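/- Let $\mathbb S$ be the unit circle; identify functions on $\mathbb S$ with $2\pi$-periodic functions of $\theta\in\mathbb R$, and give $C^\infty(\mathbb S)$ its usual topology (uniform convergence of all derivatives). Let $\Lambda:C^\infty(\mathbb S)\to C^\infty(\mathbb S)$ be the Dirichlet-to-Neumann operator of the unit disk, $\Lambda e^{in\theta}=|n|e^{in\theta}$ for $n\in\mathbb Z$. For a positive function $a\in C^\infty(\mathbb S)$ let $0=\lambda_0(a)<\lambda_1(a)\le\lambda_2(a)\le\cdots$ be the eigenvalues, repeated according to multiplicity, of the operator $\Lambda_a=a^{1/2}\Lambda a^{1/2}$ on $C^\infty(\mathbb S)$, and let $\zeta_a(z)=\sum_{k\ge1}\lambda_k(a)^{-z}$ for $\operatorname{Re}z>1$. Let $\zeta_R$ be the Riemann zeta function. (i) There is a real number $s_0>2$ such that $$\zeta_R(s-1)+s\,\zeta_R'(s-1)<0\qquad\text{for all } s\in(2,s_0).\tag{$*$}$$ (ii) Let $s_0>2$ be any real number for which $(*)$ holds. Then for every neighborhood $\mathcal U$ of the constant function $1$ in the space of real-valued functions in $C^\infty(\mathbb S)$ and every $s\in(2,s_0)$ there is a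 positive function $a\in\mathcal U$ with $$\frac1{2\pi}\int_0^{2\pi}\frac{d\theta}{a(\theta)}=1$$ such that the series defining $\zeta_a(z)$ converges absolutely for all $z$ with $\operatorname{Re}z>1$, $\zeta_a$ is differentiable at $s$, and $$\zeta_a'(s)<2\,\zeta_R'(s).$$ -/

import Mathlib

open Filter Topology Set
open scoped ContDiff ComplexOrder Real

noncomputable section

namespace Steklov

/-- The space `C^∞(𝕊)` of smooth `𝕜`-valued functions on the unit circle, a function `b` on the
circle being identified with the smooth `2π`-periodic function `θ ↦ b (e^{iθ})`. -/
structure SmoothCircle (𝕜 : Type) [RCLike 𝕜] where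
  /-- the function of the angle -/
  toFun : ℝ → 𝕜
  contDiff' : ContDiff ℝ ∞ toFun
  periodic' : Function.Periodic toFun (2 * π)

namespace SmoothCircle

variable {𝕜 : Type} [RCLike 𝕜]

instance : CoeFun (SmoothCircle 𝕜) (fun _ => ℝ → 𝕜) := ⟨SmoothCircle.toFun⟩

@[ext] theorem ext {f g : SmoothCircle 𝕜} (h : ∀ θ, f θ = g θ) : f = g := by
  cases f; cases g; congr; exact funext h

theorem contDiff (f : SmoothCircle 𝕜) : ContDiff ℝ ∞ (f : ℝ → 𝕜) := f.contDiff'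

theorem periodic (f : SmoothCircle 𝕜) : Function.Periodic (f : ℝ → 𝕜) (2 * π) := f.periodic'

instance : Zero (SmoothCircle 𝕜) := ⟨⟨fun _ => 0, contDiff_const, fun _ => rfl⟩⟩

instance : Add (SmoothCircle 𝕜) :=
  ⟨fun f g => ⟨fun θ => f θ + g θ, f.contDiff.add g.contDiff, f.periodic.add g.periodic⟩⟩

instance : Neg (SmoothCircle 𝕜) :=
  ⟨fun f => ⟨fun θ => -f θ, f.contDiff.neg, fun θ => congrArg Neg.neg (f.periodic θ)⟩⟩

instance : SMul 𝕜 (SmoothCircle 𝕜) :=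
  ⟨fun c f => ⟨fun θ => c * f θ, contDiff_const.mul f.contDiff,
    fun θ => congrArg (c * ·) (f.periodic θ)⟩⟩

@[simp] theorem zero_apply (θ : ℝ) : (0 : SmoothCircle 𝕜) θ = 0 := rfl

@[simp] theorem add_apply (f g : SmoothCircle 𝕜) (θ : ℝ) : (f + g) θ = f θ + g θ := rfl

@[simp] theorem neg_apply (f : SmoothCircle 𝕜) (θ : ℝ) : (-f) θ = -f θ := rfl

@[simp] theorem smul_apply (c : 𝕜) (f : SmoothCircle 𝕜) (θ : ℝ) : (c • f) θ = c * f θ := rfl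

instance : AddCommGroup (SmoothCircle 𝕜) where
  add_assoc f g h := by ext θ; simp [add_assoc]
  zero_add f := by ext θ; simp
  add_zero f := by ext θ; simp
  neg_add_cancel f := by ext θ; simp
  add_comm f g := by ext θ; simp [add_comm]
  nsmul := nsmulRec
  zsmul := zsmulRec

instance : Module 𝕜 (SmoothCircle 𝕜) where
  one_smul f := by ext θ; simp
  mul_smul c d f := by ext θ; simp [mul_assoc]
  smul_zero c := by ext θ; simp
  smul_add c f g := by ext θ; simp [mul_add]
  add_smul c d f := by ext θ; simp [add_mul]
  zero_smul f := by ext θ; simp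

/-- The constant function equal to `1`. -/
instance : One (SmoothCircle 𝕜) := ⟨⟨fun _ => 1, contDiff_const, fun _ => rfl⟩⟩

/-- The usual topology of `C^∞(𝕊)`: uniform convergence of the derivatives of every order. -/
instance : TopologicalSpace (SmoothCircle 𝕜) :=
  ⨅ k : ℕ, TopologicalSpace.induced
    (fun f : SmoothCircle 𝕜 => UniformFun.ofFun (iteratedDeriv k (f : ℝ → 𝕜))) inferInstance

@[simp] theorem one_apply (θ : ℝ) : (1 : SmoothCircle 𝕜) θ = 1 := rfl

end SmoothCircle

/-- The Fourier coefficient `(1/2π) ∫_0^{2π} f(θ) e^{-inθ} dθ`. -/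
def coeff (f : ℝ → ℂ) (n : ℤ) : ℂ := fourierCoeffOn Real.two_pi_pos f n

theorem coeff_eq (f : ℝ → ℂ) (n : ℤ) :
    coeff f n = (1 / (2 * π)) * ∫ θ in (0 : ℝ)..(2 * π), Complex.exp (-(n * θ * Complex.I)) * f θ := by
  rw [coeff, fourierCoeffOn_eq_integral]
  simp only [sub_zero, Complex.real_smul, smul_eq_mul]
  push_cast
  congr 1
  refine intervalIntegral.integral_congr fun θ _ => ?_
  simp only [fourier_coe_apply]
  congr 2
  push_cast
  have : (π : ℂ) ≠ 0 := by exact_mod_cast Real.pi_ne_zero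
  rw [sub_zero]
  field_simp

theorem coeff_add {f g : ℝ → ℂ} (hf : Continuous f) (hg : Continuous g) (n : ℤ) :
    coeff (fun θ => f θ + g θ) n = coeff f n + coeff g n := by
  simp only [coeff_eq, mul_add]
  rw [intervalIntegral.integral_add, mul_add] <;>
    exact (by fun_prop : Continuous _).intervalIntegrable _ _

theorem coeff_smul (c : ℂ) (f : ℝ → ℂ) (n : ℤ) :
    coeff (fun θ => c * f θ) n = c * coeff f n :=
  fourierCoeffOn.const_mul f c n _

theorem norm_coeff_le {f : ℝ → ℂ} {C : ℝ} (hC : ∀ θ, ‖f θ‖ ≤ C) (n : ℤ) : ‖coeff f n‖ ≤ C := by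
  have hp := Real.two_pi_pos
  rw [coeff_eq, norm_mul]
  have h := intervalIntegral.norm_integral_le_of_norm_le_const (a := 0) (b := 2 * π) (C := C)
    (f := fun θ : ℝ => Complex.exp (-(n * θ * Complex.I)) * f θ) (fun θ _ => by
      have : ‖Complex.exp (-(n * θ * Complex.I))‖ = 1 := by
        rw [Complex.norm_exp]; simp
      rw [norm_mul, this, one_mul]; exact hC θ)
  have h2 : ‖(1 / (2 * π) : ℂ)‖ = 1 / (2 * π) := by
    rw [norm_div, norm_mul]; simp [abs_of_pos Real.pi_pos]
  rw [sub_zero, abs_of_pos hp] at h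
  rw [h2, one_div, inv_mul_le_iff₀ hp]
  linarith

theorem coeff_deriv (f : SmoothCircle ℂ) (n : ℤ) :
    coeff (deriv f) n = n * Complex.I * coeff f n := by
  have hd : ∀ x, HasDerivAt f (deriv f x) x := fun x =>
    (f.contDiff.differentiable (by simp) x).hasDerivAt
  have hc : Continuous (deriv (f : ℝ → ℂ)) := f.contDiff.continuous_deriv (by simp)
  have hper : f (2 * π) = f 0 := by simpa using f.periodic 0
  have hE : ∀ x : ℝ, HasDerivAt (fun θ : ℝ => Complex.exp (-(n * θ * Complex.I)))
      (Complex.exp (-(n * x * Complex.I)) * (-(n * Complex.I))) x := by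
    intro x
    have h1 : HasDerivAt (fun θ : ℝ => -((n : ℂ) * θ * Complex.I)) (-(n * Complex.I)) x := by
      have := ((Complex.ofRealCLM.hasDerivAt (x := x)).const_mul (n : ℂ)).mul_const Complex.I
      simpa using! this.neg
    exact h1.cexp
  have key := intervalIntegral.integral_mul_deriv_eq_deriv_mul (a := 0) (b := 2 * π)
    (fun x _ => hE x) (fun x _ => hd x)
    ((by fun_prop : Continuous _).intervalIntegrable _ _) (hc.intervalIntegrable _ _)
  have e1 : Complex.exp (-(n * ((2 * π : ℝ) : ℂ) * Complex.I)) = 1 := by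
    rw [Complex.exp_eq_one_iff]
    exact ⟨-n, by push_cast; ring⟩
  rw [coeff_eq, coeff_eq, key, e1, hper]
  simp only [Complex.ofReal_zero, mul_zero, zero_mul, neg_zero, Complex.exp_zero, one_mul, sub_self,
    zero_sub]
  rw [← intervalIntegral.integral_neg, mul_left_comm]
  congr 1
  rw [← intervalIntegral.integral_const_mul]
  refine intervalIntegral.integral_congr fun θ _ => ?_
  ring

/-- The derivative of a smooth function on the circle. -/
def derivCircle (f : SmoothCircle ℂ) : SmoothCircle ℂ :=
  ⟨deriv f, (contDiff_infty_iff_deriv.1 f.contDiff).2, fun x => by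
    rw [← deriv_comp_add_const]
    congr 1
    funext y
    exact f.periodic y⟩

theorem exists_bound (f : SmoothCircle ℂ) : ∃ C : ℝ, ∀ θ, ‖f θ‖ ≤ C := by
  obtain ⟨C, hC⟩ := (isCompact_Icc (a := (0 : ℝ)) (b := 2 * π)).exists_bound_of_continuousOn
    f.contDiff.continuous.continuousOn
  refine ⟨C, fun θ => ?_⟩
  obtain ⟨y, hy, h⟩ := f.periodic.exists_mem_Ico₀ Real.two_pi_pos θ
  rw [h]
  exact hC y ⟨hy.1, hy.2.le⟩

/-- The Fourier coefficients of a smooth function decay faster than any power. -/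
theorem coeff_decay (f : SmoothCircle ℂ) (k : ℕ) :
    ∃ C : ℝ, ∀ n : ℤ, |(n : ℝ)| ^ k * ‖coeff f n‖ ≤ C := by
  induction k generalizing f with
  | zero =>
    obtain ⟨C, hC⟩ := exists_bound f
    exact ⟨C, fun n => by simpa using norm_coeff_le hC n⟩
  | succ k ih =>
    obtain ⟨C, hC⟩ := ih (derivCircle f)
    refine ⟨C, fun n => ?_⟩
    have h := hC n
    have e : coeff (derivCircle f) n = n * Complex.I * coeff f n := coeff_deriv f n
    rw [e] at h
    simp only [norm_mul, Complex.norm_I, mul_one, Complex.norm_intCast] at h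
    rw [pow_succ, mul_assoc]
    exact h

theorem summable_coeff (f : SmoothCircle ℂ) (k : ℕ) :
    Summable fun n : ℤ => |(n : ℝ)| ^ k * ‖coeff f n‖ := by
  obtain ⟨C, hC⟩ := coeff_decay f (k + 2)
  have hs : Summable fun n : ℤ => C * (1 / (n : ℝ) ^ 2) :=
    (Real.summable_one_div_int_pow.2 one_lt_two).mul_left C
  refine Summable.of_norm_bounded_eventually hs ?_
  refine (Set.finite_singleton (0 : ℤ)).subset fun n hn => ?_
  by_contra h0
  apply hn
  have hn0 : (n : ℝ) ≠ 0 := by exact_mod_cast h0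
  have hpos : 0 < (n : ℝ) ^ 2 := by positivity
  show ‖|(n : ℝ)| ^ k * ‖coeff f n‖‖ ≤ C * (1 / (n : ℝ) ^ 2)
  rw [Real.norm_of_nonneg (by positivity), mul_one_div, le_div_iff₀ hpos, ← sq_abs]
  calc _ = |(n : ℝ)| ^ (k + 2) * ‖coeff f n‖ := by ring
    _ ≤ C := hC n

/-- The function `Λ f = ∑_n |n| f̂(n) e^{inθ}`. -/
def dtnFun (f : ℝ → ℂ) (θ : ℝ) : ℂ :=
  ∑' n : ℤ, ((|(n : ℝ)| : ℝ) : ℂ) * coeff f n * Complex.exp (n * Complex.I * θ)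

theorem norm_exp_int (n : ℤ) (θ : ℝ) : ‖Complex.exp (n * Complex.I * θ)‖ = 1 := by
  rw [Complex.norm_exp]; simp

theorem summable_dtn (f : SmoothCircle ℂ) (θ : ℝ) :
    Summable fun n : ℤ => ((|(n : ℝ)| : ℝ) : ℂ) * coeff f n * Complex.exp (n * Complex.I * θ) := by
  refine Summable.of_norm_bounded (summable_coeff f 1) fun n => ?_
  rw [norm_mul, norm_mul, norm_exp_int]
  simp

theorem contDiff_dtnFun (f : SmoothCircle ℂ) : ContDiff ℝ ∞ (dtnFun f) := by
  refine contDiff_tsum (N := (⊤ : ℕ∞)) (𝕜 := ℝ)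
    (v := fun k (n : ℤ) => |(n : ℝ)| ^ (k + 1) * ‖coeff f n‖) ?_
    (fun k _ => summable_coeff f (k + 1)) ?_
  · intro n
    exact contDiff_const.mul ((contDiff_const.mul Complex.ofRealCLM.contDiff).cexp)
  · intro k n x _
    have hit : ∀ k : ℕ, iteratedDeriv k (fun θ : ℝ => Complex.exp (n * Complex.I * θ))
        = fun θ : ℝ => (n * Complex.I) ^ k * Complex.exp (n * Complex.I * θ) := by
      intro k
      induction k with
      | zero => simp
      | succ k ih =>
        rw [iteratedDeriv_succ, ih]
        funext θ
        have h1 : HasDerivAt (fun θ : ℝ => (n : ℂ) * Complex.I * θ) (n * Complex.I) θ := by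
          simpa using (Complex.ofRealCLM.hasDerivAt (x := θ)).const_mul ((n : ℂ) * Complex.I)
        rw [(h1.cexp.const_mul _).deriv]
        ring
    rw [norm_iteratedFDeriv_eq_norm_iteratedDeriv, iteratedDeriv_const_mul_field, hit, norm_mul,
      norm_mul, norm_mul, norm_exp_int, norm_pow]
    simp only [norm_mul, Complex.norm_I, mul_one, Complex.norm_intCast, Complex.norm_real,
      Real.norm_eq_abs, abs_abs]
    apply le_of_eq
    ring

theorem periodic_dtnFun (f : ℝ → ℂ) : Function.Periodic (dtnFun f) (2 * π) := by
  intro θ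
  refine tsum_congr fun n => ?_
  congr 1
  rw [Complex.exp_eq_exp_iff_exists_int]
  exact ⟨n, by push_cast; ring⟩

/-- The Dirichlet-to-Neumann operator `Λ : C^∞(𝕊) → C^∞(𝕊)` of the unit disk,
`Λ e^{inθ} = |n| e^{inθ}`. -/
def dtn : Module.End ℂ (SmoothCircle ℂ) where
  toFun f := ⟨dtnFun f, contDiff_dtnFun f, periodic_dtnFun f⟩
  map_add' f g := by
    ext θ
    change dtnFun (fun θ => f θ + g θ) θ = dtnFun f θ + dtnFun g θ
    simp only [dtnFun]
    rw [← (summable_dtn f θ).tsum_add (summable_dtn g θ)]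
    refine tsum_congr fun n => ?_
    rw [coeff_add f.contDiff.continuous g.contDiff.continuous]
    ring
  map_smul' c f := by
    ext θ
    change dtnFun (fun θ => c * f θ) θ = c * dtnFun f θ
    simp only [dtnFun]
    rw [← tsum_mul_left]
    refine tsum_congr fun n => ?_
    rw [coeff_smul]
    ring

/-- The operator of multiplication by a real function `b ∈ C^∞(𝕊)`. -/
def mulOp (b : SmoothCircle ℝ) : Module.End ℂ (SmoothCircle ℂ) where
  toFun f := ⟨fun θ => (b θ : ℂ) * f θ,
    (Complex.ofRealCLM.contDiff.comp b.contDiff).mul f.contDiff,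
    fun θ => by
      show ((b (θ + 2 * π) : ℝ) : ℂ) * f (θ + 2 * π) = _
      rw [b.periodic θ, f.periodic θ]⟩
  map_add' f g := by
    ext θ
    exact mul_add _ _ _
  map_smul' c f := by
    ext θ
    exact mul_left_comm _ _ _

/-- The square root `a^{1/2}` of a positive function `a ∈ C^∞(𝕊)`. -/
def sqrtFun (a : SmoothCircle ℝ) (ha : ∀ θ, 0 < a θ) : SmoothCircle ℝ :=
  ⟨fun θ => √(a θ), a.contDiff.sqrt fun θ => (ha θ).ne', fun θ => by
    show √(a (θ + 2 * π)) = _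
    rw [a.periodic θ]⟩

/-- The operator `Λ_a = a^{1/2} Λ a^{1/2}` on `C^∞(𝕊)`, for a positive `a ∈ C^∞(𝕊)`. -/
def steklovOp (a : SmoothCircle ℝ) (ha : ∀ θ, 0 < a θ) : Module.End ℂ (SmoothCircle ℂ) :=
  mulOp (sqrtFun a ha) * dtn * mulOp (sqrtFun a ha)

/-- The eigenvalues `λ_0(a) ≤ λ_1(a) ≤ …` of `Λ_a`, repeated according to multiplicity: `λ_k(a)` is
the least `t` such that the eigenspaces of `Λ_a` for the eigenvalues `μ ≤ t` together span a space
of dimension at least `k + 1`. -/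
def steklovEigenvalue (a : SmoothCircle ℝ) (ha : ∀ θ, 0 < a θ) (k : ℕ) : ℝ :=
  sInf {t : ℝ | ((k + 1 : ℕ) : Cardinal) ≤
    Module.rank ℂ ↥(⨆ μ : {μ : ℝ // μ ≤ t}, (steklovOp a ha).eigenspace ((μ : ℝ) : ℂ))}

/-- The zeta function `ζ_a(z) = ∑_{k ≥ 1} λ_k(a)^{-z}`, in the half-plane `Re z > 1` where the
series converges. -/
def steklovZeta (a : SmoothCircle ℝ) (ha : ∀ θ, 0 < a θ) (z : ℂ) : ℂ :=
  ∑' k : ℕ, (steklovEigenvalue a ha (k + 1) : ℂ) ^ (-z)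

end Steklov

end

/-! ### Fourier coefficients and trigonometric series on the circle. -/

namespace Steklov

/-! The competitor is `a = 1 / (1 + 2 ε cos Nθ)` with `N` odd and `ε` small; the normalization holds
because the cosine has mean zero. For `u = a^{1/2} f`, the equation `Λ_a f = λ f` becomes `|n| û(n)
= λ (û(n) + ε (û(n+N) + û(n-N)))`. If `λ ≠ 0`, the equation at `n = 0` gives `û(0) = -ε (û(N) +
û(-N))`. Eliminating this mode and putting `w_n = |n|^{1/2} û(n)` turns the problem into `T_ε w =
λ⁻¹ w`, where `T_ε` (`invOp`) is a compact self-adjoint operator on `ℓ²(ℤ)`, quadratic in `ε`, with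
`T_0 = diag(1/|n|)`. So the `λ_k(a)`, `k ≥ 1`, are the inverses of the nonzero eigenvalues `μ_j` of
`T_ε`, with multiplicities (`exists_equiv_steklovEigenvalue`). With `f(x) = x^s log x` this gives
`ζ_a'(s) = ∑ f(μ_j)` and `2 ζ_R'(s) = ∑_n f(1/|n|)`, and the task is to make the trace of `f(T_ε)`
smaller than that of `f(T_0)`.

No expansion of individual eigenvalues is needed. There is a one-sided bound `f(y) ≤ f(x) + f'(x)(y
- x) + K (y - x)²` (`exists_kernel_le`). Averaging it over the spectral measure of each vector of an
arbitrary Hilbert basis `φ_n`, with `x = 1/|n|`, bounds the trace of `f(T_ε)` by `∑ f(1/|n|) +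
f'(1/|n|) (⟨φ_n, T_ε φ_n⟩ - 1/|n|) + K ‖(T_ε - 1/|n|) φ_n‖²`. Here `φ_n = exp(εS) e_n`, where the
finite-rank skew-adjoint `S` cancels the first order coupling among the frequencies `0 < |n| ≤ R`.
Divided by `ε²`, the excess tends to `traceCoeff` as `ε → 0`. As `R → ∞` the terms with `K`
disappear and there remains `∑ f'(1/|n|) fullShift N n` (`tendsto_traceCoeff`), the formal second
order perturbation. Oddness of `N` makes `|n| ≠ |n ± N|`, so no degenerate denominator occurs.

The shift equals `1/N + 1/(N - 2|n|)` for `0 < |n| ≤ N` and vanishes for `|n| > N` (`fullShift_eq`).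
Up to a positive factor the sum is therefore `∑_{n ≤ N} F(n) (1 + N/(N - 2n))` with `F(n) =
f'(1/n)`. Pairing `n` with `N - n` and using that `F` is eventually increasing, it is bounded above
by a quantity tending, as `N → ∞`, to `∑ F` plus a negative partial sum of `F`
(`eventually_weighted_sum_neg`). Since `∑ F = ζ_R(s-1) + s ζ_R'(s-1)`, condition `(*)` makes this
limit negative.

For (i), `∑ F` has only finitely many terms that could be positive when `s > 2`, and its first eight
terms already have a negative sum at `s = 2`. -/

theorem coeff_exp_mul (f : ℝ → ℂ) (N n : ℤ) :
    coeff (fun θ => Complex.exp (N * Complex.I * θ) * f θ) n = coeff f (n - N) := by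
  rw [coeff_eq, coeff_eq]
  congr 1
  refine intervalIntegral.integral_congr fun θ _ => ?_
  rw [← mul_assoc, ← Complex.exp_add]
  congr 2
  push_cast
  ring

theorem coeff_const (c : ℂ) (n : ℤ) : coeff (fun _ => c) n = if n = 0 then c else 0 := by
  rw [coeff_eq, intervalIntegral.integral_mul_const]
  split_ifs with h
  · subst h
    have : (π : ℂ) ≠ 0 := by exact_mod_cast Real.pi_ne_zero
    simp
    field_simp
  · have hne : -((n : ℂ) * Complex.I) ≠ 0 := by simp [h]
    have : ∫ θ in (0 : ℝ)..(2 * π), Complex.exp (-(n * θ * Complex.I)) = 0 := by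
      have := integral_exp_mul_complex (a := 0) (b := 2 * π) hne
      have e : ∀ θ : ℝ, -((n : ℂ) * θ * Complex.I) = -((n : ℂ) * Complex.I) * θ := fun θ => by ring
      simp only [e]
      rw [this]
      have e1 : Complex.exp (-((n : ℂ) * Complex.I) * ((2 * π : ℝ) : ℂ)) = 1 := by
        rw [Complex.exp_eq_one_iff]
        exact ⟨-n, by push_cast; ring⟩
      rw [e1]
      simp
    rw [this]
    simp

theorem coeff_exp (N n : ℤ) :
    coeff (fun θ => Complex.exp (N * Complex.I * θ)) n = if n = N then 1 else 0 := by
  have := coeff_exp_mul (fun _ => 1) N n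
  simp only [mul_one] at this
  rw [this, coeff_const]
  simp [sub_eq_zero]

/-- The trigonometric series with coefficients `c`. -/
noncomputable def trigSeries (c : ℤ → ℂ) (θ : ℝ) : ℂ :=
  ∑' n : ℤ, c n * Complex.exp (n * Complex.I * θ)

theorem coeff_trigSeries {c : ℤ → ℂ} (hc : Summable fun n => ‖c n‖) (m : ℤ) :
    coeff (trigSeries c) m = c m := by
  have hs := intervalIntegral.hasSum_intervalIntegral_of_summable_norm (a := 0) (b := 2 * π)
    (f := fun n : ℤ => ⟨fun θ : ℝ => Complex.exp (-(m * θ * Complex.I)) *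
      (c n * Complex.exp (n * Complex.I * θ)), by fun_prop⟩) (by
    refine Summable.of_nonneg_of_le (fun _ => norm_nonneg _) (fun n => ?_) hc
    refine (ContinuousMap.norm_le _ (norm_nonneg _)).2 fun θ => ?_
    have h1 : ‖Complex.exp (-(m * (θ : ℝ) * Complex.I))‖ = 1 := by
      rw [Complex.norm_exp]; simp
    simp only [ContinuousMap.restrict_apply, ContinuousMap.coe_mk]
    rw [norm_mul, norm_mul, norm_exp_int, h1]
    simp)
  have hs2 := hs.mul_left (1 / (2 * π) : ℂ)
  rw [coeff_eq]
  have e : ∀ θ : ℝ, Complex.exp (-(m * θ * Complex.I)) * trigSeries c θ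
      = ∑' n : ℤ, Complex.exp (-(m * θ * Complex.I)) * (c n * Complex.exp (n * Complex.I * θ)) :=
    fun θ => by rw [trigSeries, tsum_mul_left]
  simp only [e]
  simp only [ContinuousMap.coe_mk] at hs2
  refine hs2.unique ?_
  have e2 : ∀ n : ℤ, (1 / (2 * π) : ℂ) * ∫ θ in (0 : ℝ)..(2 * π),
      Complex.exp (-(m * θ * Complex.I)) * (c n * Complex.exp (n * Complex.I * θ))
      = if n = m then c m else 0 := fun n => by
    rw [← coeff_eq, coeff_smul, coeff_exp]
    by_cases h : n = m
    · simp [h]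
    · simp [h, Ne.symm h]
  simp only [e2]
  exact hasSum_ite_eq m (c m)

theorem periodic_trigSeries (c : ℤ → ℂ) : Function.Periodic (trigSeries c) (2 * π) := by
  intro θ
  refine tsum_congr fun n => ?_
  congr 1
  rw [Complex.exp_eq_exp_iff_exists_int]
  exact ⟨n, by push_cast; ring⟩

theorem contDiff_trigSeries {c : ℤ → ℂ} (hc : ∀ k : ℕ, Summable fun n : ℤ => |(n : ℝ)| ^ k * ‖c n‖) :
    ContDiff ℝ ∞ (trigSeries c) := by
  refine contDiff_tsum (N := (⊤ : ℕ∞)) (𝕜 := ℝ)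
    (v := fun k (n : ℤ) => |(n : ℝ)| ^ k * ‖c n‖) ?_ (fun k _ => hc k) ?_
  · intro n
    exact contDiff_const.mul ((contDiff_const.mul Complex.ofRealCLM.contDiff).cexp)
  · intro k n x _
    have hit : ∀ k : ℕ, iteratedDeriv k (fun θ : ℝ => Complex.exp (n * Complex.I * θ))
        = fun θ : ℝ => (n * Complex.I) ^ k * Complex.exp (n * Complex.I * θ) := by
      intro k
      induction k with
      | zero => simp
      | succ k ih =>
        rw [iteratedDeriv_succ, ih]
        funext θ
        have h1 : HasDerivAt (fun θ : ℝ => (n : ℂ) * Complex.I * θ) (n * Complex.I) θ := by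
          simpa using (Complex.ofRealCLM.hasDerivAt (x := θ)).const_mul ((n : ℂ) * Complex.I)
        rw [(h1.cexp.const_mul _).deriv]
        ring
    rw [norm_iteratedFDeriv_eq_norm_iteratedDeriv, iteratedDeriv_const_mul_field, hit, norm_mul,
      norm_mul, norm_exp_int, norm_pow]
    simp only [norm_mul, Complex.norm_I, mul_one, Complex.norm_intCast]
    apply le_of_eq
    ring

theorem norm_coeff_summable (f : SmoothCircle ℂ) : Summable fun n : ℤ => ‖coeff f n‖ := by
  simpa using summable_coeff f 0

/-- Smoothness makes the coefficients absolutely summable, so the Fourier series on `AddCircle`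
converges pointwise to the function. -/
theorem eq_trigSeries_coeff (f : SmoothCircle ℂ) (θ : ℝ) : f θ = trigSeries (coeff f) θ := by
  have : Fact (0 < 2 * π) := ⟨Real.two_pi_pos⟩
  let F : C(AddCircle (2 * π), ℂ) := ⟨f.periodic.lift,
    continuous_coinduced_dom.mpr f.contDiff.continuous⟩
  have hF : ∀ x : ℝ, F (x : AddCircle (2 * π)) = f x := fun x => f.periodic.lift_coe x
  have hco : ∀ n, fourierCoeff F n = coeff f n := fun n => by
    rw [fourierCoeff_eq_intervalIntegral F n 0, coeff, fourierCoeffOn_eq_integral]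
    simp only [hF, zero_add]
    congr 1
    · rw [sub_zero]
    · simp only [fourier_coe_apply, sub_zero]
  have hsum : Summable (fourierCoeff F) := by
    have : fourierCoeff F = coeff f := funext hco
    rw [this]
    exact (norm_coeff_summable f).of_norm
  have h := (has_pointwise_sum_fourier_series_of_summable hsum (θ : AddCircle (2 * π))).tsum_eq
  rw [hF] at h
  rw [← h, trigSeries]
  refine tsum_congr fun n => ?_
  rw [hco, fourier_coe_apply, smul_eq_mul]
  congr 2
  have : (π : ℂ) ≠ 0 := by exact_mod_cast Real.pi_ne_zero
  push_cast
  field_simp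

theorem ext_coeff {f g : SmoothCircle ℂ} (h : ∀ n, coeff f n = coeff g n) : f = g := by
  ext θ
  rw [eq_trigSeries_coeff f, eq_trigSeries_coeff g, funext h]

theorem coeff_dtn (f : SmoothCircle ℂ) (n : ℤ) : coeff (dtn f) n = (|(n : ℝ)| : ℝ) * coeff f n :=
  coeff_trigSeries (c := fun n => ((|(n : ℝ)| : ℝ) : ℂ) * coeff f n)
    (by simpa using summable_coeff f 1) n

/-- A sequence decaying faster than any power is the sequence of Fourier coefficients of a smooth
function. -/
theorem exists_coeff_eq {c : ℤ → ℂ} (hc : ∀ k : ℕ, ∃ C : ℝ, ∀ n : ℤ, (1 + |(n : ℝ)|) ^ k * ‖c n‖ ≤ C) :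
    ∃ f : SmoothCircle ℂ, ∀ n, coeff f n = c n := by
  have hs : ∀ k : ℕ, Summable fun n : ℤ => |(n : ℝ)| ^ k * ‖c n‖ := by
    intro k
    obtain ⟨C, hC⟩ := hc (k + 2)
    have hs : Summable fun n : ℤ => C * (1 / (n : ℝ) ^ 2) :=
      (Real.summable_one_div_int_pow.2 one_lt_two).mul_left C
    refine Summable.of_norm_bounded_eventually hs ?_
    refine (Set.finite_singleton (0 : ℤ)).subset fun n hn => ?_
    by_contra h0
    apply hn
    have hn0 : (n : ℝ) ≠ 0 := by exact_mod_cast h0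
    have hpos : 0 < (n : ℝ) ^ 2 := by positivity
    show ‖|(n : ℝ)| ^ k * ‖c n‖‖ ≤ C * (1 / (n : ℝ) ^ 2)
    rw [Real.norm_of_nonneg (by positivity), mul_one_div, le_div_iff₀ hpos, ← sq_abs]
    calc _ = |(n : ℝ)| ^ (k + 2) * ‖c n‖ := by ring
      _ ≤ (1 + |(n : ℝ)|) ^ (k + 2) * ‖c n‖ := by gcongr; linarith [abs_nonneg (n : ℝ)]
      _ ≤ C := hC n
  exact ⟨⟨trigSeries c, contDiff_trigSeries hs, periodic_trigSeries c⟩,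
    fun n => coeff_trigSeries (by simpa using hs 0) n⟩

end Steklov

/-! ### Sums against stochastic weights. -/

section Stochastic

variable {J ι : Type*} {p : J → ι → ℝ}

/-- Tonelli: the rows of `p` sum to one, so summing `p j n * g j` over `n` first gives back `g j`.
The weights in use are `p j n = |⟨ψ_j, φ_n⟩|²` for two Hilbert bases. -/
theorem summable_of_stochastic (hp : ∀ j n, 0 ≤ p j n) (hrow : ∀ j, HasSum (p j) 1) {g : J → ℝ}
    (hg : ∀ j, 0 ≤ g j) {s b : ι → ℝ} (hs : ∀ n, HasSum (fun j => p j n * g j) (s n))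
    (hsb : ∀ n, s n ≤ b n) (hb : Summable b) : Summable g := by
  have hs0 : ∀ n, 0 ≤ s n := fun n => (hs n).nonneg fun j => mul_nonneg (hp _ _) (hg j)
  have hss : Summable s := Summable.of_nonneg_of_le hs0 hsb hb
  have hprod : Summable fun q : ι × J => p q.2 q.1 * g q.2 := by
    rw [summable_prod_of_nonneg (fun q => mul_nonneg (hp _ _) (hg _))]
    exact ⟨fun n => (hs n).summable, by simpa only [(hs _).tsum_eq] using hss⟩
  have := ((summable_prod_of_nonneg (f := fun q : J × ι => p q.1 q.2 * g q.1)
    (fun q => mul_nonneg (hp _ _) (hg _))).1 hprod.prod_symm).2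
  refine this.congr fun j => ?_
  simpa using ((hrow j).mul_right (g j)).tsum_eq

/-- Here `g` may change sign, so absolute summability is assumed and Fubini replaces Tonelli. This
is how a bound in each vector of a test basis becomes a bound on a trace. -/
theorem tsum_le_of_stochastic (hp : ∀ j n, 0 ≤ p j n) (hrow : ∀ j, HasSum (p j) 1) {g : J → ℝ}
    (hg : Summable g) {b : ι → ℝ} (hsb : ∀ n, ∑' j, p j n * g j ≤ b n) (hb : Summable b) :
    ∑' j, g j ≤ ∑' n, b n := by
  have hrow' : ∀ j (c : ℝ), HasSum (fun n => p j n * c) c := fun j c => by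
    simpa using (hrow j).mul_right c
  have hprod : Summable fun q : J × ι => p q.1 q.2 * g q.1 := by
    rw [← summable_abs_iff]
    have : ∀ q : J × ι, |p q.1 q.2 * g q.1| = p q.1 q.2 * |g q.1| := fun q => by
      rw [abs_mul, abs_of_nonneg (hp _ _)]
    simp only [this]
    rw [summable_prod_of_nonneg (fun q => mul_nonneg (hp _ _) (abs_nonneg _))]
    exact ⟨fun j => (hrow' j |g j|).summable, hg.abs.congr fun j => (hrow' j |g j|).tsum_eq.symm⟩
  have hcomm : ∑' n, ∑' j, p j n * g j = ∑' j, ∑' n, p j n * g j :=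
    Summable.tsum_comm (f := fun j n => p j n * g j) hprod
  have hcol : Summable fun n => ∑' j, p j n * g j :=
    Summable.prod (f := fun q : ι × J => p q.2 q.1 * g q.2) hprod.prod_symm
  have e1 : ∑' j, g j = ∑' j, ∑' n, p j n * g j := tsum_congr fun j => (hrow' j _).tsum_eq.symm
  rw [e1, ← hcomm]
  exact Summable.tsum_le_tsum hsb hcol hb

end Stochastic

/-! ### Compact self-adjoint operators and spectral averages. -/

section HilbertSpace

universe u

variable {H : Type u} [NormedAddCommGroup H] [InnerProductSpace ℂ H]

/-- An orthogonal family of complete subspaces with dense sum has an adapted Hilbert basis. -/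
theorem exists_hilbertBasis_of_orthogonalFamily [CompleteSpace H] {ι : Type}
    (V : ι → Submodule ℂ H) [hcomp : ∀ c, CompleteSpace (V c)]
    (hV : OrthogonalFamily ℂ (fun c => V c) fun c => (V c).subtypeₗᵢ) (hbot : (⨆ c, V c)ᗮ = ⊥) :
    ∃ (J : Type u) (ψ : HilbertBasis J ℂ H) (c : J → ι), ∀ j, ψ j ∈ V (c j) := by
  choose w b hb using fun c => exists_hilbertBasis ℂ (V c)
  have hon := hV.orthonormal_sigma_orthonormal
    (v_family := fun c => ⇑(b c)) (fun c => (b c).orthonormal)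
  refine ⟨Σ c, w c, HilbertBasis.mkOfOrthogonalEqBot hon ?_, fun a => a.1, fun a => ?_⟩
  · rw [eq_bot_iff, ← hbot, ← Submodule.iInf_orthogonal]
    refine le_iInf fun c x hx => ?_
    rw [Submodule.mem_orthogonal] at hx ⊢
    intro u hu
    have key2 := ((b c).hasSum_repr ⟨u, hu⟩).mapL ((innerSL ℂ x).comp (Submodule.subtypeL _))
    have hz : ∀ i, inner ℂ x ((b c i : H)) = 0 := fun i => by
      have := hx (b c i : H) (Submodule.subset_span ⟨⟨c, i⟩, rfl⟩)
      rw [← inner_conj_symm, this, map_zero]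
    have : HasSum (fun _ : w c => (0 : ℂ)) (inner ℂ x u) := by
      convert! key2 using 1
      ext i
      simp [hz]
    rw [← inner_conj_symm, this.unique hasSum_zero, map_zero]
  · rw [HilbertBasis.coe_mkOfOrthogonalEqBot]
    exact (b a.1 a.2).2

/-- The spectral theorem for a compact self-adjoint operator, in terms of a Hilbert basis. -/
theorem exists_hilbertBasis_eigenvectors [CompleteSpace H] {T : H →L[ℂ] H}
    (hc : IsCompactOperator T) (hs : T.IsSymmetric) :
    ∃ (J : Type u) (ψ : HilbertBasis J ℂ H) (μ : J → ℝ), ∀ j, T (ψ j) = (μ j : ℂ) • ψ j := by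
  have hcomp : ∀ c : ℂ, CompleteSpace (Module.End.eigenspace (T : Module.End ℂ H) c) := by
    intro c
    have : IsClosed (Module.End.eigenspace (T : Module.End ℂ H) c : Set H) := by
      have : (Module.End.eigenspace (T : Module.End ℂ H) c : Set H) = {x | T x = c • x} := by
        ext x; simp
      rw [this]
      exact isClosed_eq T.continuous (continuous_const_smul c)
    exact this.completeSpace_coe
  obtain ⟨J, ψ, c, h⟩ := exists_hilbertBasis_of_orthogonalFamily _ hs.orthogonalFamily_eigenspaces
    (ContinuousLinearMap.orthogonalComplement_iSup_eigenspaces_eq_bot hc hs)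
  refine ⟨J, ψ, fun j => (c j).re, fun j => ?_⟩
  have hreal := hs.conj_eigenvalue_eq_self (Module.End.hasEigenvalue_of_hasEigenvector
    (μ := c j) ⟨h j, ψ.orthonormal.ne_zero j⟩)
  rw [Complex.conj_eq_iff_re.1 hreal]
  exact Module.End.mem_eigenspace_iff.1 (h j)

namespace HilbertBasis

variable {J ι : Type*}

theorem hasSum_norm_inner_sq (b : HilbertBasis J ℂ H) (x : H) :
    HasSum (fun j => ‖inner ℂ (b j) x‖ ^ 2) (‖x‖ ^ 2) := by
  have h := b.hasSum_inner_mul_inner x x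
  rw [inner_self_eq_norm_sq_to_K] at h
  have h2 := Complex.hasSum_re h
  convert! h2 using 1
  · ext j
    rw [← inner_conj_symm x, Complex.conj_mul']
    norm_cast
  · norm_cast

theorem norm_self (b : HilbertBasis J ℂ H) (j : J) : ‖b j‖ = 1 := b.orthonormal.1 j

section Eigen

variable {T : H →L[ℂ] H} {μ : J → ℝ} {ψ : HilbertBasis J ℂ H}

theorem inner_eigen (hs : T.IsSymmetric) (hμ : ∀ j, T (ψ j) = (μ j : ℂ) • ψ j) (j : J) (x : H) :
    inner ℂ (ψ j) (T x) = μ j * inner ℂ (ψ j) x := by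
  have := hs (ψ j) x
  rw [← ContinuousLinearMap.coe_coe, ← this, ContinuousLinearMap.coe_coe, hμ, inner_smul_left]
  simp

theorem hasSum_eigen_inner (hs : T.IsSymmetric) (hμ : ∀ j, T (ψ j) = (μ j : ℂ) • ψ j) (x : H) :
    HasSum (fun j => ‖inner ℂ (ψ j) x‖ ^ 2 * μ j) (inner ℂ x (T x)).re := by
  have h := Complex.hasSum_re (ψ.hasSum_inner_mul_inner x (T x))
  convert! h using 1
  ext j
  rw [inner_eigen hs hμ, ← inner_conj_symm x, mul_left_comm, Complex.conj_mul']
  norm_cast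
  ring

/-- Parseval for `(T - c) x`. For a unit vector `x` it is the second moment about `c` of the
spectral measure of `x`. -/
theorem hasSum_eigen_norm_sq (hs : T.IsSymmetric) (hμ : ∀ j, T (ψ j) = (μ j : ℂ) • ψ j) (c : ℝ)
    (x : H) :
    HasSum (fun j => ‖inner ℂ (ψ j) x‖ ^ 2 * (μ j - c) ^ 2) (‖T x - (c : ℂ) • x‖ ^ 2) := by
  convert! ψ.hasSum_norm_inner_sq (T x - (c : ℂ) • x) using 1
  ext j
  rw [inner_sub_right, inner_eigen hs hμ, inner_smul_right, ← sub_mul, norm_mul, mul_pow,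
    ← Complex.ofReal_sub, Complex.norm_real, Real.norm_eq_abs, sq_abs]
  ring

/-- An eigenvector is a finite combination of the basis eigenvectors for the same eigenvalue. -/
theorem eigenvector_mem_span (hs : T.IsSymmetric) (hμ : ∀ j, T (ψ j) = (μ j : ℂ) • ψ j) {c : ℝ}
    (hfin : {j | μ j = c}.Finite) {x : H} (hx : T x = (c : ℂ) • x) :
    x ∈ Submodule.span ℂ (ψ '' {j | μ j = c}) := by
  have h0 : ∀ j, μ j ≠ c → inner ℂ (ψ j) x = 0 := by
    intro j hj
    have h1 := inner_eigen hs hμ j x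
    rw [hx, inner_smul_right] at h1
    have h2 : ((μ j : ℂ) - c) * inner ℂ (ψ j) x = 0 := by rw [sub_mul, ← h1, sub_self]
    rcases mul_eq_zero.1 h2 with h | h
    · exact absurd (by exact_mod_cast sub_eq_zero.1 h) hj
    · exact h
  have hsum := ψ.hasSum_repr x
  have : HasSum (fun j => ψ.repr x j • ψ j) (∑ j ∈ hfin.toFinset, ψ.repr x j • ψ j) :=
    hasSum_sum_of_ne_finset_zero fun j hj => by
      rw [ψ.repr_apply_apply, h0 j (by simpa using hj), zero_smul]
  rw [hsum.unique this]
  refine Submodule.sum_mem _ fun j hj => Submodule.smul_mem _ _ (Submodule.subset_span ⟨j, ?_, rfl⟩)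
  simpa using hj

theorem eigenvalue_mem_Icc (hμ : ∀ j, T (ψ j) = (μ j : ℂ) • ψ j)
    (hpos : ∀ x, 0 ≤ (inner ℂ x (T x)).re) {C : ℝ} (hC : ‖T‖ ≤ C) (j : J) :
    μ j ∈ Set.Icc 0 C := by
  constructor
  · have := hpos (ψ j)
    rw [hμ, inner_smul_right, inner_self_eq_norm_sq_to_K, ψ.norm_self] at this
    simpa using this
  · have := (T.le_opNorm (ψ j)).trans (mul_le_mul_of_nonneg_right hC (norm_nonneg _))
    rw [hμ, norm_smul, ψ.norm_self, mul_one, mul_one, Complex.norm_real] at this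
    exact (le_abs_self _).trans this

end Eigen

/-- If the quantities `∑_j |⟨ψ_j, φ_n⟩|² g_j` are bounded by a summable sequence, then `g ≥ 0` is
summable. -/
theorem summable_of_hasSum_le (ψ : HilbertBasis J ℂ H) (φ : HilbertBasis ι ℂ H) {g : J → ℝ}
    (hg : ∀ j, 0 ≤ g j) {s b : ι → ℝ}
    (hs : ∀ n, HasSum (fun j => ‖inner ℂ (ψ j) (φ n)‖ ^ 2 * g j) (s n)) (hsb : ∀ n, s n ≤ b n)
    (hb : Summable b) : Summable g := by
  refine summable_of_stochastic (p := fun j n => ‖inner ℂ (ψ j) (φ n)‖ ^ 2)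
    (fun _ _ => sq_nonneg _) (fun j => ?_) hg hs hsb hb
  simpa only [norm_inner_symm, ψ.norm_self, one_pow] using φ.hasSum_norm_inner_sq (ψ j)

theorem tsum_le_of_hasSum_le (ψ : HilbertBasis J ℂ H) (φ : HilbertBasis ι ℂ H) {g : J → ℝ}
    (hg : Summable g) {b : ι → ℝ}
    (hsb : ∀ n, ∑' j, ‖inner ℂ (ψ j) (φ n)‖ ^ 2 * g j ≤ b n) (hb : Summable b) :
    ∑' j, g j ≤ ∑' n, b n := by
  refine tsum_le_of_stochastic (p := fun j n => ‖inner ℂ (ψ j) (φ n)‖ ^ 2)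
    (fun _ _ => sq_nonneg _) (fun j => ?_) hg hsb hb
  simpa only [norm_inner_symm, ψ.norm_self, one_pow] using φ.hasSum_norm_inner_sq (ψ j)

end HilbertBasis

end HilbertSpace

/-! ### The operator `T_ε` on `ℓ²(ℤ)`. -/

namespace Steklov

noncomputable section

/-- The Hilbert space `ℓ²(ℤ)`. -/
abbrev SeqSpace := lp (fun _ : ℤ => ℂ) 2

theorem SeqSpace.summable_norm_sq (w : SeqSpace) : Summable fun n => ‖w n‖ ^ 2 := by
  have := (lp.memℓp w).summable (by norm_num)
  simpa using this

theorem SeqSpace.norm_sq_eq (w : SeqSpace) : ‖w‖ ^ 2 = ∑' n, ‖w n‖ ^ 2 := by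
  have := lp.norm_rpow_eq_tsum (p := 2) (by norm_num) w
  simpa using this

/-- The operator `(w_n) ↦ (d_n w_{n + j})`. -/
def weightedShift (d : ℤ → ℝ) (C : ℝ) (hd : ∀ n, |d n| ≤ C) (j : ℤ) : SeqSpace →L[ℂ] SeqSpace :=
  LinearMap.mkContinuous
    { toFun := fun w => ⟨fun n => d n * w (n + j), by
        refine memℓp_gen ?_
        have h := ((Equiv.addRight j).summable_iff.2 (SeqSpace.summable_norm_sq w)).mul_left (C ^ 2)
        refine Summable.of_nonneg_of_le (fun _ => by positivity) (fun n => ?_) h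
        simp only [ENNReal.toReal_ofNat, Real.rpow_two, norm_mul, Complex.norm_real, mul_pow,
          Function.comp, Equiv.coe_addRight, Real.norm_eq_abs]
        gcongr
        exact hd n⟩
      map_add' := fun x y => by
        ext n
        exact mul_add _ _ _
      map_smul' := fun c x => by
        ext n
        exact mul_left_comm _ _ _ } C fun w => by
    have hC : 0 ≤ C := (abs_nonneg _).trans (hd 0)
    refine abs_le_of_sq_le_sq' ?_ (by positivity) |>.2
    rw [mul_pow, SeqSpace.norm_sq_eq, SeqSpace.norm_sq_eq, ← (Equiv.addRight j).tsum_eq (fun n => ‖w n‖ ^ 2),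
      ← tsum_mul_left]
    have h := ((Equiv.addRight j).summable_iff.2 (SeqSpace.summable_norm_sq w)).mul_left (C ^ 2)
    have hle : ∀ n, ‖(d n : ℂ) * w (n + j)‖ ^ 2 ≤ C ^ 2 * ‖w (n + j)‖ ^ 2 := fun n => by
      rw [norm_mul, mul_pow, Complex.norm_real, Real.norm_eq_abs]
      gcongr
      exact hd n
    exact Summable.tsum_le_tsum hle (Summable.of_nonneg_of_le (fun _ => by positivity) hle h) h

@[simp] theorem weightedShift_apply (d : ℤ → ℝ) (C : ℝ) (hd : ∀ n, |d n| ≤ C) (j : ℤ)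
    (w : SeqSpace) (n : ℤ) : weightedShift d C hd j w n = d n * w (n + j) := rfl

theorem norm_weightedShift_le (d : ℤ → ℝ) (C : ℝ) (hd : ∀ n, |d n| ≤ C) (j : ℤ) :
    ‖weightedShift d C hd j‖ ≤ C :=
  LinearMap.mkContinuous_norm_le _ ((abs_nonneg _).trans (hd 0)) _

/-- The standard Hilbert basis of `ℓ²(ℤ)`. -/
def stdBasis : HilbertBasis ℤ ℂ SeqSpace := HilbertBasis.ofRepr (LinearIsometryEquiv.refl ℂ _)

theorem stdBasis_eq (n : ℤ) : stdBasis n = lp.single 2 n (1 : ℂ) :=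
  (stdBasis.repr_symm_single n).symm

theorem stdBasis_apply (n m : ℤ) : stdBasis n m = if m = n then 1 else 0 := by
  rw [stdBasis_eq, lp.single_apply]
  split_ifs with h <;> simp [h]

theorem inner_stdBasis_left (n : ℤ) (w : SeqSpace) : inner ℂ (stdBasis n) w = w n := by
  rw [← stdBasis.repr_apply_apply]; rfl

theorem inner_stdBasis_right (n : ℤ) (w : SeqSpace) :
    inner ℂ w (stdBasis n) = (starRingEnd ℂ) (w n) := by
  rw [← inner_conj_symm, inner_stdBasis_left]

theorem inner_stdBasis_stdBasis (n m : ℤ) :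
    inner ℂ (stdBasis n) (stdBasis m) = if n = m then (1 : ℂ) else 0 := by
  rw [inner_stdBasis_left, stdBasis_apply]

@[simp] theorem norm_stdBasis (n : ℤ) : ‖stdBasis n‖ = 1 := stdBasis.norm_self n

theorem weightedShift_stdBasis (d : ℤ → ℝ) (C : ℝ) (hd : ∀ n, |d n| ≤ C) (j n : ℤ) :
    weightedShift d C hd j (stdBasis n) = (d (n - j) : ℂ) • stdBasis (n - j) := by
  ext m
  rw [weightedShift_apply, lp.coeFn_smul, Pi.smul_apply, stdBasis_apply, stdBasis_apply, smul_eq_mul]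
  by_cases h : m + j = n
  · subst h; simp
  · rw [if_neg h, if_neg (fun h' => h (by omega))]; simp

theorem sqrt_le_self_of_one_le {x : ℝ} (hx : 1 ≤ x) : √x ≤ x :=
  Real.sqrt_le_iff.2 ⟨by linarith, by nlinarith⟩

/-- `|n|^{-1/2}`, with the value `0` at `n = 0`. -/
def halfInv (n : ℤ) : ℝ := (√|(n : ℝ)|)⁻¹

theorem halfInv_nonneg (n : ℤ) : 0 ≤ halfInv n := inv_nonneg.2 (Real.sqrt_nonneg _)

theorem halfInv_zero : halfInv 0 = 0 := by simp [halfInv]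

theorem halfInv_neg (n : ℤ) : halfInv (-n) = halfInv n := by simp [halfInv]

theorem halfInv_mul_self (n : ℤ) : halfInv n * halfInv n = |(n : ℝ)|⁻¹ := by
  rw [halfInv, ← mul_inv, Real.mul_self_sqrt (abs_nonneg _)]

theorem halfInv_pos {n : ℤ} (hn : n ≠ 0) : 0 < halfInv n := by
  have : (n : ℝ) ≠ 0 := by exact_mod_cast hn
  rw [halfInv]; positivity

theorem one_le_abs_cast {n : ℤ} (hn : n ≠ 0) : 1 ≤ |(n : ℝ)| := by
  exact_mod_cast Int.one_le_abs hn

theorem halfInv_le_one (n : ℤ) : halfInv n ≤ 1 := by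
  by_cases hn : n = 0
  · rw [hn, halfInv_zero]; exact zero_le_one
  · exact inv_le_one_of_one_le₀ (Real.one_le_sqrt.2 (one_le_abs_cast hn))

theorem abs_halfInv_le (n : ℤ) : |halfInv n| ≤ 1 := by
  rw [abs_of_nonneg (halfInv_nonneg n)]; exact halfInv_le_one n

/-- The operator `|n|^{-1/2}`. -/
def halfInvOp : SeqSpace →L[ℂ] SeqSpace := weightedShift halfInv 1 abs_halfInv_le 0

theorem halfInvOp_apply (w : SeqSpace) (n : ℤ) : halfInvOp w n = halfInv n * w n := by
  rw [halfInvOp, weightedShift_apply, add_zero]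

theorem halfInvOp_stdBasis (n : ℤ) : halfInvOp (stdBasis n) = (halfInv n : ℂ) • stdBasis n := by
  rw [halfInvOp, weightedShift_stdBasis, sub_zero]

theorem norm_halfInvOp_le : ‖halfInvOp‖ ≤ 1 := norm_weightedShift_le _ _ _ _

theorem halfInvOp_symm : halfInvOp.IsSymmetric := by
  intro x y
  simp only [ContinuousLinearMap.coe_coe, lp.inner_eq_tsum, halfInvOp_apply]
  refine tsum_congr fun n => ?_
  simp only [RCLike.inner_apply, map_mul, Complex.conj_ofReal]
  ring

theorem isCompactOperator_rankOne (x y : SeqSpace) :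
    IsCompactOperator (InnerProductSpace.rankOne ℂ x y) := by
  have h : IsCompactOperator (innerSL ℂ y : SeqSpace →L[ℂ] ℂ) :=
    isCompactOperator_of_locallyCompactSpace_dom _
  exact h.clm_comp (ContinuousLinearMap.toSpanSingleton ℂ x)

theorem isCompactOperator_sum {ι : Type*} (s : Finset ι) (f : ι → SeqSpace →L[ℂ] SeqSpace)
    (hf : ∀ i ∈ s, IsCompactOperator (f i)) : IsCompactOperator (∑ i ∈ s, f i : SeqSpace →L[ℂ] SeqSpace) :=
  Submodule.sum_mem (compactOperator (RingHom.id ℂ) SeqSpace SeqSpace) hf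

/-- The finite-rank truncations to `|n| ≤ R` converge in norm: the difference is diagonal with
entries at most `(R + 1)^{-1/2}`. -/
theorem halfInvOp_compact : IsCompactOperator halfInvOp := by
  let F : ℕ → SeqSpace →L[ℂ] SeqSpace := fun R => ∑ n ∈ Finset.Icc (-(R : ℤ)) R,
    InnerProductSpace.rankOne ℂ ((halfInv n : ℂ) • stdBasis n) (stdBasis n)
  have hF : ∀ R : ℕ, ∀ w n, F R w n = if n ∈ Finset.Icc (-(R : ℤ)) R then (halfInv n : ℂ) * w n else 0 := by
    intro R w n
    simp only [F, sum_apply, InnerProductSpace.rankOne_apply,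
      inner_stdBasis_left]
    rw [lp.coeFn_sum, Finset.sum_apply]
    simp only [lp.coeFn_smul, Pi.smul_apply, stdBasis_apply, smul_eq_mul]
    simp only [mul_ite, mul_one, mul_zero, Finset.sum_ite_eq]
    split_ifs <;> ring
  refine isCompactOperator_of_tendsto (l := atTop) (F := F) ?_ (Eventually.of_forall fun R =>
    isCompactOperator_sum _ _ fun i _ => isCompactOperator_rankOne _ _)
  rw [tendsto_iff_norm_sub_tendsto_zero]
  have hlim : Tendsto (fun R : ℕ => (√((R : ℝ) + 1))⁻¹) atTop (𝓝 0) :=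
    (Real.tendsto_sqrt_atTop.comp (tendsto_natCast_atTop_atTop.atTop_add tendsto_const_nhds)).inv_tendsto_atTop
  refine squeeze_zero (fun _ => norm_nonneg _) (fun R => ?_) hlim
  have hb : ∀ n : ℤ, |if n ∈ Finset.Icc (-(R : ℤ)) R then 0 else -halfInv n| ≤ (√((R : ℝ) + 1))⁻¹ := by
    intro n
    split_ifs with h
    · simp
    · rw [abs_neg, abs_of_nonneg (halfInv_nonneg n), halfInv]
      have : (R : ℤ) + 1 ≤ |n| := by
        rw [Finset.mem_Icc, not_and_or] at h
        rcases abs_cases n with h' | h' <;> omega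
      have : (R : ℝ) + 1 ≤ |(n : ℝ)| := by exact_mod_cast this
      gcongr
  have : F R - halfInvOp = weightedShift _ _ hb 0 := by
    ext w n
    rw [weightedShift_apply, sub_apply, lp.coeFn_sub, Pi.sub_apply, hF,
      halfInvOp_apply, add_zero]
    split_ifs <;> push_cast <;> ring
  rw [this]
  exact norm_weightedShift_le _ _ _ _

/-- The operator `(w_n) ↦ (w_{n + j})`. -/
def shiftOp (j : ℤ) : SeqSpace →L[ℂ] SeqSpace := weightedShift (fun _ => 1) 1 (by simp) j

theorem shiftOp_apply (j : ℤ) (w : SeqSpace) (n : ℤ) : shiftOp j w n = w (n + j) := by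
  rw [shiftOp, weightedShift_apply]; simp

theorem shiftOp_stdBasis (j n : ℤ) : shiftOp j (stdBasis n) = stdBasis (n - j) := by
  rw [shiftOp, weightedShift_stdBasis]; simp

theorem norm_shiftOp_le (j : ℤ) : ‖shiftOp j‖ ≤ 1 := norm_weightedShift_le _ _ _ _

theorem inner_shiftOp (j : ℤ) (x y : SeqSpace) :
    inner ℂ (shiftOp j x) y = inner ℂ x (shiftOp (-j) y) := by
  simp only [lp.inner_eq_tsum, shiftOp_apply]
  rw [← (Equiv.addRight j).tsum_eq fun n => inner ℂ (x n) (y (n + -j))]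
  simp

/-- The vector `e_N + e_{-N}`. -/
def pairVec (N : ℤ) : SeqSpace := stdBasis N + stdBasis (-N)

theorem norm_pairVec_le (N : ℤ) : ‖pairVec N‖ ≤ 2 :=
  (norm_add_le _ _).trans (by rw [norm_stdBasis, norm_stdBasis]; norm_num)

theorem norm_sq_pairVec {N : ℤ} (hN : N ≠ 0) : ‖pairVec N‖ ^ 2 = 2 := by
  have h : inner ℂ (stdBasis N) (stdBasis (-N)) = (0 : ℂ) := by
    rw [inner_stdBasis_stdBasis, if_neg (by omega)]
  rw [sq, pairVec, norm_add_sq_eq_norm_sq_add_norm_sq_of_inner_eq_zero _ _ h]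
  simp; norm_num

/-- The first order part of `T_ε`. -/
def firstOrderOp (N : ℤ) : SeqSpace →L[ℂ] SeqSpace :=
  halfInvOp ∘L (shiftOp N + shiftOp (-N)) ∘L halfInvOp

/-- The second order part of `T_ε`. -/
def secondOrderOp (N : ℤ) : SeqSpace →L[ℂ] SeqSpace :=
  -InnerProductSpace.rankOne ℂ (halfInvOp (pairVec N)) (halfInvOp (pairVec N))

/-- The compact operator `T_ε` whose nonzero eigenvalues are the inverses of the nonzero Steklov
eigenvalues of `a = 1 / (1 + 2 ε cos Nθ)`. -/
def invOp (N : ℤ) (ε : ℝ) : SeqSpace →L[ℂ] SeqSpace :=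
  halfInvOp ∘L halfInvOp + (ε : ℂ) • firstOrderOp N + ((ε ^ 2 : ℝ) : ℂ) • secondOrderOp N

theorem firstOrderOp_symm (N : ℤ) : (firstOrderOp N).IsSymmetric := by
  intro x y
  have hD := fun u v => halfInvOp_symm u v
  simp only [ContinuousLinearMap.coe_coe] at hD
  simp only [ContinuousLinearMap.coe_coe, firstOrderOp, ContinuousLinearMap.comp_apply,
    add_apply]
  rw [hD, inner_add_left, inner_shiftOp, inner_shiftOp, neg_neg, ← inner_add_right, hD, add_comm]

theorem secondOrderOp_symm (N : ℤ) : (secondOrderOp N).IsSymmetric := by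
  intro x y
  simp only [ContinuousLinearMap.coe_coe, secondOrderOp, neg_apply,
    inner_neg_left, inner_neg_right, InnerProductSpace.inner_left_rankOne_apply,
    InnerProductSpace.inner_right_rankOne_apply]

theorem invOp_symm (N : ℤ) (ε : ℝ) : (invOp N ε).IsSymmetric := by
  intro x y
  have hD := fun u v => halfInvOp_symm u v
  have h1 := fun u v => firstOrderOp_symm N u v
  have h2 := fun u v => secondOrderOp_symm N u v
  simp only [ContinuousLinearMap.coe_coe] at hD h1 h2
  simp only [ContinuousLinearMap.coe_coe, invOp, add_apply, inner_add_left,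
    inner_add_right, smul_apply, inner_smul_left, inner_smul_right,
    Complex.conj_ofReal, ContinuousLinearMap.comp_apply, hD, h1, h2]

theorem invOp_compact (N : ℤ) (ε : ℝ) : IsCompactOperator (invOp N ε) := by
  have h1 : IsCompactOperator (halfInvOp ∘L halfInvOp) := halfInvOp_compact.comp_clm _
  have h2 : IsCompactOperator (firstOrderOp N) := halfInvOp_compact.comp_clm _
  have h3 : IsCompactOperator (secondOrderOp N) := (isCompactOperator_rankOne _ _).neg
  exact (h1.add (h2.smul (ε : ℂ))).add (h3.smul ((ε ^ 2 : ℝ) : ℂ))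

theorem norm_firstOrderOp_le (N : ℤ) : ‖firstOrderOp N‖ ≤ 2 := by
  refine ContinuousLinearMap.opNorm_le_bound _ zero_le_two fun x => ?_
  have hD : ∀ y, ‖halfInvOp y‖ ≤ ‖y‖ := fun y => by
    simpa using halfInvOp.le_of_opNorm_le norm_halfInvOp_le y
  have hS : ∀ j y, ‖shiftOp j y‖ ≤ ‖y‖ := fun j y => by
    simpa using (shiftOp j).le_of_opNorm_le (norm_shiftOp_le j) y
  calc ‖firstOrderOp N x‖ ≤ ‖shiftOp N (halfInvOp x) + shiftOp (-N) (halfInvOp x)‖ := hD _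
    _ ≤ ‖halfInvOp x‖ + ‖halfInvOp x‖ := (norm_add_le _ _).trans (add_le_add (hS _ _) (hS _ _))
    _ ≤ 2 * ‖x‖ := by linarith [hD x]

theorem norm_secondOrderOp_le {N : ℤ} (hN : N ≠ 0) : ‖secondOrderOp N‖ ≤ 2 := by
  have h : ‖halfInvOp (pairVec N)‖ ≤ ‖pairVec N‖ := by
    simpa using halfInvOp.le_of_opNorm_le norm_halfInvOp_le (pairVec N)
  rw [secondOrderOp, norm_neg, InnerProductSpace.norm_rankOne, ← sq, ← norm_sq_pairVec hN]
  gcongr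

theorem norm_invOp_le {N : ℤ} (hN : N ≠ 0) {ε : ℝ} (hε : |ε| ≤ 1 / 4) : ‖invOp N ε‖ ≤ 2 := by
  have h0 : ‖halfInvOp ∘L halfInvOp‖ ≤ 1 * 1 := (ContinuousLinearMap.opNorm_comp_le _ _).trans
    (mul_le_mul norm_halfInvOp_le norm_halfInvOp_le (norm_nonneg _) zero_le_one)
  have h1 := norm_firstOrderOp_le N
  have h2 := norm_secondOrderOp_le hN
  have hsq : ε ^ 2 ≤ 1 / 16 := by
    rw [← sq_abs]
    nlinarith [abs_nonneg ε]
  calc ‖invOp N ε‖ ≤ 1 * 1 + |ε| * 2 + ε ^ 2 * 2 := by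
        refine (norm_add_le _ _).trans (add_le_add ((norm_add_le _ _).trans (add_le_add h0 ?_)) ?_)
        · rw [norm_smul, Complex.norm_real, Real.norm_eq_abs]
          gcongr
        · rw [norm_smul, Complex.norm_real, Real.norm_eq_abs, abs_of_nonneg (sq_nonneg ε)]
          gcongr
    _ ≤ 2 := by linarith

/-- With `D = |n|^{-1/2}` and `p = e_N + e_{-N}`, `T_ε = D (1 + ε (shift_N + shift_{-N}) - ε²
|p⟩⟨p|) D`; the shifts have norm at most one and `‖p‖² = 2`. For `|ε| ≤ 1/4` the factor on the left
is positive, which gives both the positivity of `T_ε` and its kernel. -/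
theorem invOp_inner_ge {N : ℤ} (hN : N ≠ 0) (ε : ℝ) (x : SeqSpace) :
    (1 - 2 * |ε| - 2 * ε ^ 2) * ‖halfInvOp x‖ ^ 2 ≤ (inner ℂ x (invOp N ε x)).re := by
  have hD := fun u v => halfInvOp_symm u v
  simp only [ContinuousLinearMap.coe_coe] at hD
  set y := halfInvOp x with hy
  have e1 : inner ℂ x (firstOrderOp N x) = inner ℂ y (shiftOp N y + shiftOp (-N) y) := by
    rw [firstOrderOp, ContinuousLinearMap.comp_apply, ← hD]; rfl
  have e2 : inner ℂ x (secondOrderOp N x)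
      = -(inner ℂ y (pairVec N) * inner ℂ (pairVec N) y) := by
    rw [secondOrderOp, neg_apply, inner_neg_right,
      InnerProductSpace.inner_right_rankOne_apply, ← hD, hD (pairVec N) x]
  have e0 : inner ℂ x ((halfInvOp ∘L halfInvOp) x) = inner ℂ y y := by
    rw [ContinuousLinearMap.comp_apply, ← hD]
  have hS : ∀ j, ‖shiftOp j y‖ ≤ ‖y‖ := fun j => by
    simpa using (shiftOp j).le_of_opNorm_le (norm_shiftOp_le j) y
  have b1 : ‖inner ℂ y (shiftOp N y + shiftOp (-N) y)‖ ≤ 2 * ‖y‖ ^ 2 :=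
    calc _ ≤ ‖y‖ * ‖shiftOp N y + shiftOp (-N) y‖ := norm_inner_le_norm _ _
      _ ≤ ‖y‖ * (‖y‖ + ‖y‖) := by
        gcongr
        exact (norm_add_le _ _).trans (add_le_add (hS _) (hS _))
      _ = _ := by ring
  have b2 : ‖inner ℂ (pairVec N) y‖ ^ 2 ≤ 2 * ‖y‖ ^ 2 := by
    rw [← norm_sq_pairVec hN, ← mul_pow]
    gcongr
    exact norm_inner_le_norm _ _
  have e3 : inner ℂ y (pairVec N) * inner ℂ (pairVec N) y
      = ((‖inner ℂ (pairVec N) y‖ ^ 2 : ℝ) : ℂ) := by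
    rw [← inner_conj_symm y, Complex.conj_mul']
    norm_cast
  have key : (inner ℂ x (invOp N ε x)).re = ‖y‖ ^ 2
      + ε * (inner ℂ y (shiftOp N y + shiftOp (-N) y)).re - ε ^ 2 * ‖inner ℂ (pairVec N) y‖ ^ 2 := by
    simp only [invOp, add_apply, inner_add_right (𝕜 := ℂ) x,
      smul_apply, inner_smul_right, e0, e1, e2, e3, Complex.add_re,
      Complex.re_ofReal_mul, Complex.neg_re, Complex.ofReal_re, inner_self_eq_norm_sq_to_K]
    have : (((‖y‖ : ℝ) : ℂ) ^ 2).re = ‖y‖ ^ 2 := by norm_cast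
    simp only [Complex.coe_algebraMap, this]
    ring
  rw [key]
  have b3 : -(|ε| * (2 * ‖y‖ ^ 2)) ≤ ε * (inner ℂ y (shiftOp N y + shiftOp (-N) y)).re := by
    refine (abs_le.1 ?_).1
    rw [abs_mul]
    gcongr
    exact (Complex.abs_re_le_norm _).trans b1
  nlinarith [mul_le_mul_of_nonneg_left b2 (sq_nonneg ε)]

theorem invOp_inner_nonneg {N : ℤ} (hN : N ≠ 0) {ε : ℝ} (hε : |ε| ≤ 1 / 4) (x : SeqSpace) :
    0 ≤ (inner ℂ x (invOp N ε x)).re := by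
  refine le_trans ?_ (invOp_inner_ge hN ε x)
  have hsq : ε ^ 2 ≤ 1 / 16 := by
    rw [← sq_abs]
    nlinarith [abs_nonneg ε]
  exact mul_nonneg (by linarith) (sq_nonneg _)

theorem eq_smul_stdBasis_of_invOp_eq_zero {N : ℤ} (hN : N ≠ 0) {ε : ℝ} (hε : |ε| ≤ 1 / 4)
    {x : SeqSpace} (hx : invOp N ε x = 0) : ∀ n ≠ 0, x n = 0 := by
  intro n hn
  have h := invOp_inner_ge hN ε x
  rw [hx, inner_zero_right, Complex.zero_re] at h
  have hsq : ε ^ 2 ≤ 1 / 16 := by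
    rw [← sq_abs]
    nlinarith [abs_nonneg ε]
  have hy : halfInvOp x = 0 := by
    have : ‖halfInvOp x‖ ^ 2 ≤ 0 := by
      nlinarith [sq_nonneg ‖halfInvOp x‖]
    simpa using le_antisymm this (sq_nonneg _)
  have h2 := halfInvOp_apply x n
  rw [hy] at h2
  have : (halfInv n : ℂ) ≠ 0 := by exact_mod_cast (halfInv_pos hn).ne'
  simpa [this] using h2.symm

theorem pairVec_apply (N n : ℤ) :
    pairVec N n = (if n = N then 1 else 0) + if n = -N then 1 else 0 := by
  rw [pairVec, lp.coeFn_add, Pi.add_apply, stdBasis_apply, stdBasis_apply]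

theorem inner_pairVec_left (N : ℤ) (w : SeqSpace) : inner ℂ (pairVec N) w = w N + w (-N) := by
  rw [pairVec, inner_add_left, inner_stdBasis_left, inner_stdBasis_left]

theorem firstOrderOp_stdBasis (N n : ℤ) : firstOrderOp N (stdBasis n) =
    ((halfInv n * halfInv (n - N) : ℝ) : ℂ) • stdBasis (n - N)
      + ((halfInv n * halfInv (n + N) : ℝ) : ℂ) • stdBasis (n + N) := by
  simp only [firstOrderOp, ContinuousLinearMap.comp_apply, halfInvOp_stdBasis,
    add_apply, map_smul, shiftOp_stdBasis, map_add, sub_neg_eq_add, smul_add,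
    smul_smul, Complex.ofReal_mul]

theorem secondOrderOp_stdBasis (N n : ℤ) : secondOrderOp N (stdBasis n) =
    -((halfInv n * ((if n = N then 1 else 0) + if n = -N then 1 else 0) : ℝ) : ℂ) •
      halfInvOp (pairVec N) := by
  rw [secondOrderOp, neg_apply, InnerProductSpace.rankOne_apply,
    inner_stdBasis_right, halfInvOp_apply, pairVec_apply, neg_smul]
  congr 2
  rw [map_mul, map_add, Complex.conj_ofReal]
  split_ifs <;> simp

theorem invOp_apply (N : ℤ) (ε : ℝ) (w : SeqSpace) (n : ℤ) :
    invOp N ε w n = halfInv n * (halfInv n * w n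
      + ε * (halfInv (n + N) * w (n + N) + halfInv (n - N) * w (n - N))
      - ε ^ 2 * (halfInv N * w N + halfInv (-N) * w (-N)) *
        ((if n = N then 1 else 0) + if n = -N then 1 else 0)) := by
  have hD := fun u v => halfInvOp_symm u v
  simp only [ContinuousLinearMap.coe_coe] at hD
  simp only [invOp, firstOrderOp, secondOrderOp, add_apply,
    ContinuousLinearMap.comp_apply, smul_apply, neg_apply,
    InnerProductSpace.rankOne_apply, hD, inner_pairVec_left]
  simp only [lp.coeFn_add, lp.coeFn_smul, lp.coeFn_neg, Pi.add_apply, Pi.smul_apply, Pi.neg_apply,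
    halfInvOp_apply, shiftOp_apply, pairVec_apply, smul_eq_mul, map_add]
  push_cast
  simp only [← sub_eq_add_neg]
  ring

theorem invOp_stdBasis_zero (N : ℤ) (ε : ℝ) : invOp N ε (stdBasis 0) = 0 := by
  rw [invOp, add_apply, add_apply,
    smul_apply, smul_apply, firstOrderOp_stdBasis,
    secondOrderOp_stdBasis, ContinuousLinearMap.comp_apply, halfInvOp_stdBasis, halfInv_zero]
  simp

/-- A shift by at most `|N|` changes `|n|` by a factor at most `1 + |N|` between nonzero
frequencies; at `m = 0` the default value `halfInv 0 = 0` makes the bound trivial. -/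
theorem halfInv_le_mul (N : ℤ) {n m : ℤ} (hn : n ≠ 0) (h : |n - m| ≤ |N|) :
    halfInv m ≤ (1 + |(N : ℝ)|) * halfInv n := by
  by_cases hm : m = 0
  · rw [hm, halfInv_zero]
    exact mul_nonneg (by positivity) (halfInv_nonneg n)
  · have h1 := one_le_abs_cast hm
    have h2 := one_le_abs_cast hn
    have h3 : |(n : ℝ)| ≤ (1 + |(N : ℝ)|) * |(m : ℝ)| := by
      have h4 : |(n : ℝ) - m| ≤ |(N : ℝ)| := by exact_mod_cast h
      have h5 : |(n : ℝ)| ≤ |(m : ℝ)| + |(n : ℝ) - m| := by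
        calc |(n : ℝ)| = |(m : ℝ) + (n - m)| := by ring_nf
          _ ≤ _ := abs_add_le _ _
      nlinarith [abs_nonneg (N : ℝ)]
    have h6 : (1 : ℝ) ≤ 1 + |(N : ℝ)| := by linarith [abs_nonneg (N : ℝ)]
    have h7 : √|(n : ℝ)| ≤ (1 + |(N : ℝ)|) * √|(m : ℝ)| := by
      calc √|(n : ℝ)| ≤ √((1 + |(N : ℝ)|) * |(m : ℝ)|) := Real.sqrt_le_sqrt h3
        _ = √(1 + |(N : ℝ)|) * √|(m : ℝ)| := Real.sqrt_mul (by linarith) _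
        _ ≤ _ := by
          gcongr
          exact sqrt_le_self_of_one_le h6
    have p1 : 0 < √|(n : ℝ)| := Real.sqrt_pos.2 (by linarith)
    have p2 : 0 < √|(m : ℝ)| := Real.sqrt_pos.2 (by linarith)
    rw [halfInv, halfInv, ← div_eq_mul_inv, le_div_iff₀ p1, inv_mul_eq_div, div_le_iff₀ p2]
    exact h7

/-- Every entry in column `n` carries a factor `|n|^{-1/2}` and a second one from a frequency
comparable to `n`. This decay is what yields summability of `μ_j^σ` for all `σ > 1`. -/
theorem exists_norm_invOp_stdBasis_le {N : ℤ} {ε : ℝ} (hε : |ε| ≤ 1 / 4) :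
    ∃ C : ℝ, 0 ≤ C ∧ ∀ n : ℤ, n ≠ 0 → ‖invOp N ε (stdBasis n)‖ ≤ C * |(n : ℝ)|⁻¹ := by
  refine ⟨1 + 6 * (1 + |(N : ℝ)|), by positivity, fun n hn => ?_⟩
  set c := 1 + |(N : ℝ)| with hc
  have hc1 : 1 ≤ c := by rw [hc]; linarith [abs_nonneg (N : ℝ)]
  have hε1 : |ε| ≤ 1 := by linarith
  have hε2 : ε ^ 2 ≤ 1 := by rw [← sq_abs]; nlinarith [abs_nonneg ε]
  have hpos := halfInv_nonneg n
  have hD : ‖halfInvOp (pairVec N)‖ ≤ 2 :=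
    (halfInvOp.le_of_opNorm_le norm_halfInvOp_le _).trans (by
      rw [one_mul]; exact norm_pairVec_le N)
  have h1 : ‖firstOrderOp N (stdBasis n)‖ ≤ halfInv n * (c * halfInv n) + halfInv n * (c * halfInv n) := by
    rw [firstOrderOp_stdBasis]
    refine (norm_add_le _ _).trans (add_le_add ?_ ?_)
    · rw [norm_smul, norm_stdBasis, mul_one, Complex.norm_real, Real.norm_of_nonneg
        (mul_nonneg hpos (halfInv_nonneg _))]
      exact mul_le_mul_of_nonneg_left (halfInv_le_mul N hn (by simp)) hpos
    · rw [norm_smul, norm_stdBasis, mul_one, Complex.norm_real, Real.norm_of_nonneg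
        (mul_nonneg hpos (halfInv_nonneg _))]
      exact mul_le_mul_of_nonneg_left (halfInv_le_mul N hn (by simp)) hpos
  have h2 : ‖secondOrderOp N (stdBasis n)‖ ≤ 2 * (halfInv n * (c * halfInv n)) * 2 := by
    rw [secondOrderOp_stdBasis, norm_smul, norm_neg, Complex.norm_real, norm_mul,
      Real.norm_of_nonneg hpos]
    have h4 : ‖(((if n = N then 1 else 0) + if n = -N then 1 else 0) : ℝ)‖ ≤ 2 * (c * halfInv n) := by
      by_cases h : n = N ∨ n = -N
      · have habs : |(n : ℝ)| = |(N : ℝ)| := by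
          rcases h with h | h <;> simp [h]
        have h5 : 1 ≤ c * halfInv n := by
          have := one_le_abs_cast hn
          have p1 : 0 < √|(n : ℝ)| := Real.sqrt_pos.2 (by linarith)
          rw [halfInv, ← div_eq_mul_inv, le_div_iff₀ p1, one_mul, hc, ← habs]
          exact (sqrt_le_self_of_one_le this).trans (by linarith)
        have h6 : ‖(((if n = N then 1 else 0) + if n = -N then 1 else 0) : ℝ)‖ ≤ 2 := by
          split_ifs <;> norm_num
        linarith
      · rw [not_or] at h
        rw [if_neg h.1, if_neg h.2, add_zero, norm_zero]
        exact mul_nonneg zero_le_two (mul_nonneg (by linarith) hpos)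
    calc _ ≤ halfInv n * (2 * (c * halfInv n)) * 2 := by gcongr
      _ = _ := by ring
  have h0 : ‖(halfInvOp ∘L halfInvOp) (stdBasis n)‖ = halfInv n * halfInv n := by
    rw [ContinuousLinearMap.comp_apply, halfInvOp_stdBasis, map_smul, halfInvOp_stdBasis, norm_smul,
      norm_smul, norm_stdBasis, Complex.norm_real, Real.norm_of_nonneg hpos, mul_one]
  rw [← halfInv_mul_self]
  calc ‖invOp N ε (stdBasis n)‖ ≤ halfInv n * halfInv n
        + 1 * (halfInv n * (c * halfInv n) + halfInv n * (c * halfInv n))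
        + 1 * (2 * (halfInv n * (c * halfInv n)) * 2) := by
        refine (norm_add_le _ _).trans (add_le_add ((norm_add_le _ _).trans (add_le_add h0.le ?_)) ?_)
        · change ‖(ε : ℂ) • firstOrderOp N (stdBasis n)‖ ≤ _
          rw [norm_smul, Complex.norm_real, Real.norm_eq_abs]
          gcongr
        · change ‖((ε ^ 2 : ℝ) : ℂ) • secondOrderOp N (stdBasis n)‖ ≤ _
          rw [norm_smul, Complex.norm_real, Real.norm_eq_abs, abs_of_nonneg (sq_nonneg ε)]
          gcongr
    _ = _ := by ring

end

end Steklov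

/-! ### Enumerating eigenvalues in increasing order. -/

/-- A function on an infinite set with finite sublevel sets can be enumerated increasingly. -/
theorem exists_equiv_nat_monotone {I : Type*} [Infinite I] {ν : I → ℝ}
    (hfin : ∀ t, {i | ν i ≤ t}.Finite) : ∃ e : ℕ ≃ I, Monotone (ν ∘ e) := by
  have hcount : Countable I := by
    rw [← Set.countable_univ_iff]
    have : (Set.univ : Set I) = ⋃ n : ℕ, {i | ν i ≤ n} := by
      ext i
      simpa using exists_nat_ge (ν i)
    rw [this]
    exact Set.countable_iUnion fun n => (hfin n).countable
  obtain ⟨c, hc⟩ := exists_injective_nat I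
  have hinj : Function.Injective fun i => toLex (ν i, c i) := fun i j h => by
    have := congrArg (fun x => (ofLex x).2) h
    exact hc this
  -- Ties in `ν` are broken by an injection into `ℕ`. The resulting order is linear, locally finite,
  -- with a least and no greatest element, hence isomorphic to `ℕ`.
  let : LinearOrder I := LinearOrder.lift' (fun i => toLex (ν i, c i)) hinj
  have hmono : Monotone ν := fun i j hij => by
    have h : toLex (ν i, c i) ≤ toLex (ν j, c j) := hij
    rw [Prod.Lex.toLex_le_toLex] at h
    rcases h with h | h
    · exact h.le
    · exact h.1.le
  have hIic : ∀ i : I, (Set.Iic i).Finite := fun i => (hfin (ν i)).subset fun j hj => hmono hj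
  let : LocallyFiniteOrder I := LocallyFiniteOrder.ofFiniteIcc fun a b =>
    (hIic b).subset fun x hx => hx.2
  obtain ⟨i0⟩ : Nonempty I := inferInstance
  obtain ⟨b, hb, hbmin⟩ := (hIic i0).exists_minimal ⟨i0, le_refl i0⟩
  let : OrderBot I :=
    { bot := b
      bot_le := fun j => (le_total b j).elim id fun h => hbmin (le_trans h hb) h }
  have : NoMaxOrder I := ⟨fun i => by
    by_contra! h
    exact Set.infinite_univ ((hIic i).subset fun j _ => h j)⟩
  let := LinearLocallyFiniteOrder.succOrder I
  let := LinearLocallyFiniteOrder.predOrder I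
  exact ⟨orderIsoNatOfLinearSuccPredArch.symm.toEquiv,
    hmono.comp orderIsoNatOfLinearSuccPredArch.symm.monotone⟩

/-- The rank is the number of `i` with `ν i ≤ t`, and this number is at least `k + 1` exactly when
`ν (e k) ≤ t`; the infimum is thus that of a closed half-line. -/
theorem sInf_rank_eq {V : Type*} [AddCommGroup V] [Module ℂ V] (L : Module.End ℂ V) {I : Type*}
    {u : I → V} {ν : I → ℝ} (hu : LinearIndependent ℂ u)
    (hE : ∀ t : ℝ, L.eigenspace (t : ℂ) = Submodule.span ℂ (u '' {i | ν i = t}))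
    (e : ℕ ≃ I) (he : Monotone (ν ∘ e)) (hfin : ∀ t, {i | ν i ≤ t}.Finite) (k : ℕ) :
    sInf {t : ℝ | ((k + 1 : ℕ) : Cardinal) ≤
      Module.rank ℂ ↥(⨆ μ : {μ : ℝ // μ ≤ t}, L.eigenspace ((μ : ℝ) : ℂ))} = ν (e k) := by
  have hsup : ∀ t : ℝ, (⨆ μ : {μ : ℝ // μ ≤ t}, L.eigenspace ((μ : ℝ) : ℂ))
      = Submodule.span ℂ (u '' {i | ν i ≤ t}) := fun t => by
    simp only [hE]
    rw [← Submodule.span_iUnion, ← Set.image_iUnion]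
    congr 2
    ext i
    simp
  have hrank : ∀ t : ℝ, Module.rank ℂ ↥(⨆ μ : {μ : ℝ // μ ≤ t}, L.eigenspace ((μ : ℝ) : ℂ))
      = (({i | ν i ≤ t}.ncard : ℕ) : Cardinal) := fun t => by
    rw [hsup, rank_span_set ((hu.linearIndepOn _).id_image),
      ← Set.cast_ncard ((hfin t).image u), Set.ncard_image_of_injective _ hu.injective]
  have : {t : ℝ | ((k + 1 : ℕ) : Cardinal) ≤
      Module.rank ℂ ↥(⨆ μ : {μ : ℝ // μ ≤ t}, L.eigenspace ((μ : ℝ) : ℂ))} = Set.Ici (ν (e k)) := by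
    ext t
    rw [Set.mem_ofPred_eq, hrank, Nat.cast_le, Set.mem_Ici]
    constructor
    · intro h
      by_contra! hlt
      have hsub : {i | ν i ≤ t} ⊆ e '' (Finset.range k : Set ℕ) := fun i hi => by
        refine ⟨e.symm i, ?_, e.apply_symm_apply i⟩
        rw [Finset.coe_range, Set.mem_Iio]
        by_contra! hk
        have := he hk
        simp only [Function.comp, e.apply_symm_apply] at this
        exact absurd (this.trans hi) (not_le.2 hlt)
      have h2 := Set.ncard_le_ncard hsub ((Finset.finite_toSet _).image _)
      rw [Set.ncard_image_of_injective _ e.injective, Set.ncard_coe_finset, Finset.card_range] at h2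
      omega
    · intro h
      have hsub : e '' (Finset.range (k + 1) : Set ℕ) ⊆ {i | ν i ≤ t} := by
        rintro _ ⟨j, hj, rfl⟩
        rw [Finset.coe_range, Set.mem_Iio] at hj
        exact (he (show j ≤ k by omega)).trans h
      have h2 := Set.ncard_le_ncard hsub (hfin t)
      rwa [Set.ncard_image_of_injective _ e.injective, Set.ncard_coe_finset, Finset.card_range] at h2
  rw [this, csInf_Ici]

/-! ### From the Steklov problem to `T_ε` and back. -/

namespace Steklov

noncomputable section

/-- The function `1 + 2 ε cos Nθ`. -/
def density (N : ℤ) (ε : ℝ) : SmoothCircle ℝ :=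
  ⟨fun θ => 1 + 2 * ε * Real.cos (N * θ),
    contDiff_const.add (contDiff_const.mul (Real.contDiff_cos.comp (contDiff_const.mul contDiff_id))),
    fun θ => by
      have : (N : ℝ) * (θ + 2 * π) = N * θ + N * (2 * π) := by ring
      simp only
      rw [this, Real.cos_add_int_mul_two_pi]⟩

theorem density_apply (N : ℤ) (ε θ : ℝ) : density N ε θ = 1 + 2 * ε * Real.cos (N * θ) := rfl

theorem density_pos (N : ℤ) {ε : ℝ} (hε : |ε| ≤ 1 / 4) (θ : ℝ) : 0 < density N ε θ := by
  have h1 := Real.abs_cos_le_one (N * θ)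
  have h2 : |ε * Real.cos (N * θ)| ≤ 1 / 4 * 1 := by
    rw [abs_mul]
    exact mul_le_mul hε h1 (abs_nonneg _) (by norm_num)
  have h3 := (abs_le.1 h2).1
  rw [density_apply]
  linarith

/-- The function `a = 1 / (1 + 2 ε cos Nθ)`. -/
def weight (N : ℤ) (ε : ℝ) (hε : |ε| ≤ 1 / 4) : SmoothCircle ℝ :=
  ⟨fun θ => (density N ε θ)⁻¹, (density N ε).contDiff.inv fun θ => (density_pos N hε θ).ne',
    fun θ => congrArg _ ((density N ε).periodic θ)⟩

theorem weight_apply (N : ℤ) {ε : ℝ} (hε : |ε| ≤ 1 / 4) (θ : ℝ) :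
    weight N ε hε θ = (density N ε θ)⁻¹ := rfl

theorem weight_pos (N : ℤ) {ε : ℝ} (hε : |ε| ≤ 1 / 4) (θ : ℝ) : 0 < weight N ε hε θ :=
  inv_pos.2 (density_pos N hε θ)

theorem mulOp_apply (b : SmoothCircle ℝ) (f : SmoothCircle ℂ) (θ : ℝ) :
    mulOp b f θ = (b θ : ℂ) * f θ := rfl

theorem coeff_mulOp_density (N : ℤ) (ε : ℝ) (u : SmoothCircle ℂ) (n : ℤ) :
    coeff (mulOp (density N ε) u) n = coeff u n + ε * (coeff u (n + N) + coeff u (n - N)) := by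
  have hu := u.contDiff.continuous
  have e : (mulOp (density N ε) u : ℝ → ℂ) = fun θ => u θ + (ε : ℂ) *
      (Complex.exp (((-N : ℤ) : ℂ) * Complex.I * θ) * u θ + Complex.exp ((N : ℂ) * Complex.I * θ) * u θ) := by
    funext θ
    rw [mulOp_apply, density_apply]
    push_cast
    have h2 : (2 : ℂ) * Complex.cos (N * θ) = Complex.exp (N * θ * Complex.I) + Complex.exp (-(N * θ) * Complex.I) := by
      rw [Complex.cos]; ring
    have e1 : (-(N : ℂ)) * Complex.I * θ = -(N * θ) * Complex.I := by ring
    have e2 : (N : ℂ) * Complex.I * θ = (N * θ) * Complex.I := by ring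
    rw [e1, e2]
    linear_combination (ε : ℂ) * u θ * h2
  rw [e, coeff_add hu (by fun_prop), coeff_smul, coeff_add (by fun_prop) (by fun_prop),
    coeff_exp_mul, coeff_exp_mul, sub_neg_eq_add]

theorem ofReal_sqrt_mul_self {x : ℝ} (hx : 0 ≤ x) : ((√x : ℝ) : ℂ) * (√x : ℝ) = x := by
  rw [← Complex.ofReal_mul, Real.mul_self_sqrt hx]

section Weight

variable (N : ℤ) {ε : ℝ} (hε : |ε| ≤ 1 / 4)

theorem sqrt_weight_mul_sqrt_density (θ : ℝ) : √(weight N ε hε θ) * √(density N ε θ) = 1 := by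
  rw [← Real.sqrt_mul (weight_pos N hε θ).le, weight_apply,
    inv_mul_cancel₀ (density_pos N hε θ).ne', Real.sqrt_one]

/-- Multiplication by `a^{1/2}` is invertible. -/
def sqrtWeightEquiv : SmoothCircle ℂ ≃ₗ[ℂ] SmoothCircle ℂ :=
  LinearEquiv.ofLinearMap (mulOp (sqrtFun (weight N ε hε) (weight_pos N hε)))
    (mulOp (sqrtFun (density N ε) (density_pos N hε)))
    (by
      ext f θ
      have h : ((√(weight N ε hε θ) : ℝ) : ℂ) * (√(density N ε θ) : ℝ) = 1 := by
        exact_mod_cast sqrt_weight_mul_sqrt_density N hε θ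
      change ((√(weight N ε hε θ) : ℝ) : ℂ) * ((√(density N ε θ) : ℝ) * f θ) = f θ
      rw [← mul_assoc, h, one_mul])
    (by
      ext f θ
      have h : ((√(weight N ε hε θ) : ℝ) : ℂ) * (√(density N ε θ) : ℝ) = 1 := by
        exact_mod_cast sqrt_weight_mul_sqrt_density N hε θ
      change ((√(density N ε θ) : ℝ) : ℂ) * ((√(weight N ε hε θ) : ℝ) * f θ) = f θ
      rw [← mul_assoc, mul_comm (((√(density N ε θ) : ℝ) : ℂ)), h, one_mul])

theorem sqrtWeightEquiv_apply (f : SmoothCircle ℂ) (θ : ℝ) :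
    sqrtWeightEquiv N hε f θ = (√(weight N ε hε θ) : ℝ) * f θ := rfl

/-- `Λ_a f = λ f` is equivalent to the Steklov problem `Λ u = λ a⁻¹ u` for `u = a^{1/2} f`. -/
theorem steklovOp_eq_smul_iff (lam : ℂ) (f : SmoothCircle ℂ) :
    steklovOp (weight N ε hε) (weight_pos N hε) f = lam • f ↔
      dtn (sqrtWeightEquiv N hε f) = lam • mulOp (density N ε) (sqrtWeightEquiv N hε f) := by
  have e1 : steklovOp (weight N ε hε) (weight_pos N hε) f
      = sqrtWeightEquiv N hε (dtn (sqrtWeightEquiv N hε f)) := rfl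
  -- This is `a^{1/2} a⁻¹ a^{1/2} = 1`; it exhibits both sides as images under the injective
  -- multiplication by `a^{1/2}`.
  have e2 : f = sqrtWeightEquiv N hε (mulOp (density N ε) (sqrtWeightEquiv N hε f)) := by
    ext θ
    rw [sqrtWeightEquiv_apply, mulOp_apply, sqrtWeightEquiv_apply]
    have h := ofReal_sqrt_mul_self (weight_pos N hε θ).le
    have h2 : (weight N ε hε θ : ℂ) * density N ε θ = 1 := by
      rw [weight_apply]
      exact_mod_cast inv_mul_cancel₀ (density_pos N hε θ).ne'
    linear_combination (-(density N ε θ : ℂ) * f θ) * h - f θ * h2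
  rw [e1]
  nth_rewrite 2 [e2]
  rw [← map_smul, (sqrtWeightEquiv N hε).injective.eq_iff]

end Weight

theorem steklov_eq_iff_coeff (N : ℤ) (ε : ℝ) (lam : ℂ) (u : SmoothCircle ℂ) :
    dtn u = lam • mulOp (density N ε) u ↔ ∀ n : ℤ, (|(n : ℝ)| : ℝ) * coeff u n
      = lam * (coeff u n + ε * (coeff u (n + N) + coeff u (n - N))) := by
  have h : ∀ n, coeff (lam • mulOp (density N ε) u : SmoothCircle ℂ) n
      = lam * (coeff u n + ε * (coeff u (n + N) + coeff u (n - N))) := fun n => by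
    rw [← coeff_mulOp_density]
    exact coeff_smul _ _ _
  constructor
  · intro he n
    rw [← coeff_dtn, he, h]
  · intro he
    refine ext_coeff fun n => ?_
    rw [coeff_dtn, he, h]

/-- The sequence `|n|^{1/2} û(n)`. -/
def halfSeq : SmoothCircle ℂ →ₗ[ℂ] SeqSpace where
  toFun u := ⟨fun n => (√|(n : ℝ)| : ℝ) * coeff u n, by
    refine memℓp_gen ?_
    obtain ⟨C, hC⟩ := exists_bound u
    refine Summable.of_nonneg_of_le (fun _ => by positivity) (fun n => ?_)
      ((summable_coeff u 1).mul_left C)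
    simp only [ENNReal.toReal_ofNat, Real.rpow_two, norm_mul, Complex.norm_real, mul_pow,
      Real.norm_eq_abs, sq_abs, Real.sq_sqrt (abs_nonneg (n : ℝ)), pow_one]
    have := mul_le_mul_of_nonneg_left (norm_coeff_le hC n)
      (mul_nonneg (abs_nonneg (n : ℝ)) (norm_nonneg (coeff u n)))
    linarith⟩
  map_add' f g := by
    ext n
    change ((√|(n : ℝ)| : ℝ) : ℂ) * coeff (fun θ => f θ + g θ) n = _
    rw [coeff_add f.contDiff.continuous g.contDiff.continuous, mul_add]
    rfl
  map_smul' c f := by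
    ext n
    change ((√|(n : ℝ)| : ℝ) : ℂ) * coeff (fun θ => c * f θ) n = _
    rw [coeff_smul, mul_left_comm]
    rfl

theorem halfSeq_apply (u : SmoothCircle ℂ) (n : ℤ) :
    halfSeq u n = (√|(n : ℝ)| : ℝ) * coeff u n := rfl

theorem halfInv_mul_sqrt {n : ℤ} (hn : n ≠ 0) : (halfInv n : ℂ) * (√|(n : ℝ)| : ℝ) = 1 := by
  have : 0 < √|(n : ℝ)| := Real.sqrt_pos.2 (lt_of_lt_of_le one_pos (one_le_abs_cast hn))
  rw [halfInv]
  exact_mod_cast inv_mul_cancel₀ this.ne'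

/-- For `n ≠ 0` the operator `T_ε`, written in terms of the Fourier coefficients `v`, is
`v ↦ |n|^{-1/2} (v_n + ε (v_{n + N} + v_{n - N}))`, if `v_0` is chosen suitably. -/
theorem invOp_apply_of_coeff {N : ℤ} (hN : N ≠ 0) (ε : ℝ) {w : SeqSpace} {v : ℤ → ℂ}
    (hv : ∀ n ≠ 0, v n = halfInv n * w n) (hv0 : v 0 = -(ε * (v N + v (-N)))) {n : ℤ} (hn : n ≠ 0) :
    invOp N ε w n = halfInv n * (v n + ε * (v (n + N) + v (n - N))) := by
  rw [invOp_apply, hv n hn]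
  rw [hv N hN, hv (-N) (neg_ne_zero.2 hN)] at hv0
  congr 1
  -- At `n = ±N` one neighbour is the frequency `0`. The default `halfInv 0 = 0` removes it from the
  -- shift term, and the rank-one term of order `ε²` restores exactly `ε v_0`.
  by_cases h1 : n = N
  · subst h1
    rw [if_pos rfl, if_neg (by omega), sub_self, hv0, hv _ (show n + n ≠ 0 by omega), halfInv_zero]
    push_cast
    ring
  by_cases h2 : n = -N
  · subst h2
    rw [if_pos rfl, if_neg h1, neg_add_cancel, hv0, hv _ (show -N - N ≠ 0 by omega), halfInv_zero]
    push_cast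
    ring
  · rw [if_neg h1, if_neg h2, hv _ (show n + N ≠ 0 by omega), hv _ (show n - N ≠ 0 by omega)]
    ring

theorem sqrt_eq_abs_mul_halfInv (n : ℤ) : ((√|(n : ℝ)| : ℝ) : ℂ) = (|(n : ℝ)| : ℝ) * halfInv n := by
  by_cases hn : n = 0
  · simp [hn]
  · have h := halfInv_mul_sqrt hn
    have h2 := ofReal_sqrt_mul_self (abs_nonneg (n : ℝ))
    linear_combination (halfInv n : ℂ) * h2 - (√|(n : ℝ)| : ℝ) * h

/-- For `lam ≠ 0` the equation at `n = 0` determines `û(0)` from `û(±N)`, so that mode can be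
eliminated without losing information. -/
theorem invOp_halfSeq {N : ℤ} (hN : N ≠ 0) {ε : ℝ} {lam : ℂ} (hlam : lam ≠ 0) {u : SmoothCircle ℂ}
    (hu : dtn u = lam • mulOp (density N ε) u) :
    invOp N ε (halfSeq u) = lam⁻¹ • halfSeq u := by
  rw [steklov_eq_iff_coeff] at hu
  have h0 := hu 0
  simp only [Int.cast_zero, abs_zero, Complex.ofReal_zero, zero_mul, zero_add, zero_sub] at h0
  have h0' : coeff u 0 = -(ε * (coeff u N + coeff u (-N))) :=
    eq_neg_of_add_eq_zero_left ((mul_eq_zero.1 h0.symm).resolve_left hlam)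
  ext n
  rw [lp.coeFn_smul, Pi.smul_apply, smul_eq_mul]
  by_cases hn : n = 0
  · subst hn
    rw [invOp_apply, halfInv_zero, halfSeq_apply]
    simp
  · rw [invOp_apply_of_coeff hN ε (v := coeff u) (fun m hm => by
      rw [halfSeq_apply, ← mul_assoc, halfInv_mul_sqrt hm, one_mul]) h0' hn, halfSeq_apply,
      sqrt_eq_abs_mul_halfInv]
    have := hu n
    field_simp
    linear_combination -(halfInv n : ℂ) * this

/-- Elliptic regularity for the Steklov problem, on the level of Fourier coefficients. -/
theorem decay_of_steklov {N : ℤ} {ε : ℝ} {lam : ℂ} {v : ℤ → ℂ} {B : ℝ} (hB : ∀ n, ‖v n‖ ≤ B)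
    (hv : ∀ n : ℤ, (|(n : ℝ)| : ℝ) * v n = lam * (v n + ε * (v (n + N) + v (n - N)))) (k : ℕ) :
    ∃ C : ℝ, ∀ n : ℤ, (1 + |(n : ℝ)|) ^ k * ‖v n‖ ≤ C := by
  induction k with
  | zero => exact ⟨B, fun n => by simpa using hB n⟩
  | succ k ih =>
    obtain ⟨C, hC⟩ := ih
    set M := (1 + |(N : ℝ)|) ^ k with hM
    have hshift : ∀ n m : ℤ, |n - m| ≤ |N| → (1 + |(n : ℝ)|) ^ k * ‖v m‖ ≤ M * C := by
      intro n m h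
      have h4 : |(n : ℝ) - m| ≤ |(N : ℝ)| := by exact_mod_cast h
      have h5 : |(n : ℝ)| ≤ |(m : ℝ)| + |(n : ℝ) - m| := by
        calc |(n : ℝ)| = |(m : ℝ) + (n - m)| := by ring_nf
          _ ≤ _ := abs_add_le _ _
      have h6 : 1 + |(n : ℝ)| ≤ (1 + |(N : ℝ)|) * (1 + |(m : ℝ)|) := by
        nlinarith [abs_nonneg (N : ℝ), abs_nonneg (m : ℝ)]
      calc (1 + |(n : ℝ)|) ^ k * ‖v m‖ ≤ ((1 + |(N : ℝ)|) * (1 + |(m : ℝ)|)) ^ k * ‖v m‖ := by gcongr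
        _ = M * ((1 + |(m : ℝ)|) ^ k * ‖v m‖) := by rw [mul_pow, hM]; ring
        _ ≤ M * C := by
          gcongr
          exact hC m
    refine ⟨C + ‖lam‖ * (C + |ε| * (M * C + M * C)), fun n => ?_⟩
    -- The recurrence gains one power of `|n|`; moving the weight from `n ± N` to `n` costs only the
    -- constant `M`.
    have h1 : |(n : ℝ)| * ‖v n‖ ≤ ‖lam‖ * (‖v n‖ + |ε| * (‖v (n + N)‖ + ‖v (n - N)‖)) := by
      have := congrArg norm (hv n)
      rw [norm_mul, norm_mul, Complex.norm_real, Real.norm_eq_abs, abs_abs] at this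
      rw [this]
      gcongr
      refine (norm_add_le _ _).trans ?_
      gcongr
      rw [norm_mul, Complex.norm_real, Real.norm_eq_abs]
      gcongr
      exact norm_add_le _ _
    have p : 0 ≤ (1 + |(n : ℝ)|) ^ k := by positivity
    calc (1 + |(n : ℝ)|) ^ (k + 1) * ‖v n‖
        = (1 + |(n : ℝ)|) ^ k * ‖v n‖ + (1 + |(n : ℝ)|) ^ k * (|(n : ℝ)| * ‖v n‖) := by ring
      _ ≤ (1 + |(n : ℝ)|) ^ k * ‖v n‖ + (1 + |(n : ℝ)|) ^ k *
          (‖lam‖ * (‖v n‖ + |ε| * (‖v (n + N)‖ + ‖v (n - N)‖))) := by gcongr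
      _ = (1 + |(n : ℝ)|) ^ k * ‖v n‖ + ‖lam‖ * ((1 + |(n : ℝ)|) ^ k * ‖v n‖ +
          |ε| * ((1 + |(n : ℝ)|) ^ k * ‖v (n + N)‖ + (1 + |(n : ℝ)|) ^ k * ‖v (n - N)‖)) := by ring
      _ ≤ _ := by
        refine add_le_add (hC n) (mul_le_mul_of_nonneg_left (add_le_add (hC n)
          (mul_le_mul_of_nonneg_left (add_le_add (hshift n _ (by simp)) (hshift n _ (by simp)))
            (abs_nonneg ε))) (norm_nonneg lam))

/-- Converse of `invOp_halfSeq`: the missing zero mode is defined by the equation at `n = 0`, and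
`decay_of_steklov` upgrades the bounded coefficients to those of a smooth function. -/
theorem exists_halfSeq_eq {N : ℤ} (hN : N ≠ 0) {ε : ℝ} {mu : ℂ} (hmu : mu ≠ 0) {w : SeqSpace}
    (hw : invOp N ε w = mu • w) :
    ∃ u : SmoothCircle ℂ, halfSeq u = w ∧ dtn u = mu⁻¹ • mulOp (density N ε) u := by
  set v : ℤ → ℂ := fun n => if n = 0 then -(ε * (halfInv N * w N + halfInv (-N) * w (-N)))
    else halfInv n * w n with hvdef
  have hv : ∀ n ≠ 0, v n = halfInv n * w n := fun n hn => if_neg hn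
  have hv0 : v 0 = -(ε * (v N + v (-N))) := by
    rw [hv N hN, hv _ (neg_ne_zero.2 hN)]
    exact if_pos rfl
  have heq : ∀ n : ℤ, (|(n : ℝ)| : ℝ) * v n = mu⁻¹ * (v n + ε * (v (n + N) + v (n - N))) := by
    intro n
    by_cases hn : n = 0
    · subst hn
      rw [zero_add, zero_sub, hv0]
      simp
    · have h1 := invOp_apply_of_coeff hN ε hv hv0 hn
      rw [hw, lp.coeFn_smul, Pi.smul_apply, smul_eq_mul] at h1
      have h2 := halfInv_mul_sqrt hn
      have h3 := ofReal_sqrt_mul_self (abs_nonneg (n : ℝ))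
      rw [eq_inv_mul_iff_mul_eq₀ hmu]
      set q : ℂ := ((√|(n : ℝ)| : ℝ) : ℂ)
      set X := v n + ε * (v (n + N) + v (n - N))
      rw [hv n hn, ← h3]
      linear_combination q * h1 + (mu * q * w n + X) * h2
  have hb : ∀ n, ‖v n‖ ≤ max ‖v 0‖ ‖w‖ := by
    intro n
    by_cases hn : n = 0
    · rw [hn]; exact le_max_left _ _
    · refine le_max_of_le_right ?_
      rw [hv n hn, norm_mul, Complex.norm_real, Real.norm_of_nonneg (halfInv_nonneg n)]
      calc _ ≤ 1 * ‖w‖ := mul_le_mul (halfInv_le_one n) (lp.norm_apply_le_norm (by simp) w n)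
            (norm_nonneg _) zero_le_one
        _ = _ := one_mul _
  obtain ⟨u, hu⟩ := exists_coeff_eq (decay_of_steklov hb heq)
  refine ⟨u, ?_, ?_⟩
  · ext n
    rw [halfSeq_apply, hu]
    by_cases hn : n = 0
    · subst hn
      have h1 := invOp_apply N ε w 0
      rw [hw, lp.coeFn_smul, Pi.smul_apply, smul_eq_mul, halfInv_zero, Complex.ofReal_zero,
        zero_mul] at h1
      rw [(mul_eq_zero.1 h1).resolve_left hmu]
      simp
    · rw [hv n hn]
      linear_combination (w n) * halfInv_mul_sqrt hn
  · rw [steklov_eq_iff_coeff]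
    simpa only [hu] using heq

theorem coeff_eq_zero_of_halfSeq {u : SmoothCircle ℂ} (h : halfSeq u = 0) {n : ℤ} (hn : n ≠ 0) :
    coeff u n = 0 := by
  have h1 := halfSeq_apply u n
  rw [h] at h1
  have h2 : (0 : ℂ) = (√|(n : ℝ)| : ℝ) * coeff u n := h1
  linear_combination -(halfInv n : ℂ) * h2 - coeff u n * halfInv_mul_sqrt hn

theorem eq_smul_one_of_halfSeq {u : SmoothCircle ℂ} (h : halfSeq u = 0) :
    u = coeff u 0 • (1 : SmoothCircle ℂ) := by
  refine ext_coeff fun n => ?_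
  have e : coeff (coeff u 0 • (1 : SmoothCircle ℂ) : SmoothCircle ℂ) n = if n = 0 then coeff u 0 else 0 := by
    rw [← coeff_const]
    congr 1
    funext θ
    exact mul_one _
  rw [e]
  split_ifs with hn
  · rw [hn]
  · exact coeff_eq_zero_of_halfSeq h hn

theorem dtn_eq_zero_of_halfSeq {u : SmoothCircle ℂ} (h : halfSeq u = 0) : dtn u = 0 := by
  refine ext_coeff fun n => ?_
  rw [coeff_dtn]
  have e : coeff (0 : SmoothCircle ℂ) n = 0 := by
    have := coeff_const 0 n
    rw [ite_self] at this
    exact this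
  rw [e]
  by_cases hn : n = 0
  · simp [hn]
  · rw [coeff_eq_zero_of_halfSeq h hn, mul_zero]

theorem halfSeq_eq_zero_of_dtn {u : SmoothCircle ℂ} (h : dtn u = 0) : halfSeq u = 0 := by
  ext n
  have h1 := coeff_dtn u n
  rw [h] at h1
  have e : coeff (0 : SmoothCircle ℂ) n = 0 := by
    have := coeff_const 0 n
    rw [ite_self] at this
    exact this
  rw [e] at h1
  rw [halfSeq_apply]
  have h2 := ofReal_sqrt_mul_self (abs_nonneg (n : ℝ))
  rw [← h2, mul_assoc] at h1
  rcases mul_eq_zero.1 h1.symm with h3 | h3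
  · rw [h3]; simp
  · exact h3

theorem halfSeq_one : halfSeq (1 : SmoothCircle ℂ) = 0 := by
  ext n
  rw [halfSeq_apply]
  have : coeff (1 : SmoothCircle ℂ) n = if n = 0 then 1 else 0 := coeff_const 1 n
  rw [this]
  split_ifs with h <;> simp [h]

end

end Steklov

/-! ### Eigenvalues of `T_ε`: summability and the correspondence with the Steklov spectrum. -/

namespace Steklov

section Eigenbasis

variable {N : ℤ} {ε : ℝ} {J : Type} {ψ : HilbertBasis J ℂ SeqSpace} {μ : J → ℝ}

/-- The first term dominates for `y ≥ c` and the second for `y ≤ c`. It replaces the power `σ` by a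
second moment at the scale `c = 1/|n|`. -/
theorem rpow_le_mul_sq_add {c y σ : ℝ} (hc : 0 < c) (hy : 0 ≤ y) (h0 : 0 < σ) (h2 : σ ≤ 2) :
    y ^ σ ≤ c ^ (σ - 2) * y ^ 2 + c ^ σ := by
  rcases le_total y c with h | h
  · have h1 : y ^ σ ≤ c ^ σ := Real.rpow_le_rpow hy h h0.le
    have h3 : 0 ≤ c ^ (σ - 2) * y ^ 2 := by positivity
    linarith
  · have hy' : 0 < y := hc.trans_le h
    have h1 : y ^ σ = y ^ (σ - 2) * y ^ 2 := by
      rw [← Real.rpow_natCast, ← Real.rpow_add hy']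
      congr 1
      push_cast
      ring
    have h3 : y ^ (σ - 2) ≤ c ^ (σ - 2) := Real.rpow_le_rpow_of_nonpos hc h (by linarith)
    rw [h1]
    have := mul_le_mul_of_nonneg_right h3 (sq_nonneg y)
    have h4 : 0 ≤ c ^ σ := by positivity
    linarith

theorem eigenvalue_mem_Icc_two (hN : N ≠ 0) (hε : |ε| ≤ 1 / 4)
    (hμ : ∀ j, invOp N ε (ψ j) = (μ j : ℂ) • ψ j) (j : J) : μ j ∈ Set.Icc (0 : ℝ) 2 :=
  HilbertBasis.eigenvalue_mem_Icc hμ (invOp_inner_nonneg hN hε) (norm_invOp_le hN hε) j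

/-- For `1 < σ ≤ 2`, `rpow_le_mul_sq_add` and `‖T_ε e_n‖ ≤ C/|n|` give `⟨e_n, T_ε^σ e_n⟩ ≤ (C² + 1)
|n|^{-σ}` for `n ≠ 0`, and `T_ε e_0 = 0`; these diagonal entries are summed. Larger `σ` follow from
`μ_j ≤ 2`. -/
theorem summable_eigenvalue_rpow (hN : N ≠ 0) (hε : |ε| ≤ 1 / 4)
    (hμ : ∀ j, invOp N ε (ψ j) = (μ j : ℂ) • ψ j) {σ : ℝ} (hσ : 1 < σ) :
    Summable fun j => μ j ^ σ := by
  have hmem := eigenvalue_mem_Icc_two hN hε hμ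
  have main : ∀ σ : ℝ, 1 < σ → σ ≤ 2 → Summable fun j => μ j ^ σ := by
    intro σ hσ hσ2
    obtain ⟨C, hC0, hC⟩ := exists_norm_invOp_stdBasis_le (N := N) hε
    have hsum : ∀ n, Summable fun j => ‖inner ℂ (ψ j) (stdBasis n)‖ ^ 2 * μ j ^ σ := fun n => by
      refine Summable.of_nonneg_of_le
        (fun j => mul_nonneg (sq_nonneg _) (Real.rpow_nonneg (hmem j).1 _)) (fun j => ?_)
        ((ψ.hasSum_norm_inner_sq (stdBasis n)).summable.mul_right (2 ^ σ))
      exact mul_le_mul_of_nonneg_left (Real.rpow_le_rpow (hmem j).1 (hmem j).2 (by linarith))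
        (sq_nonneg _)
    have hbsum : Summable fun n : ℤ => (C ^ 2 + 1) * (|(n : ℝ)|⁻¹) ^ σ := by
      refine Summable.mul_left _ ?_
      refine (Real.summable_abs_int_rpow hσ).congr fun n => ?_
      rw [Real.rpow_neg (abs_nonneg _), Real.inv_rpow (abs_nonneg _)]
    refine HilbertBasis.summable_of_hasSum_le ψ stdBasis
      (fun j => Real.rpow_nonneg (hmem j).1 _) (fun n => (hsum n).hasSum) (fun n => ?_) hbsum
    by_cases hn : n = 0
    · subst hn
      have hz : ∀ j, ‖inner ℂ (ψ j) (stdBasis 0)‖ ^ 2 * μ j ^ σ = 0 := fun j => by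
        have h1 := HilbertBasis.inner_eigen (invOp_symm N ε) hμ j (stdBasis 0)
        rw [invOp_stdBasis_zero, inner_zero_right] at h1
        rcases mul_eq_zero.1 h1.symm with h | h
        · rw [Complex.ofReal_eq_zero.1 h, Real.zero_rpow (by linarith), mul_zero]
        · rw [h, norm_zero]; ring
      rw [tsum_congr hz, tsum_zero]
      positivity
    · set c : ℝ := |(n : ℝ)|⁻¹ with hc
      have hcpos : 0 < c := inv_pos.2 (lt_of_lt_of_le one_pos (one_le_abs_cast hn))
      have h1 := HilbertBasis.hasSum_eigen_norm_sq (invOp_symm N ε) hμ 0 (stdBasis n)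
      have h2 := ψ.hasSum_norm_inner_sq (stdBasis n)
      rw [norm_stdBasis] at h2
      simp only [sub_zero, Complex.ofReal_zero, zero_smul] at h1
      have h3 := (h1.mul_left (c ^ (σ - 2))).add (h2.mul_left (c ^ σ))
      refine (Summable.tsum_le_tsum (fun j => ?_) (hsum n) h3.summable).trans ?_
      · have := mul_le_mul_of_nonneg_left
          (rpow_le_mul_sq_add hcpos (hmem j).1 (by linarith : 0 < σ) hσ2)
          (sq_nonneg ‖inner ℂ (ψ j) (stdBasis n)‖)
        linarith
      · rw [h3.tsum_eq]
        have h4 : c ^ (σ - 2) * c ^ 2 = c ^ σ := by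
          rw [← Real.rpow_natCast, ← Real.rpow_add hcpos]
          congr 1
          push_cast
          ring
        have h5 : ‖invOp N ε (stdBasis n)‖ ^ 2 ≤ (C * c) ^ 2 := by
          gcongr
          exact hC n hn
        have h6 : 0 ≤ c ^ (σ - 2) := by positivity
        nlinarith [mul_le_mul_of_nonneg_left h5 h6]
  rcases le_total σ 2 with h | h
  · exact main σ hσ h
  · refine Summable.of_nonneg_of_le (fun j => Real.rpow_nonneg (hmem j).1 _) (fun j => ?_)
      ((main 2 one_lt_two le_rfl).mul_left (2 ^ (σ - 2)))
    rcases (hmem j).1.eq_or_lt with h0 | h0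
    · rw [← h0, Real.zero_rpow (by linarith)]
      simp
    · calc μ j ^ σ = μ j ^ (σ - 2) * μ j ^ (2 : ℝ) := by
            rw [← Real.rpow_add h0]; congr 1; ring
        _ ≤ _ := mul_le_mul_of_nonneg_right
          (Real.rpow_le_rpow h0.le (hmem j).2 (by linarith)) (Real.rpow_nonneg h0.le _)

theorem finite_eigenvalue_ge (hN : N ≠ 0) (hε : |ε| ≤ 1 / 4)
    (hμ : ∀ j, invOp N ε (ψ j) = (μ j : ℂ) • ψ j) {c : ℝ} (hc : 0 < c) : {j | c ≤ μ j}.Finite := by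
  have h := (summable_eigenvalue_rpow hN hε hμ one_lt_two).tendsto_cofinite_zero
  have h2 := h.eventually_lt_const (show (0 : ℝ) < c ^ (2 : ℝ) by positivity)
  refine (Filter.eventually_cofinite.1 h2).subset fun j hj => ?_
  rw [Set.mem_ofPred_eq, not_lt]
  exact Real.rpow_le_rpow hc.le hj zero_le_two

/-- The kernel of `T_ε` lies in the span of `e_0`. With finitely many nonzero eigenvalues, Parseval
for `e_n`, `n ≠ 0`, would make a finite sum of `|ψ_j(n)|²` equal to one for every such `n`, although
each `ψ_j` is square summable. -/
theorem infinite_eigenvalue_ne_zero (hN : N ≠ 0) (hε : |ε| ≤ 1 / 4)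
    (hμ : ∀ j, invOp N ε (ψ j) = (μ j : ℂ) • ψ j) : Infinite {j // μ j ≠ 0} := by
  rw [← not_finite_iff_infinite]
  intro hfin
  have hfin' : {j | μ j ≠ 0}.Finite := Set.finite_coe_iff.1 hfin
  have hone : ∀ n : ℤ, n ≠ 0 → ∑ j ∈ hfin'.toFinset, ‖ψ j n‖ ^ 2 = 1 := by
    intro n hn
    have h1 := ψ.hasSum_norm_inner_sq (stdBasis n)
    rw [norm_stdBasis, one_pow] at h1
    simp only [inner_stdBasis_right, RCLike.norm_conj] at h1
    refine (hasSum_sum_of_ne_finset_zero fun j hj => ?_).unique h1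
    have hj0 : μ j = 0 := by simpa using hj
    have := eq_smul_stdBasis_of_invOp_eq_zero hN hε (x := ψ j)
      (by rw [hμ, hj0, Complex.ofReal_zero, zero_smul]) n hn
    rw [this, norm_zero]
    ring
  have hlim : Tendsto (fun n : ℤ => ∑ j ∈ hfin'.toFinset, ‖ψ j n‖ ^ 2) cofinite (𝓝 0) := by
    have := tendsto_finsetSum hfin'.toFinset (fun j _ =>
      (SeqSpace.summable_norm_sq (ψ j)).tendsto_cofinite_zero)
    simpa using this
  have h2 := hlim.eventually_lt_const one_pos
  have h3 : ∀ᶠ n : ℤ in cofinite, n ≠ 0 := (Set.finite_singleton (0 : ℤ)).eventually_cofinite_notMem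
  obtain ⟨n, hn1, hn2⟩ := (h2.and h3).exists
  rw [hone n hn2] at hn1
  exact lt_irrefl _ hn1

/-- The nonzero Steklov eigenvalues are the inverses of the nonzero eigenvalues of `T_ε`, with
multiplicities. -/
theorem exists_equiv_steklovEigenvalue (hN : N ≠ 0) (hε : |ε| ≤ 1 / 4)
    (hμ : ∀ j, invOp N ε (ψ j) = (μ j : ℂ) • ψ j) :
    ∃ e : ℕ ≃ {j // μ j ≠ 0}, ∀ k,
      steklovEigenvalue (weight N ε hε) (weight_pos N hε) (k + 1) = (μ (e k))⁻¹ := by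
  have hmem := eigenvalue_mem_Icc_two hN hε hμ
  have hpos : ∀ j : {j // μ j ≠ 0}, 0 < μ j := fun j => (hmem j).1.lt_of_ne (Ne.symm j.2)
  set S := sqrtWeightEquiv N hε with hS
  set L := steklovOp (weight N ε hε) (weight_pos N hε) with hL
  let Φ : SmoothCircle ℂ →ₗ[ℂ] SeqSpace := halfSeq ∘ₗ S.toLinearMap
  have hΦ : ∀ f, Φ f = halfSeq (S f) := fun f => rfl
  have hex : ∀ j : {j // μ j ≠ 0}, ∃ f, Φ f = ψ j ∧ L f = ((((μ j)⁻¹ : ℝ)) : ℂ) • f := by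
    intro j
    obtain ⟨u, hu1, hu2⟩ := exists_halfSeq_eq hN (mu := μ j) (by exact_mod_cast j.2) (hμ j)
    refine ⟨S.symm u, by rw [hΦ, S.apply_symm_apply, hu1], ?_⟩
    rw [hL, steklovOp_eq_smul_iff, ← hS, S.apply_symm_apply, hu2, Complex.ofReal_inv]
  choose f hf1 hf2 using hex
  -- The index `none` carries the eigenvalue `0`, with eigenfunction `a^{-1/2}`, which `Φ` kills.
  let u : Option {j // μ j ≠ 0} → SmoothCircle ℂ := fun o => o.elim (S.symm 1) f
  let ν : Option {j // μ j ≠ 0} → ℝ := fun o => o.elim 0 fun j => (μ j)⁻¹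
  have hLu : ∀ o, L (u o) = (ν o : ℂ) • u o := by
    rintro (_ | j)
    · change L (S.symm 1) = ((0 : ℝ) : ℂ) • S.symm 1
      rw [hL, steklovOp_eq_smul_iff, ← hS, S.apply_symm_apply, dtn_eq_zero_of_halfSeq halfSeq_one,
        Complex.ofReal_zero, zero_smul]
    · exact hf2 j
  have hΦsome : LinearIndependent ℂ (Φ ∘ f) := by
    have h1 : Φ ∘ f = ψ ∘ Subtype.val := funext hf1
    rw [h1]
    exact ψ.orthonormal.linearIndependent.comp _ Subtype.val_injective
  have hu : LinearIndependent ℂ u := by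
    rw [linearIndependent_option]
    refine ⟨LinearIndependent.of_comp Φ hΦsome, fun hmem => ?_⟩
    have hdis := Submodule.range_ker_disjoint hΦsome
    have hker : S.symm 1 ∈ LinearMap.ker Φ := by
      rw [LinearMap.mem_ker, hΦ, S.apply_symm_apply, halfSeq_one]
    have h0 := Submodule.disjoint_def.1 hdis _ hmem hker
    have h1 : (1 : SmoothCircle ℂ) = 0 := by
      have h2 : S.symm 1 = 0 := h0
      rw [← S.apply_symm_apply 1, h2, map_zero]
    have := congrArg (fun g : SmoothCircle ℂ => g 0) h1
    simp at this
  have hker : ∀ g, Φ g = 0 → ∃ c : ℂ, g = c • S.symm 1 := fun g hg =>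
    ⟨coeff (S g) 0, by rw [← map_smul, ← eq_smul_one_of_halfSeq (u := S g) hg, S.symm_apply_apply]⟩
  have hkerL : ∀ g, Φ g = 0 → L g = 0 := fun g hg => by
    have : L g = (0 : ℂ) • g := by
      rw [hL, steklovOp_eq_smul_iff, ← hS, dtn_eq_zero_of_halfSeq (u := S g) hg, zero_smul]
    rw [this, zero_smul]
  have hE : ∀ t : ℝ, L.eigenspace (t : ℂ) = Submodule.span ℂ (u '' {i | ν i = t}) := by
    intro t
    refine le_antisymm (fun g hg => ?_) (Submodule.span_le.2 ?_)
    · rw [Module.End.mem_eigenspace_iff] at hg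
      have hg' := hg
      rw [hL, steklovOp_eq_smul_iff, ← hS] at hg'
      by_cases ht : t = 0
      · subst ht
        have h0 : Φ g = 0 := halfSeq_eq_zero_of_dtn (u := S g) (by rw [hg', Complex.ofReal_zero, zero_smul])
        obtain ⟨c, hc⟩ := hker g h0
        rw [hc]
        exact Submodule.smul_mem _ _ (Submodule.subset_span ⟨none, rfl, rfl⟩)
      · have ht' : (t : ℂ) ≠ 0 := by exact_mod_cast ht
        have hTg := invOp_halfSeq hN ht' hg'
        rw [← hΦ, ← Complex.ofReal_inv] at hTg
        have hfinset : {j | μ j = t⁻¹}.Finite := by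
          by_cases hneg : t⁻¹ ≤ 0
          · have : {j | μ j = t⁻¹} = ∅ := by
              ext j
              simp only [Set.mem_ofPred_eq, Set.mem_empty_iff_false, iff_false]
              intro hj
              have := (hmem j).1
              rw [hj] at this
              exact inv_ne_zero ht (le_antisymm hneg this)
            rw [this]
            exact Set.finite_empty
          · exact (finite_eigenvalue_ge hN hε hμ (not_le.1 hneg)).subset fun j hj => hj.ge
        have hspan := HilbertBasis.eigenvector_mem_span (invOp_symm N ε) hμ hfinset hTg
        have hsub : Submodule.span ℂ (ψ '' {j | μ j = t⁻¹})
            ≤ (Submodule.span ℂ (u '' {i | ν i = t})).map Φ := by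
          rw [Submodule.map_span, Submodule.span_le]
          rintro _ ⟨j, hj, rfl⟩
          have hj0 : μ j ≠ 0 := by
            rw [show μ j = t⁻¹ from hj]
            exact inv_ne_zero ht
          refine Submodule.subset_span ⟨u (some ⟨j, hj0⟩), ⟨some ⟨j, hj0⟩, ?_, rfl⟩, hf1 ⟨j, hj0⟩⟩
          change (μ j)⁻¹ = t
          rw [show μ j = t⁻¹ from hj, inv_inv]
        -- `g - g'` is annihilated by `Φ`, hence by `L`, while both terms are eigenvectors for `t ≠
        -- 0`; so `g = g'`.
        obtain ⟨g', hg'mem, hg'eq⟩ := hsub hspan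
        have hdiff : Φ (g - g') = 0 := by rw [map_sub, hg'eq, sub_self]
        have hLg' : L g' = (t : ℂ) • g' := by
          have hle : Submodule.span ℂ (u '' {i | ν i = t}) ≤ L.eigenspace (t : ℂ) := by
            rw [Submodule.span_le]
            rintro _ ⟨i, hi, rfl⟩
            rw [SetLike.mem_coe, Module.End.mem_eigenspace_iff, hLu, show ν i = t from hi]
          exact Module.End.mem_eigenspace_iff.1 (hle hg'mem)
        have hz := hkerL _ hdiff
        rw [map_sub, hg, hLg', ← smul_sub, smul_eq_zero] at hz
        rw [sub_eq_zero.1 (hz.resolve_left ht')]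
        exact hg'mem
    · rintro _ ⟨i, hi, rfl⟩
      rw [SetLike.mem_coe, Module.End.mem_eigenspace_iff, hLu, show ν i = t from hi]
  have hνpos : ∀ j, 0 < ν (some j) := fun j => inv_pos.2 (hpos j)
  have hinf := infinite_eigenvalue_ne_zero hN hε hμ
  have hfin : ∀ t, {j : {j // μ j ≠ 0} | (μ j)⁻¹ ≤ t}.Finite := by
    intro t
    by_cases ht : 0 < t
    · refine Set.Finite.of_finite_image (f := Subtype.val)
        ((finite_eigenvalue_ge hN hε hμ (inv_pos.2 ht)).subset ?_) Subtype.val_injective.injOn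
      rintro _ ⟨j, hj, rfl⟩
      exact inv_le_of_inv_le₀ (hpos j) hj
    · have : {j : {j // μ j ≠ 0} | (μ j)⁻¹ ≤ t} = ∅ := by
        ext j
        simp only [Set.mem_ofPred_eq, Set.mem_empty_iff_false, iff_false]
        exact not_le.2 (lt_of_le_of_lt (not_lt.1 ht) (hνpos j))
      rw [this]
      exact Set.finite_empty
  obtain ⟨e, he⟩ := exists_equiv_nat_monotone hfin
  refine ⟨e, fun k => ?_⟩
  -- Prepending the eigenvalue `0` shifts the enumeration by one, whence the index `k + 1` in the
  -- statement.
  let e' : ℕ ≃ Option {j // μ j ≠ 0} :=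
    { toFun := fun n => n.casesOn none fun m => some (e m)
      invFun := fun o => o.elim 0 fun j => e.symm j + 1
      left_inv := by rintro (_ | n) <;> simp
      right_inv := by rintro (_ | j) <;> simp }
  have he' : Monotone (ν ∘ e') := by
    refine monotone_nat_of_le_succ fun n => ?_
    rcases n with _ | n
    · exact (hνpos (e 0)).le
    · exact he (Nat.le_succ n)
  have hfin' : ∀ t, {i | ν i ≤ t}.Finite := by
    intro t
    refine (((hfin t).image some).insert none).subset ?_
    rintro (_ | j) hj
    · exact Set.mem_insert _ _
    · exact Set.mem_insert_of_mem _ ⟨j, hj, rfl⟩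
  exact sInf_rank_eq L hu hE e' he' hfin' (k + 1)

end Eigenbasis

end Steklov

/-! ### Zeta functions as Dirichlet series. -/

namespace Steklov

section Dirichlet

variable {l : ℕ → ℝ}

theorem norm_ofReal_cpow_neg {x : ℝ} (hx : 0 < x) (z : ℂ) : ‖(x : ℂ) ^ (-z)‖ = x ^ (-z.re) := by
  rw [Complex.norm_cpow_eq_rpow_re_of_pos hx, Complex.neg_re]

theorem summable_ofReal_cpow_neg (hl : ∀ k, 0 < l k)
    (hs : ∀ σ : ℝ, 1 < σ → Summable fun k => l k ^ (-σ)) {z : ℂ} (hz : 1 < z.re) :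
    Summable fun k => (l k : ℂ) ^ (-z) :=
  Summable.of_norm ((hs _ hz).congr fun k => (norm_ofReal_cpow_neg (hl k) z).symm)

theorem differentiable_ofReal_cpow_neg {x : ℝ} (hx : 0 < x) :
    Differentiable ℂ fun z : ℂ => (x : ℂ) ^ (-z) := by
  intro z
  exact (differentiableAt_id.neg).const_cpow (Or.inl (by exact_mod_cast hx.ne'))

/-- Termwise differentiation of a general Dirichlet series. -/
theorem dirichletSeries_deriv (hl : ∀ k, 0 < l k)
    (hs : ∀ σ : ℝ, 1 < σ → Summable fun k => l k ^ (-σ)) {s : ℝ} (hs1 : 1 < s) :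
    DifferentiableAt ℂ (fun z : ℂ => ∑' k, (l k : ℂ) ^ (-z)) s ∧
    HasSum (fun k => (((l k)⁻¹ ^ s * Real.log (l k)⁻¹ : ℝ) : ℂ))
      (deriv (fun z : ℂ => ∑' k, (l k : ℂ) ^ (-z)) s) := by
  obtain ⟨σ, hσ1, hσs⟩ := exists_between hs1
  -- The strip is bounded on the right because some `l k` may be smaller than `1`, where `l k ^
  -- (-z)` grows with the real part.
  set U : Set ℂ := {z | σ < z.re ∧ z.re < s + 1} with hU
  have hUo : IsOpen U :=
    (isOpen_lt continuous_const Complex.continuous_re).inter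
      (isOpen_lt Complex.continuous_re continuous_const)
  have hsU : (s : ℂ) ∈ U := ⟨by simpa using hσs, by simp⟩
  have hu : Summable fun k => l k ^ (-σ) + l k ^ (-(s + 1)) := (hs _ hσ1).add (hs _ (by linarith))
  have hbound : ∀ k (w : ℂ), w ∈ U → ‖(l k : ℂ) ^ (-w)‖ ≤ l k ^ (-σ) + l k ^ (-(s + 1)) := by
    intro k w hw
    rw [norm_ofReal_cpow_neg (hl k)]
    have p1 : 0 ≤ l k ^ (-σ) := Real.rpow_nonneg (hl k).le _
    have p2 : 0 ≤ l k ^ (-(s + 1)) := Real.rpow_nonneg (hl k).le _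
    rcases le_total 1 (l k) with h | h
    · have := Real.rpow_le_rpow_of_exponent_le h (neg_le_neg hw.1.le)
      linarith
    · have := Real.rpow_le_rpow_of_exponent_ge (hl k) h (neg_le_neg hw.2.le)
      linarith
  have hd : ∀ k, DifferentiableOn ℂ (fun z : ℂ => (l k : ℂ) ^ (-z)) U := fun k =>
    (differentiable_ofReal_cpow_neg (hl k)).differentiableOn
  refine ⟨(Complex.differentiableOn_tsum_of_summable_norm hu hd hUo hbound).differentiableAt
    (hUo.mem_nhds hsU), ?_⟩
  have := Complex.hasSum_deriv_of_summable_norm hu hd hUo hbound hsU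
  convert! this using 1
  ext k
  have hk : (l k : ℂ) ≠ 0 := by exact_mod_cast (hl k).ne'
  have h1 : HasDerivAt (fun z : ℂ => (l k : ℂ) ^ (-z)) ((l k : ℂ) ^ (-(s : ℂ)) * Complex.log (l k) * (-1)) s :=
    (hasDerivAt_id (s : ℂ)).neg.const_cpow (Or.inl hk)
  rw [h1.deriv, Real.log_inv, Real.inv_rpow (hl k).le, ← Real.rpow_neg (hl k).le]
  push_cast
  rw [Complex.ofReal_cpow (hl k).le, Complex.ofReal_log (hl k).le]
  push_cast
  ring

theorem summable_natCast_succ_rpow_neg {σ : ℝ} (hσ : 1 < σ) :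
    Summable fun k : ℕ => ((k : ℝ) + 1) ^ (-σ) := by
  have h := (summable_nat_add_iff 1).2 (Real.summable_nat_rpow.2 (neg_lt_neg hσ))
  simpa using h

theorem riemannZeta_eq_tsum_neg {z : ℂ} (hz : 1 < z.re) :
    riemannZeta z = ∑' k : ℕ, ((((k : ℝ) + 1 : ℝ)) : ℂ) ^ (-z) := by
  rw [zeta_eq_tsum_one_div_nat_add_one_cpow hz]
  refine tsum_congr fun k => ?_
  rw [Complex.cpow_neg, one_div]
  push_cast
  rfl

theorem hasSum_riemannZeta {s : ℝ} (hs : 1 < s) :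
    HasSum (fun k : ℕ => ((((k : ℝ) + 1)⁻¹ ^ s : ℝ) : ℂ)) (riemannZeta s) := by
  rw [riemannZeta_eq_tsum_neg (by simpa using hs)]
  have h := (summable_ofReal_cpow_neg (l := fun k => (k : ℝ) + 1) (fun k => by positivity)
    (fun σ hσ => summable_natCast_succ_rpow_neg hσ) (z := s) (by simpa using hs)).hasSum
  convert! h using 1
  ext k
  have hk : (0 : ℝ) ≤ (k : ℝ) + 1 := by positivity
  rw [Real.inv_rpow hk, ← Real.rpow_neg hk, Complex.ofReal_cpow hk, Complex.ofReal_neg]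

theorem hasSum_deriv_riemannZeta {s : ℝ} (hs : 1 < s) :
    HasSum (fun k : ℕ => ((((k : ℝ) + 1)⁻¹ ^ s * Real.log ((k : ℝ) + 1)⁻¹ : ℝ) : ℂ))
      (deriv riemannZeta s) := by
  have h := (dirichletSeries_deriv (l := fun k => (k : ℝ) + 1) (fun k => by positivity)
    (fun σ hσ => summable_natCast_succ_rpow_neg hσ) hs).2
  have he : riemannZeta =ᶠ[𝓝 (s : ℂ)] fun z => ∑' k : ℕ, ((((k : ℝ) + 1 : ℝ)) : ℂ) ^ (-z) := by
    filter_upwards [(isOpen_lt continuous_const Complex.continuous_re).mem_nhds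
      (show (1 : ℝ) < (s : ℂ).re by simpa using hs)] with z hz
    exact riemannZeta_eq_tsum_neg hz
  rw [he.deriv_eq]
  exact h

/-- `ζ_R'(s) = ∑ n^{-s} log (1/n)`, as a real number. -/
theorem deriv_riemannZeta_eq {s : ℝ} (hs : 1 < s) :
    Summable (fun k : ℕ => ((k : ℝ) + 1)⁻¹ ^ s * Real.log ((k : ℝ) + 1)⁻¹) ∧
    deriv riemannZeta s = ((∑' k : ℕ, ((k : ℝ) + 1)⁻¹ ^ s * Real.log ((k : ℝ) + 1)⁻¹ : ℝ) : ℂ) := by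
  have h := hasSum_deriv_riemannZeta hs
  refine ⟨by exact_mod_cast h.summable, ?_⟩
  rw [Complex.ofReal_tsum]
  exact h.tsum_eq.symm

theorem riemannZeta_eq_ofReal {s : ℝ} (hs : 1 < s) :
    Summable (fun k : ℕ => ((k : ℝ) + 1)⁻¹ ^ s) ∧
    riemannZeta s = ((∑' k : ℕ, ((k : ℝ) + 1)⁻¹ ^ s : ℝ) : ℂ) := by
  have h := hasSum_riemannZeta hs
  refine ⟨by exact_mod_cast h.summable, ?_⟩
  rw [Complex.ofReal_tsum]
  exact h.tsum_eq.symm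

end Dirichlet

section SteklovZeta

variable {N : ℤ} {ε : ℝ} {J : Type} {ψ : HilbertBasis J ℂ SeqSpace} {μ : J → ℝ}

theorem steklovEigenvalue_summable (hN : N ≠ 0) (hε : |ε| ≤ 1 / 4)
    (hμ : ∀ j, invOp N ε (ψ j) = (μ j : ℂ) • ψ j) :
    (∀ k, 0 < steklovEigenvalue (weight N ε hε) (weight_pos N hε) (k + 1)) ∧ ∀ σ : ℝ, 1 < σ →
      Summable fun k => steklovEigenvalue (weight N ε hε) (weight_pos N hε) (k + 1) ^ (-σ) := by
  have hmem := eigenvalue_mem_Icc_two hN hε hμ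
  obtain ⟨e, he⟩ := exists_equiv_steklovEigenvalue hN hε hμ
  have hpos : ∀ j : {j // μ j ≠ 0}, 0 < μ j := fun j => (hmem j).1.lt_of_ne (Ne.symm j.2)
  refine ⟨fun k => by rw [he]; exact inv_pos.2 (hpos _), fun σ hσ => ?_⟩
  have h1 : Summable fun j : {j // μ j ≠ 0} => μ j ^ σ :=
    (summable_eigenvalue_rpow hN hε hμ hσ).subtype _
  refine (e.summable_iff.2 h1).congr fun k => ?_
  rw [he, Real.rpow_neg (inv_pos.2 (hpos _)).le, Real.inv_rpow (hpos _).le, inv_inv]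
  rfl

theorem steklovZeta_deriv (hN : N ≠ 0) (hε : |ε| ≤ 1 / 4)
    (hμ : ∀ j, invOp N ε (ψ j) = (μ j : ℂ) • ψ j) {s : ℝ} (hs : 1 < s) :
    DifferentiableAt ℂ (steklovZeta (weight N ε hε) (weight_pos N hε)) s ∧
    Summable (fun j => μ j ^ s * Real.log (μ j)) ∧
    deriv (steklovZeta (weight N ε hε) (weight_pos N hε)) s
      = ((∑' j, μ j ^ s * Real.log (μ j) : ℝ) : ℂ) := by
  obtain ⟨h1, h2⟩ := steklovEigenvalue_summable hN hε hμ
  obtain ⟨e, he⟩ := exists_equiv_steklovEigenvalue hN hε hμ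
  obtain ⟨h3, h4⟩ := dirichletSeries_deriv h1 h2 hs
  simp only [he, inv_inv] at h4
  have h5 : HasSum (fun j : {j // μ j ≠ 0} => ((μ j ^ s * Real.log (μ j) : ℝ) : ℂ))
      (deriv (steklovZeta (weight N ε hε) (weight_pos N hε)) s) := by
    rw [← e.hasSum_iff]
    convert! h4 using 1
    unfold steklovZeta
    simp only [he]
  have h6 : HasSum (fun j => ((μ j ^ s * Real.log (μ j) : ℝ) : ℂ))
      (deriv (steklovZeta (weight N ε hε) (weight_pos N hε)) s) := by
    -- Zero eigenvalues contribute nothing, since `Real.log 0 = 0`, so the sum may run over the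
    -- whole basis.
    refine (hasSum_subtype_iff_of_support_subset (s := {j | μ j ≠ 0}) ?_).1 h5
    intro j hj
    rw [Set.mem_ofPred_eq]
    intro h0
    apply hj
    simp [h0]
  refine ⟨h3, by exact_mod_cast h6.summable, ?_⟩
  rw [Complex.ofReal_tsum]
  exact h6.tsum_eq.symm

end SteklovZeta

end Steklov

/-! ### Second order perturbation along a rotated vector. -/

section Perturbation

variable {H : Type*} [NormedAddCommGroup H] [InnerProductSpace ℂ H]

/-- Second order perturbation of the quantities `⟨φ, T φ⟩` and `‖(T - m) φ‖²` along the curve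
`T = T₀ + t A + t² B`, `φ = U(t) e`, where `T₀ e = m e`. -/
theorem tendsto_second_order {T₀ A B S : H →L[ℂ] H} {U : ℝ → H →L[ℂ] H} {T : ℝ → H →L[ℂ] H}
    {e : H} {m : ℝ} (hT : ∀ t, T t = T₀ + (t : ℂ) • A + ((t ^ 2 : ℝ) : ℂ) • B)
    (h0 : T₀.IsSymmetric) (hA : A.IsSymmetric) (hB : B.IsSymmetric)
    (he : T₀ e = (m : ℂ) • e) (hAe : inner ℂ (A e) e = 0) (hU0 : U 0 = 1)
    (hU : HasDerivAt U S 0) (hnorm : ∀ t, ‖U t e‖ = 1) :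
    Tendsto (fun t => ((inner ℂ (U t e) (T t (U t e))).re - m) / t ^ 2) (𝓝[≠] 0)
      (𝓝 ((inner ℂ (S e) (T₀ (S e) - (m : ℂ) • S e + A e)).re + (inner ℂ (A e) (S e)).re
        + (inner ℂ (B e) e).re)) ∧
    Tendsto (fun t => ‖T t (U t e) - (m : ℂ) • U t e‖ ^ 2 / t ^ 2) (𝓝[≠] 0)
      (𝓝 (‖T₀ (S e) - (m : ℂ) • S e + A e‖ ^ 2)) := by
  have hev : ∀ V : ℝ → H →L[ℂ] H, ∀ V' : H →L[ℂ] H, HasDerivAt V V' 0 →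
      HasDerivAt (fun t => V t e) (V' e) 0 := fun V V' hV =>
    (((ContinuousLinearMap.apply ℂ H e).restrictScalars ℝ).hasFDerivAt.comp_hasDerivAt 0 hV)
  have hφ : HasDerivAt (fun t => U t e) (S e) 0 := hev U S hU
  have hTd : HasDerivAt (fun t => T t - (m : ℂ) • (1 : H →L[ℂ] H)) A 0 := by
    have h1 : HasDerivAt (fun t : ℝ => (t : ℂ) • A) ((1 : ℂ) • A) 0 :=
      ((Complex.ofRealCLM.hasDerivAt (x := (0 : ℝ)))).smul_const A
    have h2' : HasDerivAt (fun t : ℝ => ((t ^ 2 : ℝ) : ℂ)) ((0 : ℝ) : ℂ) 0 := by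
      have h : HasDerivAt (fun t : ℝ => t ^ 2) 0 0 := by simpa using hasDerivAt_pow 2 (0 : ℝ)
      exact h.ofReal_comp
    have h2 : HasDerivAt (fun t : ℝ => ((t ^ 2 : ℝ) : ℂ) • B) (((0 : ℝ) : ℂ) • B) 0 :=
      h2'.smul_const B
    have h3 := (((hasDerivAt_const (0 : ℝ) T₀).add h1).add h2).sub_const ((m : ℂ) • (1 : H →L[ℂ] H))
    have h4 : (fun t : ℝ => T t - (m : ℂ) • (1 : H →L[ℂ] H))
        = fun t : ℝ => T₀ + (t : ℂ) • A + ((t ^ 2 : ℝ) : ℂ) • B - (m : ℂ) • (1 : H →L[ℂ] H) := by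
      funext t; rw [hT]
    rw [h4]
    convert! h3 using 1
    simp
  have hr : HasDerivAt (fun t => T t (U t e) - (m : ℂ) • U t e)
      (T₀ (S e) - (m : ℂ) • S e + A e) 0 := by
    have h5 := hev _ _ (hTd.mul hU)
    have e0 : T 0 = T₀ := by rw [hT]; simp
    convert! h5 using 1
    simp [hU0, e0]
    abel
  have hφs : Tendsto (fun t : ℝ => ((t⁻¹ : ℝ) : ℂ) • (U t e - e)) (𝓝[≠] 0) (𝓝 (S e)) := by
    refine (hasDerivAt_iff_tendsto_slope_zero.1 hφ).congr fun t => ?_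
    rw [Complex.coe_smul, zero_add, hU0]
    rfl
  have hrs : Tendsto (fun t : ℝ => ((t⁻¹ : ℝ) : ℂ) • (T t (U t e) - (m : ℂ) • U t e)) (𝓝[≠] 0)
      (𝓝 (T₀ (S e) - (m : ℂ) • S e + A e)) := by
    have e0 : T 0 (U 0 e) - (m : ℂ) • U 0 e = 0 := by rw [hT, hU0]; simp [he]
    refine (hasDerivAt_iff_tendsto_slope_zero.1 hr).congr fun t => ?_
    rw [zero_add, e0, sub_zero]
    exact (Complex.coe_smul t⁻¹ _).symm
  have hφc : Tendsto (fun t => U t e) (𝓝[≠] 0) (𝓝 e) := by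
    have := hφ.continuousAt.tendsto
    rw [hU0] at this
    exact this.mono_left nhdsWithin_le_nhds
  constructor
  · have hlim := ((Complex.continuous_re.tendsto _).comp (hφs.inner hrs)).add
      ((Complex.continuous_re.tendsto _).comp ((tendsto_const_nhds (x := A e)).inner hφs (𝕜 := ℂ)))
    have hlim2 := hlim.add ((Complex.continuous_re.tendsto _).comp
      ((tendsto_const_nhds (x := B e)).inner hφc (𝕜 := ℂ)))
    refine hlim2.congr' ?_
    filter_upwards [self_mem_nhdsWithin] with t ht
    have ht0 : t ≠ 0 := ht
    have hsT : (T t).IsSymmetric := by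
      intro x y
      have a0 := h0 x y
      have a1 := hA x y
      have a2 := hB x y
      simp only [ContinuousLinearMap.coe_coe] at a0 a1 a2
      simp only [ContinuousLinearMap.coe_coe, hT, add_apply, inner_add_left, inner_add_right,
        smul_apply, inner_smul_left, inner_smul_right, Complex.conj_ofReal, a0, a1, a2]
    set φ := U t e with hφdef
    set r := T t φ - (m : ℂ) • φ with hrdef
    have k1 : (inner ℂ φ (T t φ)).re - m = (inner ℂ φ r).re := by
      rw [hrdef, inner_sub_right, inner_smul_right, inner_self_eq_norm_sq_to_K, hnorm]
      simp
    -- Moving `T - m` onto `e` cancels the zeroth order, and `⟨A e, e⟩ = 0` allows replacing `φ` by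
    -- `φ - e`. As `r` and `φ - e` are both `O(t)`, only the first derivative of `U` enters the `t²`
    -- coefficient.
    have k2 : inner ℂ e r = (t : ℂ) * inner ℂ (A e) (φ - e) + ((t ^ 2 : ℝ) : ℂ) * inner ℂ (B e) φ := by
      have := hsT e φ
      simp only [ContinuousLinearMap.coe_coe] at this
      rw [hrdef, inner_sub_right, ← this, hT, inner_smul_right, inner_sub_right, hAe, sub_zero]
      simp only [add_apply, smul_apply, inner_add_left, inner_smul_left, he, Complex.conj_ofReal]
      ring
    have k3 : inner ℂ φ r = inner ℂ (φ - e) r + inner ℂ e r := by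
      rw [inner_sub_left]; ring
    rw [k1, k3, k2]
    simp only [Function.comp, inner_smul_left, inner_smul_right, Complex.conj_ofReal,
      Complex.re_ofReal_mul, Complex.add_re]
    field_simp
    ring
  · have hlim := (hrs.norm.pow 2)
    refine hlim.congr' ?_
    filter_upwards [self_mem_nhdsWithin] with t ht
    rw [norm_smul, Complex.norm_real, mul_pow, Real.norm_eq_abs, sq_abs, inv_pow]
    field_simp

end Perturbation

/-! ### The function `x ^ s log x` and its quadratic bound. -/

namespace Steklov

/-- The derivative of `x ^ s * log x`. -/
noncomputable def kernelDeriv (s x : ℝ) : ℝ := x ^ (s - 1) * (s * Real.log x + 1)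

theorem hasDerivAt_kernel {s x : ℝ} (hx : 0 < x) :
    HasDerivAt (fun y : ℝ => y ^ s * Real.log y) (kernelDeriv s x) x := by
  have h := (Real.hasDerivAt_rpow_const (p := s) (Or.inl hx.ne')).mul (Real.hasDerivAt_log hx.ne')
  convert! h using 1
  have : x ^ s = x ^ (s - 1) * x := by
    rw [← Real.rpow_add_one hx.ne']; congr 1; ring
  rw [this, kernelDeriv]
  field_simp

theorem hasDerivAt_kernelDeriv {s x : ℝ} (hx : 0 < x) :
    HasDerivAt (kernelDeriv s) (x ^ (s - 2) * (s * (s - 1) * Real.log x + (2 * s - 1))) x := by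
  have h := (Real.hasDerivAt_rpow_const (p := s - 1) (Or.inl hx.ne')).mul
    (((Real.hasDerivAt_log hx.ne').const_mul s).add_const 1)
  convert! h using 1
  have e1 : s - 1 - 1 = s - 2 := by ring
  have : x ^ (s - 1) = x ^ (s - 2) * x := by
    rw [← Real.rpow_add_one hx.ne']; congr 1; ring
  rw [e1, this]
  field_simp
  ring

theorem continuous_kernel {s : ℝ} (hs : 2 < s) : Continuous fun y : ℝ => y ^ s * Real.log y := by
  have h : (fun y : ℝ => y ^ s * Real.log y) = fun y : ℝ => y ^ (s - 1) * (y * Real.log y) := by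
    funext y
    by_cases hy : y = 0
    · simp [hy]
    · rw [← mul_assoc, ← Real.rpow_add_one hy, sub_add_cancel]
  rw [h]
  exact (Real.continuous_rpow_const (by linarith)).mul Real.continuous_mul_log

/-- One-sided quadratic Taylor bound for `x ^ s * log x`. -/
theorem exists_kernel_le {s : ℝ} (hs : 2 < s) : ∃ K : ℝ, 0 ≤ K ∧ ∀ x ∈ Set.Icc (0 : ℝ) 1,
    ∀ y ∈ Set.Icc (0 : ℝ) 2, y ^ s * Real.log y ≤
      x ^ s * Real.log x + kernelDeriv s x * (y - x) + K * (y - x) ^ 2 := by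
  -- An upper bound for the second derivative on `(0, 2)`, from `log t ≤ t - 1 ≤ 1`.
  set K : ℝ := 2 ^ (s - 2) * (s * (s - 1) + (2 * s - 1)) with hK
  have hbr : 0 ≤ s * (s - 1) + (2 * s - 1) := by nlinarith
  have hK0 : 0 ≤ K := mul_nonneg (by positivity) hbr
  refine ⟨K, hK0, fun x hx y hy => ?_⟩
  rcases hx.1.eq_or_lt with h0 | hx0
  · subst h0
    rcases hy.1.eq_or_lt with h1 | hy0
    · subst h1; simp
    · have h2 : kernelDeriv s 0 = 0 := by
        rw [kernelDeriv, Real.zero_rpow (by linarith), zero_mul]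
      rw [h2, Real.log_zero]
      have h3 : y ^ s = y ^ (s - 2) * y ^ 2 := by
        rw [← Real.rpow_natCast, ← Real.rpow_add hy0]; congr 1; push_cast; ring
      have h4 : y ^ (s - 2) * Real.log y ≤ K := by
        have h5 : Real.log y ≤ 1 := (Real.log_le_sub_one_of_pos hy0).trans (by linarith [hy.2])
        have h6 : y ^ (s - 2) ≤ 2 ^ (s - 2) := Real.rpow_le_rpow hy.1 hy.2 (by linarith)
        calc y ^ (s - 2) * Real.log y ≤ y ^ (s - 2) * 1 := by gcongr
          _ ≤ 2 ^ (s - 2) * (s * (s - 1) + (2 * s - 1)) := by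
            gcongr
            nlinarith
      rw [h3]
      nlinarith [sq_nonneg y]
  set q : ℝ → ℝ := fun y => x ^ s * Real.log x + kernelDeriv s x * (y - x) + K * (y - x) ^ 2
    - y ^ s * Real.log y with hq
  have hqc : Continuous q := by
    have := continuous_kernel hs
    fun_prop
  have hqd : ∀ t, 0 < t → HasDerivAt q (kernelDeriv s x + 2 * K * (t - x) - kernelDeriv s t) t := by
    intro t ht
    have h1 := (((((hasDerivAt_id t).sub_const x).const_mul (kernelDeriv s x)).const_add
      (x ^ s * Real.log x)).add ((((hasDerivAt_id t).sub_const x).pow 2).const_mul K)).sub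
      (hasDerivAt_kernel (s := s) ht)
    convert! h1 using 1
    simp
    ring
  -- This fixes the sign of the derivative of `q` on either side of `x`, so that `q` has its minimum
  -- `0` there.
  have hanti : AntitoneOn (fun t => kernelDeriv s t - 2 * K * t) (Set.Ioc 0 2) := by
    have hd : ∀ t, 0 < t → HasDerivAt (fun t => kernelDeriv s t - 2 * K * t)
        (t ^ (s - 2) * (s * (s - 1) * Real.log t + (2 * s - 1)) - 2 * K * 1) t := fun t ht =>
      (hasDerivAt_kernelDeriv ht).sub ((hasDerivAt_id t).const_mul (2 * K))
    refine antitoneOn_of_deriv_nonpos (convex_Ioc 0 2)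
      (fun t ht => (hd t ht.1).continuousAt.continuousWithinAt) (fun t ht => ?_) (fun t ht => ?_)
    · rw [interior_Ioc] at ht
      exact (hd t ht.1).differentiableAt.differentiableWithinAt
    · rw [interior_Ioc] at ht
      rw [(hd t ht.1).deriv]
      have h5 : Real.log t ≤ 1 := (Real.log_le_sub_one_of_pos ht.1).trans (by linarith [ht.2])
      have h6 : t ^ (s - 2) ≤ 2 ^ (s - 2) := Real.rpow_le_rpow ht.1.le ht.2.le (by linarith)
      have h7 : t ^ (s - 2) * (s * (s - 1) * Real.log t + (2 * s - 1)) ≤ K := by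
        have hss : 0 ≤ s * (s - 1) := by nlinarith
        have hp : 0 ≤ t ^ (s - 2) := Real.rpow_nonneg ht.1.le _
        calc _ ≤ t ^ (s - 2) * (s * (s - 1) + (2 * s - 1)) := by
              refine mul_le_mul_of_nonneg_left ?_ hp
              nlinarith [mul_le_mul_of_nonneg_left h5 hss]
          _ ≤ K := mul_le_mul_of_nonneg_right h6 hbr
      linarith
  have hx2 : x ∈ Set.Ioc (0 : ℝ) 2 := ⟨hx0, by linarith [hx.2]⟩
  have hqx : q x = 0 := by simp [hq]
  have hqy : 0 ≤ q y := by
    rcases le_total x y with hxy | hxy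
    · have hmono : MonotoneOn q (Set.Icc x 2) := by
        refine monotoneOn_of_deriv_nonneg (convex_Icc x 2) hqc.continuousOn (fun t ht => ?_)
          (fun t ht => ?_)
        · rw [interior_Icc] at ht
          exact (hqd t (hx0.trans ht.1)).differentiableAt.differentiableWithinAt
        · rw [interior_Icc] at ht
          rw [(hqd t (hx0.trans ht.1)).deriv]
          have := hanti hx2 ⟨hx0.trans ht.1, ht.2.le⟩ ht.1.le
          simp only at this
          linarith
      have := hmono (Set.left_mem_Icc.2 (hxy.trans hy.2)) ⟨hxy, hy.2⟩ hxy
      rwa [hqx] at this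
    · have hmono : AntitoneOn q (Set.Icc 0 x) := by
        refine antitoneOn_of_deriv_nonpos (convex_Icc 0 x) hqc.continuousOn (fun t ht => ?_)
          (fun t ht => ?_)
        · rw [interior_Icc] at ht
          exact (hqd t ht.1).differentiableAt.differentiableWithinAt
        · rw [interior_Icc] at ht
          rw [(hqd t ht.1).deriv]
          have := hanti ⟨ht.1, ht.2.le.trans hx2.2⟩ hx2 ht.2.le
          simp only at this
          linarith
      have := hmono ⟨hy.1, hxy⟩ (Set.right_mem_Icc.2 hx0.le) hxy
      rwa [hqx] at this
  simp only [hq] at hqy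
  linarith

end Steklov

/-! ### The rotated basis and its second order data. -/

namespace Steklov

noncomputable section

section Rotation

variable (N : ℤ) (R : ℕ)

/-- The frequencies `0 < |n| ≤ R`. -/
def block (R : ℕ) : Finset ℤ := (Finset.Icc (-(R : ℤ)) R).erase 0

theorem mem_block {R : ℕ} {n : ℤ} : n ∈ block R ↔ n ≠ 0 ∧ |n| ≤ R := by
  rw [block, Finset.mem_erase, Finset.mem_Icc, abs_le]

/-- The entry of the infinitesimal rotation that removes the first order coupling of the frequencies
`n` and `n + N`. -/
def rotCoeff (n : ℤ) : ℝ :=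
  if n ∈ block R ∧ n + N ∈ block R then
    halfInv n * halfInv (n + N) / (|(n : ℝ)|⁻¹ - |((n + N : ℤ) : ℝ)|⁻¹) else 0

/-- The infinitesimal rotation diagonalizing `T_ε` up to second order on a block. -/
def rotGen : SeqSpace →L[ℂ] SeqSpace :=
  ∑ n ∈ block R, (rotCoeff N R n : ℂ) •
    (InnerProductSpace.rankOne ℂ (stdBasis (n + N)) (stdBasis n)
      - InnerProductSpace.rankOne ℂ (stdBasis n) (stdBasis (n + N)))

theorem rotCoeff_of_notMem {n : ℤ} (h : n ∉ block R) : rotCoeff N R n = 0 :=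
  if_neg fun h' => h h'.1

theorem rotCoeff_of_notMem' {n : ℤ} (h : n + N ∉ block R) : rotCoeff N R n = 0 :=
  if_neg fun h' => h h'.2

theorem rotGen_stdBasis (m : ℤ) : rotGen N R (stdBasis m) =
    (rotCoeff N R m : ℂ) • stdBasis (m + N) - (rotCoeff N R (m - N) : ℂ) • stdBasis (m - N) := by
  have h1 : ∀ n : ℤ, inner ℂ (stdBasis (n + N)) (stdBasis m) = if n = m - N then (1 : ℂ) else 0 := by
    intro n
    rw [inner_stdBasis_stdBasis]
    by_cases h : n = m - N
    · rw [if_pos (by omega), if_pos h]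
    · rw [if_neg (by omega), if_neg h]
  simp only [rotGen, sum_apply, smul_apply, sub_apply, InnerProductSpace.rankOne_apply,
    h1, smul_sub, smul_smul, mul_ite, mul_one, mul_zero,
    Finset.sum_sub_distrib, inner_stdBasis_stdBasis]
  simp only [ite_smul, zero_smul, Finset.sum_ite_eq']
  congr 1
  · split_ifs with h
    · rfl
    · rw [rotCoeff_of_notMem N R h]; simp
  · split_ifs with h
    · rfl
    · rw [rotCoeff_of_notMem N R h]; simp

theorem rotGen_mem_skewAdjoint : rotGen N R ∈ skewAdjoint (SeqSpace →L[ℂ] SeqSpace) := by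
  refine sum_mem fun n _ => ?_
  rw [skewAdjoint.mem_iff, star_smul, star_sub, ContinuousLinearMap.star_eq_adjoint,
    ContinuousLinearMap.star_eq_adjoint, InnerProductSpace.adjoint_rankOne,
    InnerProductSpace.adjoint_rankOne, RCLike.star_def, Complex.conj_ofReal, ← smul_neg, neg_sub]

/-- The rotation `exp (t S)`. -/
def rot (t : ℝ) : SeqSpace →L[ℂ] SeqSpace := NormedSpace.exp ((t : ℂ) • rotGen N R)

theorem rot_zero : rot N R 0 = 1 := by rw [rot, Complex.ofReal_zero, zero_smul, NormedSpace.exp_zero]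

theorem hasDerivAt_rot : HasDerivAt (rot N R) (rotGen N R) 0 := by
  have h := hasDerivAt_exp_smul_const (𝕂 := ℂ) (rotGen N R) ((0 : ℝ) : ℂ)
  have h2 := h.scomp (0 : ℝ) Complex.ofRealCLM.hasDerivAt
  rw [Complex.ofReal_zero, zero_smul, NormedSpace.exp_zero, one_mul] at h2
  simpa using! h2

theorem rot_mem_unitary (t : ℝ) : rot N R t ∈ unitary (SeqSpace →L[ℂ] SeqSpace) := by
  let : NormedAlgebra ℚ (SeqSpace →L[ℂ] SeqSpace) := NormedAlgebra.restrictScalars ℚ ℂ _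
  refine NormedSpace.exp_mem_unitary_of_mem_skewAdjoint ?_
  rw [skewAdjoint.mem_iff, star_smul, RCLike.star_def, Complex.conj_ofReal,
    skewAdjoint.mem_iff.1 (rotGen_mem_skewAdjoint N R), smul_neg]

/-- The rotated Hilbert basis. -/
def rotBasis (t : ℝ) : HilbertBasis ℤ ℂ SeqSpace :=
  HilbertBasis.ofRepr
    ((Unitary.linearIsometryEquiv ⟨rot N R t, rot_mem_unitary N R t⟩).symm.trans stdBasis.repr)

theorem rotBasis_eq (t : ℝ) (n : ℤ) : rotBasis N R t n = rot N R t (stdBasis n) := by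
  rw [← HilbertBasis.repr_symm_single]
  change (Unitary.linearIsometryEquiv ⟨rot N R t, rot_mem_unitary N R t⟩)
    (stdBasis.repr.symm (lp.single 2 n 1)) = _
  rw [HilbertBasis.repr_symm_single]
  rfl

theorem rot_stdBasis_of_notMem {n : ℤ} (h : n ∉ block R) (t : ℝ) :
    rot N R t (stdBasis n) = stdBasis n := by
  have hS : rotGen N R (stdBasis n) = 0 := by
    rw [rotGen_stdBasis, rotCoeff_of_notMem N R h,
      rotCoeff_of_notMem' N R (n := n - N) (by rwa [sub_add_cancel])]
    simp
  let : NormedAlgebra ℚ (SeqSpace →L[ℂ] SeqSpace) := NormedAlgebra.restrictScalars ℚ ℂ _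
  set P := InnerProductSpace.rankOne ℂ (stdBasis n) (stdBasis n) with hP
  -- `S e_n = 0` says that the projection `P` onto `e_n` intertwines `0` with `tS`; exponentiating
  -- gives `P = exp(tS) P`.
  have hsemi : SemiconjBy P 0 ((t : ℂ) • rotGen N R) := by
    rw [SemiconjBy, mul_zero, hP]
    ext1 x
    rw [mul_apply_eq_comp, InnerProductSpace.rankOne_apply, map_smul, smul_apply, hS, smul_zero,
      smul_zero]
    rfl
  have h2 := hsemi.exp_right
  rw [NormedSpace.exp_zero, SemiconjBy, mul_one] at h2
  have h3 := congrArg (fun L : SeqSpace →L[ℂ] SeqSpace => L (stdBasis n)) h2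
  simp only [mul_apply_eq_comp] at h3
  have hPe : P (stdBasis n) = stdBasis n := by
    rw [hP, InnerProductSpace.rankOne_apply, inner_stdBasis_stdBasis, if_pos rfl, one_smul]
  rw [hPe] at h3
  exact h3.symm

end Rotation

section SecondOrder

variable (N : ℤ) (R : ℕ)

/-- The Hilbert–Schmidt mass of a column of the first order part of `T_ε`. -/
def columnMass (n : ℤ) : ℝ := (halfInv n * halfInv (n + N)) ^ 2 + (halfInv n * halfInv (n - N)) ^ 2

/-- The part of `columnMass` outside of the block. -/
def leakMass (n : ℤ) : ℝ := (if n + N ∈ block R then 0 else (halfInv n * halfInv (n + N)) ^ 2)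
  + if n - N ∈ block R then 0 else (halfInv n * halfInv (n - N)) ^ 2

/-- The second order correction of the eigenvalue `1 / |n|`. -/
def secondShift (n : ℤ) : ℝ := rotCoeff N R n * (halfInv n * halfInv (n + N))
  - rotCoeff N R (n - N) * (halfInv n * halfInv (n - N))
  - (halfInv n * ((if n = N then 1 else 0) + if n = -N then 1 else 0)) ^ 2

variable {N}

theorem norm_sq_add_stdBasis (hN : N ≠ 0) (n : ℤ) (a b : ℝ) :
    ‖(a : ℂ) • stdBasis (n + N) + (b : ℂ) • stdBasis (n - N)‖ ^ 2 = a ^ 2 + b ^ 2 := by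
  have h : inner ℂ ((a : ℂ) • stdBasis (n + N)) ((b : ℂ) • stdBasis (n - N)) = (0 : ℂ) := by
    rw [inner_smul_left, inner_smul_right, inner_stdBasis_stdBasis, if_neg (by omega)]
    simp
  rw [sq, norm_add_sq_eq_norm_sq_add_norm_sq_of_inner_eq_zero _ _ h]
  simp only [norm_smul, norm_stdBasis, Complex.norm_real, Real.norm_eq_abs, mul_one, ← sq, sq_abs]

theorem inner_pair_stdBasis (hN : N ≠ 0) (n : ℤ) (a b c d : ℝ) :
    inner ℂ ((a : ℂ) • stdBasis (n + N) + (b : ℂ) • stdBasis (n - N))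
      ((c : ℂ) • stdBasis (n + N) + (d : ℂ) • stdBasis (n - N)) = ((a * c + b * d : ℝ) : ℂ) := by
  simp only [inner_add_left, inner_add_right, inner_smul_left, inner_smul_right,
    inner_stdBasis_stdBasis, Complex.conj_ofReal]
  have h1 : n - N ≠ n + N := by omega
  have h2 : n + N ≠ n - N := by omega
  simp only [h1, h2, if_false, if_true]
  push_cast
  ring

theorem firstOrderOp_stdBasis' (N n : ℤ) : firstOrderOp N (stdBasis n) =
    ((halfInv n * halfInv (n + N) : ℝ) : ℂ) • stdBasis (n + N)
      + ((halfInv n * halfInv (n - N) : ℝ) : ℂ) • stdBasis (n - N) := by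
  rw [firstOrderOp_stdBasis, add_comm]

theorem rotGen_stdBasis' (N : ℤ) (R : ℕ) (m : ℤ) : rotGen N R (stdBasis m) =
    ((rotCoeff N R m : ℝ) : ℂ) • stdBasis (m + N)
      + ((-rotCoeff N R (m - N) : ℝ) : ℂ) • stdBasis (m - N) := by
  rw [rotGen_stdBasis, Complex.ofReal_neg, neg_smul, sub_eq_add_neg]

theorem halfInvOp_sq_stdBasis (n : ℤ) :
    (halfInvOp ∘L halfInvOp) (stdBasis n) = ((|(n : ℝ)|⁻¹ : ℝ) : ℂ) • stdBasis n := by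
  rw [ContinuousLinearMap.comp_apply, halfInvOp_stdBasis, map_smul, halfInvOp_stdBasis, smul_smul,
    ← Complex.ofReal_mul, halfInv_mul_self]

theorem rotCoeff_mul (hodd : Odd N) {n : ℤ} (h1 : n ∈ block R) (h2 : n + N ∈ block R) :
    rotCoeff N R n * (|(n : ℝ)|⁻¹ - |((n + N : ℤ) : ℝ)|⁻¹) = halfInv n * halfInv (n + N) := by
  rw [rotCoeff, if_pos ⟨h1, h2⟩]
  refine div_mul_cancel₀ _ ?_
  rw [sub_ne_zero]
  intro h
  have h3 := inv_injective h
  have h4 : |n| = |n + N| := by exact_mod_cast h3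
  obtain ⟨k, hk⟩ := hodd
  rcases abs_eq_abs.1 h4 with h5 | h5 <;> omega

/-- `rotCoeff` is the solution of the commutator equation `[T_0, S] + A = 0` on the entries inside
the block. Only the couplings that leave the block survive. -/
theorem residual_eq (hodd : Odd N) {n : ℤ} (hn : n ∈ block R) :
    (halfInvOp ∘L halfInvOp) (rotGen N R (stdBasis n))
      - ((|(n : ℝ)|⁻¹ : ℝ) : ℂ) • rotGen N R (stdBasis n) + firstOrderOp N (stdBasis n)
    = ((if n + N ∈ block R then 0 else halfInv n * halfInv (n + N) : ℝ) : ℂ) • stdBasis (n + N)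
      + ((if n - N ∈ block R then 0 else halfInv n * halfInv (n - N) : ℝ) : ℂ) • stdBasis (n - N) := by
  have e1 : rotCoeff N R n * |((n + N : ℤ) : ℝ)|⁻¹ - |(n : ℝ)|⁻¹ * rotCoeff N R n
      + halfInv n * halfInv (n + N) = if n + N ∈ block R then 0 else halfInv n * halfInv (n + N) := by
    split_ifs with h
    · linarith [rotCoeff_mul R hodd hn h]
    · rw [rotCoeff_of_notMem' N R h]; ring
  have e2 : -rotCoeff N R (n - N) * |((n - N : ℤ) : ℝ)|⁻¹ - |(n : ℝ)|⁻¹ * -rotCoeff N R (n - N)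
      + halfInv n * halfInv (n - N) = if n - N ∈ block R then 0 else halfInv n * halfInv (n - N) := by
    split_ifs with h
    · have := rotCoeff_mul R hodd h (by rwa [sub_add_cancel])
      rw [sub_add_cancel] at this
      linarith
    · rw [rotCoeff_of_notMem N R h]; ring
  rw [← e1, ← e2, rotGen_stdBasis', firstOrderOp_stdBasis']
  simp only [map_add, map_smul, halfInvOp_sq_stdBasis]
  push_cast
  module

theorem inner_secondOrderOp_stdBasis (n : ℤ) : inner ℂ (secondOrderOp N (stdBasis n)) (stdBasis n)
    = ((-(halfInv n * ((if n = N then 1 else 0) + if n = -N then 1 else 0)) ^ 2 : ℝ) : ℂ) := by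
  rw [secondOrderOp_stdBasis, inner_smul_left, inner_stdBasis_right, halfInvOp_apply, pairVec_apply,
    map_neg, Complex.conj_ofReal, map_mul, Complex.conj_ofReal]
  split_ifs <;> simp <;> ring

/-- The second order behaviour of the two terms that enter the trace inequality. -/
theorem tendsto_block_term (hN : N ≠ 0) (hodd : Odd N) {n : ℤ} (hn : n ∈ block R) :
    Tendsto (fun t => ((inner ℂ (rotBasis N R t n) (invOp N t (rotBasis N R t n))).re - |(n : ℝ)|⁻¹)
      / t ^ 2) (𝓝[≠] 0) (𝓝 (secondShift N R n)) ∧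
    Tendsto (fun t => ‖invOp N t (rotBasis N R t n)
      - ((|(n : ℝ)|⁻¹ : ℝ) : ℂ) • rotBasis N R t n‖ ^ 2 / t ^ 2) (𝓝[≠] 0) (𝓝 (leakMass N R n)) := by
  have hT0 : (halfInvOp ∘L halfInvOp).IsSymmetric := by
    intro x y
    have hD := fun u v => halfInvOp_symm u v
    simp only [ContinuousLinearMap.coe_coe] at hD
    simp only [ContinuousLinearMap.coe_coe, ContinuousLinearMap.comp_apply, hD]
  have hAe : inner ℂ (firstOrderOp N (stdBasis n)) (stdBasis n) = 0 := by
    rw [firstOrderOp_stdBasis, inner_add_left, inner_smul_left, inner_smul_left,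
      inner_stdBasis_stdBasis, inner_stdBasis_stdBasis, if_neg (by omega), if_neg (by omega)]
    simp
  have hnorm : ∀ t, ‖rot N R t (stdBasis n)‖ = 1 := fun t => by
    rw [← rotBasis_eq]; exact (rotBasis N R t).norm_self n
  have key := tendsto_second_order (T := invOp N) (U := rot N R) (e := stdBasis n)
    (fun t => rfl) hT0 (firstOrderOp_symm N) (secondOrderOp_symm N) (halfInvOp_sq_stdBasis n) hAe
    (rot_zero N R) (hasDerivAt_rot N R) hnorm
  simp only [rotBasis_eq]
  rw [residual_eq R hodd hn, norm_sq_add_stdBasis hN, inner_secondOrderOp_stdBasis,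
    rotGen_stdBasis', firstOrderOp_stdBasis', inner_pair_stdBasis hN, inner_pair_stdBasis hN,
    Complex.ofReal_re, Complex.ofReal_re, Complex.ofReal_re] at key
  convert! key using 2
  · congr 1
    -- The residual lives outside the block, where `S e_n` has no component, so `⟨S e, residual⟩`
    -- drops out.
    have z1 : rotCoeff N R n * (if n + N ∈ block R then 0 else halfInv n * halfInv (n + N)) = 0 := by
      split_ifs with h
      · simp
      · rw [rotCoeff_of_notMem' N R h, zero_mul]
    have z2 : rotCoeff N R (n - N) * (if n - N ∈ block R then 0 else halfInv n * halfInv (n - N)) = 0 := by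
      split_ifs with h
      · simp
      · rw [rotCoeff_of_notMem N R h, zero_mul]
    rw [secondShift, neg_mul, z1, z2]
    ring
  · congr 1
    rw [leakMass]
    split_ifs <;> ring

/-- Since `|N| ≤ R`, the frequencies `±N` lie in the block, so the rank-one term vanishes on `e_n`.
The formulas are exact in `t`, so no uniformity over the infinitely many remaining `n` is needed. -/
theorem norm_invOp_sub_of_notMem (hN : N ≠ 0) (hR : |N| ≤ R) {n : ℤ} (hn : n ∉ block R) (t : ℝ) :
    (inner ℂ (stdBasis n) (invOp N t (stdBasis n))).re = |(n : ℝ)|⁻¹ ∧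
    ‖invOp N t (stdBasis n) - ((|(n : ℝ)|⁻¹ : ℝ) : ℂ) • stdBasis n‖ ^ 2 = t ^ 2 * columnMass N n := by
  have hχ : halfInv n * ((if n = N then 1 else 0) + if n = -N then 1 else 0) = 0 := by
    by_cases h0 : n = 0
    · rw [h0, halfInv_zero, zero_mul]
    · rw [mem_block, not_and, not_le] at hn
      have := hn h0
      rw [if_neg, if_neg]
      · simp
      · rintro rfl; rw [abs_neg] at this; omega
      · rintro rfl; omega
  have e : invOp N t (stdBasis n) = ((|(n : ℝ)|⁻¹ : ℝ) : ℂ) • stdBasis n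
      + (t : ℂ) • firstOrderOp N (stdBasis n) := by
    rw [invOp, add_apply, add_apply, smul_apply, smul_apply, halfInvOp_sq_stdBasis,
      secondOrderOp_stdBasis, hχ]
    simp
  constructor
  · rw [e, inner_add_right, inner_smul_right, inner_smul_right, inner_stdBasis_stdBasis,
      firstOrderOp_stdBasis, inner_add_right, inner_smul_right, inner_smul_right,
      inner_stdBasis_stdBasis, inner_stdBasis_stdBasis, if_pos rfl, if_neg (by omega),
      if_neg (by omega)]
    simp only [mul_zero, add_zero, mul_one, Complex.ofReal_re]
  · rw [e, add_sub_cancel_left, norm_smul, mul_pow, firstOrderOp_stdBasis',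
      norm_sq_add_stdBasis hN, Complex.norm_real, Real.norm_eq_abs, sq_abs, columnMass]

theorem columnMass_nonneg (n : ℤ) : 0 ≤ columnMass N n := by
  rw [columnMass]; positivity

theorem columnMass_le (n : ℤ) : columnMass N n ≤ 2 * (1 + |(N : ℝ)|) ^ 2 * (1 / (n : ℝ) ^ 2) := by
  by_cases hn : n = 0
  · subst hn
    simp [columnMass, halfInv_zero]
  · have h1 : ∀ m, |n - m| ≤ |N| → (halfInv n * halfInv m) ^ 2
        ≤ (1 + |(N : ℝ)|) ^ 2 * (1 / (n : ℝ) ^ 2) := by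
      intro m hm
      have h2 := halfInv_le_mul N hn hm
      have h3 := halfInv_mul_self n
      calc (halfInv n * halfInv m) ^ 2 ≤ (halfInv n * ((1 + |(N : ℝ)|) * halfInv n)) ^ 2 := by
            have := halfInv_nonneg n
            have := halfInv_nonneg m
            gcongr
        _ = (1 + |(N : ℝ)|) ^ 2 * (halfInv n * halfInv n) ^ 2 := by ring
        _ = _ := by rw [h3, inv_pow, sq_abs, one_div]
    have h4 := h1 (n + N) (by simp)
    have h5 := h1 (n - N) (by simp)
    rw [columnMass]
    linarith

theorem summable_columnMass : Summable (columnMass N) :=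
  Summable.of_nonneg_of_le columnMass_nonneg columnMass_le
    ((Real.summable_one_div_int_pow.2 one_lt_two).mul_left _)

end SecondOrder

end

end Steklov

/-! ### The trace inequality and the limit of large blocks. -/

/-- A sum over the frequencies of a function of `1 / |n|`. -/
theorem hasSum_int_of_inv_abs {g : ℝ → ℝ} (h0 : g 0 = 0) {S : ℝ}
    (h : HasSum (fun k : ℕ => g ((k : ℝ) + 1)⁻¹) S) :
    HasSum (fun n : ℤ => g |(n : ℝ)|⁻¹) (2 * S) := by
  rw [two_mul]
  refine HasSum.of_nat_of_neg_add_one (f := fun n : ℤ => g |(n : ℝ)|⁻¹) ?_ ?_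
  · set F : ℕ → ℝ := fun m => g |((m : ℤ) : ℝ)|⁻¹ with hF
    have h1 : HasSum (fun k : ℕ => F (k + 1)) S := by
      convert! h using 1
      ext k
      rw [hF]
      push_cast
      rw [abs_of_pos (by positivity)]
    have h2 := (hasSum_nat_add_iff (f := F) 1).1 h1
    have h3 : F 0 = 0 := by simp [hF, h0]
    rwa [Finset.sum_range_one, h3, add_zero] at h2
  · convert! h using 1
    ext k
    push_cast
    rw [abs_neg, abs_of_pos (by positivity)]

namespace HilbertBasis

variable {H J : Type*} [NormedAddCommGroup H] [InnerProductSpace ℂ H] {T : H →L[ℂ] H} {μ : J → ℝ}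
  {ψ : HilbertBasis J ℂ H}

/-- A quadratic upper bound for `f` passes to spectral averages of `f`. -/
theorem tsum_inner_le_of_quadratic (hs : T.IsSymmetric) (hμ : ∀ j, T (ψ j) = (μ j : ℂ) • ψ j)
    {f : ℝ → ℝ} {x y d K : ℝ} {v : H} (hv : ‖v‖ = 1)
    (hf : ∀ j, f (μ j) ≤ y + d * (μ j - x) + K * (μ j - x) ^ 2) (hsum : Summable fun j => f (μ j)) :
    ∑' j, ‖inner ℂ (ψ j) v‖ ^ 2 * f (μ j) ≤
      y + d * ((inner ℂ v (T v)).re - x) + K * ‖T v - (x : ℂ) • v‖ ^ 2 := by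
  have h1 := ψ.hasSum_norm_inner_sq v
  rw [hv, one_pow] at h1
  have h2 := hasSum_eigen_inner hs hμ v
  have h3 := hasSum_eigen_norm_sq hs hμ x v
  have h4 := ((h1.mul_left y).add ((h2.sub (h1.mul_left x)).mul_left d)).add (h3.mul_left K)
  have h5 : Summable fun j => ‖inner ℂ (ψ j) v‖ ^ 2 * f (μ j) := by
    rw [← summable_abs_iff]
    refine Summable.of_nonneg_of_le (fun j => abs_nonneg _) (fun j => ?_) hsum.abs
    rw [abs_mul, abs_of_nonneg (sq_nonneg _)]
    refine mul_le_of_le_one_left (abs_nonneg _) ?_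
    have : ‖inner ℂ (ψ j) v‖ ≤ 1 := by
      have := norm_inner_le_norm (𝕜 := ℂ) (ψ j) v
      rwa [ψ.norm_self, hv, one_mul] at this
    exact pow_le_one₀ (norm_nonneg _) this
  rw [mul_one, mul_one] at h4
  refine hasSum_le (fun j => ?_) h5.hasSum h4
  have := mul_le_mul_of_nonneg_left (hf j) (sq_nonneg ‖inner ℂ (ψ j) v‖)
  linarith

end HilbertBasis

namespace Steklov

theorem kernelDeriv_zero {s : ℝ} (hs : 2 < s) : kernelDeriv s 0 = 0 := by
  rw [kernelDeriv, Real.zero_rpow (by linarith), zero_mul]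

theorem inv_abs_mem_Icc (n : ℤ) : |(n : ℝ)|⁻¹ ∈ Set.Icc (0 : ℝ) 1 := by
  refine ⟨by positivity, ?_⟩
  by_cases h : n = 0
  · simp [h]
  · exact inv_le_one_of_one_le₀ (one_le_abs_cast h)

/-- The sum of `f (1 / |n|)`, `f x = x ^ s log x`, is twice the derivative of the Riemann zeta
function. -/
theorem hasSum_kernel {s : ℝ} (hs : 1 < s) :
    HasSum (fun n : ℤ => |(n : ℝ)|⁻¹ ^ s * Real.log |(n : ℝ)|⁻¹)
      (2 * ∑' k : ℕ, ((k : ℝ) + 1)⁻¹ ^ s * Real.log ((k : ℝ) + 1)⁻¹) :=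
  hasSum_int_of_inv_abs (g := fun x => x ^ s * Real.log x) (by simp) (deriv_riemannZeta_eq hs).1.hasSum

theorem hasSum_kernelDeriv {s : ℝ} (hs : 2 < s) :
    HasSum (fun k : ℕ => kernelDeriv s ((k : ℝ) + 1)⁻¹)
      (∑' k : ℕ, kernelDeriv s ((k : ℝ) + 1)⁻¹) ∧
    riemannZeta ((s : ℂ) - 1) + s * deriv riemannZeta ((s : ℂ) - 1)
      = ((∑' k : ℕ, kernelDeriv s ((k : ℝ) + 1)⁻¹ : ℝ) : ℂ) := by
  have h1 := deriv_riemannZeta_eq (s := s - 1) (by linarith)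
  have h2 := riemannZeta_eq_ofReal (s := s - 1) (by linarith)
  have h3 := h2.1.hasSum.add (h1.1.hasSum.mul_left s)
  have h4 : (fun k : ℕ => ((k : ℝ) + 1)⁻¹ ^ (s - 1) + s * (((k : ℝ) + 1)⁻¹ ^ (s - 1) * Real.log ((k : ℝ) + 1)⁻¹))
      = fun k : ℕ => kernelDeriv s ((k : ℝ) + 1)⁻¹ := by
    ext k
    rw [kernelDeriv]
    ring
  rw [h4] at h3
  refine ⟨h3.summable.hasSum, ?_⟩
  rw [h3.tsum_eq]
  have h5 : ((s - 1 : ℝ) : ℂ) = (s : ℂ) - 1 := by push_cast; rfl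
  rw [← h5, h1.2, h2.2]
  push_cast
  rfl

/-- The coefficient of `ε ^ 2` in the upper bound for the trace of `f (T_ε)`. -/
noncomputable def traceCoeff (N : ℤ) (R : ℕ) (s K : ℝ) : ℝ := K * ∑' n, columnMass N n +
  ∑ n ∈ block R, (kernelDeriv s |(n : ℝ)|⁻¹ * secondShift N R n + K * leakMass N R n
    - K * columnMass N n)

/-- A trace inequality for `T_ε`, as `ε → 0`. -/
theorem eventually_tsum_lt {N : ℤ} {R : ℕ} {s K : ℝ} (hN : N ≠ 0) (hodd : Odd N) (hR : |N| ≤ R)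
    (hs : 2 < s)
    (hK : ∀ x ∈ Set.Icc (0 : ℝ) 1, ∀ y ∈ Set.Icc (0 : ℝ) 2, y ^ s * Real.log y ≤
      x ^ s * Real.log x + kernelDeriv s x * (y - x) + K * (y - x) ^ 2)
    (hneg : traceCoeff N R s K < 0) :
    ∀ᶠ t in 𝓝[≠] (0 : ℝ), ∀ (_ : |t| ≤ 1 / 4) {J : Type} {ψ : HilbertBasis J ℂ SeqSpace} {μ : J → ℝ},
      (∀ j, invOp N t (ψ j) = (μ j : ℂ) • ψ j) →
      ∑' j, μ j ^ s * Real.log (μ j) <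
        2 * ∑' k : ℕ, ((k : ℝ) + 1)⁻¹ ^ s * Real.log ((k : ℝ) + 1)⁻¹ := by
  set c : ℝ → ℤ → ℝ := fun t n =>
    kernelDeriv s |(n : ℝ)|⁻¹ * ((inner ℂ (rotBasis N R t n) (invOp N t (rotBasis N R t n))).re
      - |(n : ℝ)|⁻¹) + K * ‖invOp N t (rotBasis N R t n)
      - ((|(n : ℝ)|⁻¹ : ℝ) : ℂ) • rotBasis N R t n‖ ^ 2 - t ^ 2 * (K * columnMass N n) with hc
  have hlim : Tendsto (fun t => K * ∑' n, columnMass N n + ∑ n ∈ block R, c t n / t ^ 2) (𝓝[≠] 0)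
      (𝓝 (traceCoeff N R s K)) := by
    refine tendsto_const_nhds.add (tendsto_finsetSum _ fun n hn => ?_)
    obtain ⟨h1, h2⟩ := tendsto_block_term R hN hodd hn
    refine (((h1.const_mul _).add (h2.const_mul K)).sub_const (K * columnMass N n)).congr' ?_
    filter_upwards [self_mem_nhdsWithin] with t ht
    have ht : t ≠ 0 := ht
    simp only [hc]
    field_simp
  filter_upwards [hlim.eventually_lt_const hneg, self_mem_nhdsWithin] with t hlt ht hε J ψ μ hμ
  have ht : t ≠ 0 := ht
  -- Subtracting `t² K columnMass` in `c` leaves a finite sum, whose limit can be taken term by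
  -- term; the subtracted part is summed exactly.
  have hcz : ∀ n ∉ block R, c t n = 0 := by
    intro n hn
    obtain ⟨h1, h2⟩ := norm_invOp_sub_of_notMem R hN hR hn t
    simp only [hc, rotBasis_eq, rot_stdBasis_of_notMem N R hn, h1, h2]
    ring
  have hb := ((hasSum_kernel (s := s) (by linarith)).add
    (((summable_columnMass (N := N)).hasSum.mul_left K).mul_left (t ^ 2))).add
    (hasSum_sum_of_ne_finset_zero hcz)
  have hsumf := (steklovZeta_deriv hN hε hμ (s := s) (by linarith)).2.1
  have hle := HilbertBasis.tsum_le_of_hasSum_le ψ (rotBasis N R t) hsumf (fun n => ?_) hb.summable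
  · rw [hb.tsum_eq] at hle
    have h3 : t ^ 2 * (K * ∑' n, columnMass N n) + ∑ n ∈ block R, c t n < 0 := by
      have h4 : 0 < t ^ 2 := by positivity
      have h5 := mul_neg_of_pos_of_neg h4 hlt
      rw [mul_add, Finset.mul_sum] at h5
      have h6 : ∀ n, t ^ 2 * (c t n / t ^ 2) = c t n := fun n => mul_div_cancel₀ _ h4.ne'
      simpa only [h6] using h5
    linarith
  · refine (HilbertBasis.tsum_inner_le_of_quadratic (f := fun y => y ^ s * Real.log y)
      (invOp_symm N t) hμ ((rotBasis N R t).norm_self n)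
      (fun j => hK _ (inv_abs_mem_Icc n) _ (eigenvalue_mem_Icc_two hN hε hμ j)) hsumf).trans
      (le_of_eq ?_)
    simp only [hc]
    ring

/-- The term of second order perturbation theory that comes from the coupling of `n` and `m`. -/
noncomputable def pairShift (n m : ℤ) : ℝ :=
  if n = 0 ∨ m = 0 then 0 else (|(m : ℝ)| - |(n : ℝ)|)⁻¹

/-- The second order correction of the eigenvalue `1 / |n|`. -/
noncomputable def fullShift (N n : ℤ) : ℝ := pairShift n (n + N) + pairShift n (n - N)
  - (halfInv n * ((if n = N then 1 else 0) + if n = -N then 1 else 0)) ^ 2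

theorem rotCoeff_mul_halfInv {N : ℤ} {R : ℕ} {n : ℤ} (h1 : n ∈ block R) (h2 : n + N ∈ block R) :
    rotCoeff N R n * (halfInv n * halfInv (n + N)) = pairShift n (n + N) := by
  have hn := (mem_block.1 h1).1
  have hm := (mem_block.1 h2).1
  rw [rotCoeff, if_pos ⟨h1, h2⟩, pairShift, if_neg (by tauto), div_mul_eq_mul_div,
    mul_mul_mul_comm, halfInv_mul_self, halfInv_mul_self]
  have hn' := one_le_abs_cast hn
  have hm' := one_le_abs_cast hm
  rw [inv_sub_inv (by linarith) (by linarith), div_div_eq_mul_div, ← mul_inv, inv_mul_cancel₀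
    (by positivity), one_div]

theorem rotCoeff_sub_mul_halfInv {N : ℤ} {R : ℕ} {n : ℤ} (h1 : n ∈ block R) (h2 : n - N ∈ block R) :
    -(rotCoeff N R (n - N) * (halfInv n * halfInv (n - N))) = pairShift n (n - N) := by
  have h3 := rotCoeff_mul_halfInv h2 (by rwa [sub_add_cancel])
  rw [sub_add_cancel] at h3
  have hn := (mem_block.1 h1).1
  have hm := (mem_block.1 h2).1
  rw [mul_comm (halfInv n), h3, pairShift, pairShift, if_neg (by tauto), if_neg (by tauto),
    ← inv_neg, neg_sub]

/-- For odd `N`, `|m| - |n|` is a nonzero integer: the denominators of perturbation theory are at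
least one in absolute value. -/
theorem abs_pairShift_le {N n m : ℤ} (hodd : Odd N) (h : m = n + N ∨ m = n - N) :
    |pairShift n m| ≤ 1 := by
  rw [pairShift]
  split_ifs with h0
  · simp
  · rw [abs_inv]
    refine inv_le_one_of_one_le₀ ?_
    have h1 : |m| - |n| ≠ 0 := by
      obtain ⟨k, hk⟩ := hodd
      intro h2
      rcases abs_eq_abs.1 (sub_eq_zero.1 h2) with h3 | h3 <;> omega
    have h2 := one_le_abs_cast h1
    push_cast at h2
    exact h2

/-- The bound is uniform in `R`, which provides the dominating sequence in `tendsto_traceCoeff`. -/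
theorem abs_secondShift_le {N : ℤ} (hN : N ≠ 0) (hodd : Odd N) {R : ℕ} {n : ℤ} (hn : n ∈ block R) :
    |secondShift N R n| ≤ 3 := by
  have h1 : |rotCoeff N R n * (halfInv n * halfInv (n + N))| ≤ 1 := by
    by_cases h : n + N ∈ block R
    · rw [rotCoeff_mul_halfInv hn h]
      exact abs_pairShift_le hodd (Or.inl rfl)
    · rw [rotCoeff_of_notMem' N R h]; simp
  have h2 : |rotCoeff N R (n - N) * (halfInv n * halfInv (n - N))| ≤ 1 := by
    by_cases h : n - N ∈ block R
    · rw [← abs_neg, rotCoeff_sub_mul_halfInv hn h]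
      exact abs_pairShift_le hodd (Or.inr rfl)
    · rw [rotCoeff_of_notMem N R h]; simp
  have h3 : |(halfInv n * ((if n = N then 1 else 0) + if n = -N then 1 else 0)) ^ 2| ≤ 1 := by
    rw [abs_pow]
    refine pow_le_one₀ (abs_nonneg _) ?_
    rw [abs_mul]
    refine mul_le_one₀ (abs_halfInv_le n) (abs_nonneg _) ?_
    split_ifs
    · omega
    all_goals norm_num
  rw [secondShift]
  rw [abs_le] at *
  constructor <;> linarith

theorem leakMass_nonneg (N : ℤ) (R : ℕ) (n : ℤ) : 0 ≤ leakMass N R n := by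
  rw [leakMass]
  split_ifs <;> positivity

theorem leakMass_le (N : ℤ) (R : ℕ) (n : ℤ) : leakMass N R n ≤ columnMass N n := by
  rw [leakMass, columnMass]
  have := sq_nonneg (halfInv n * halfInv (n + N))
  have := sq_nonneg (halfInv n * halfInv (n - N))
  split_ifs <;> linarith

/-- For large blocks the leak disappears. -/
theorem tendsto_traceCoeff {N : ℤ} {s K : ℝ} (hN : N ≠ 0) (hodd : Odd N) (hs : 2 < s) (hK : 0 ≤ K) :
    Tendsto (fun R : ℕ => traceCoeff N R s K) atTop
      (𝓝 (∑' n : ℤ, kernelDeriv s |(n : ℝ)|⁻¹ * fullShift N n)) := by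
  classical
  set G : ℕ → ℤ → ℝ := fun R n => K * columnMass N n + if n ∈ block R then
    kernelDeriv s |(n : ℝ)|⁻¹ * secondShift N R n + K * leakMass N R n - K * columnMass N n else 0
    with hG
  have hsum : ∀ R, traceCoeff N R s K = ∑' n, G R n := by
    intro R
    have h1 : HasSum (fun n => if n ∈ block R then kernelDeriv s |(n : ℝ)|⁻¹ * secondShift N R n
        + K * leakMass N R n - K * columnMass N n else 0) _ :=
      hasSum_sum_of_ne_finset_zero (s := block R) (fun n hn => if_neg hn)
    have h2 := ((summable_columnMass (N := N)).hasSum.mul_left K).add h1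
    rw [h2.tsum_eq, traceCoeff]
    congr 1
    exact Finset.sum_congr rfl fun n hn => (if_pos hn).symm
  simp only [hsum]
  have hF : Summable fun n : ℤ => |kernelDeriv s |(n : ℝ)|⁻¹| :=
    (hasSum_int_of_inv_abs (g := kernelDeriv s) (kernelDeriv_zero hs)
      (hasSum_kernelDeriv hs).1).summable.abs
  refine tendsto_tsum_of_dominated_convergence
    (bound := fun n => 3 * |kernelDeriv s |(n : ℝ)|⁻¹| + K * columnMass N n)
    ((hF.mul_left 3).add (summable_columnMass.mul_left K)) (fun n => ?_)
    (Eventually.of_forall fun R n => ?_)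
  · refine tendsto_const_nhds.congr' ?_
    -- From this `R` on, `n` and its nonzero neighbours `n ± N` lie in the block: the leak is zero
    -- and the summand no longer depends on `R`.
    filter_upwards [eventually_ge_atTop (n.natAbs + N.natAbs)] with R hR
    simp only [hG]
    by_cases h0 : n = 0
    · subst h0
      rw [if_neg (by simp [mem_block])]
      simp [kernelDeriv_zero hs, columnMass, halfInv_zero]
    have hmem : ∀ m, m = n ∨ m = n + N ∨ m = n - N → m ≠ 0 → m ∈ block R := by
      intro m hm hm0
      rw [mem_block, Int.abs_eq_natAbs]
      omega
    have hn := hmem n (Or.inl rfl) h0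
    have h1 : rotCoeff N R n * (halfInv n * halfInv (n + N)) = pairShift n (n + N) := by
      by_cases h : n + N = 0
      · rw [pairShift, if_pos (Or.inr h), h, halfInv_zero]; ring
      · exact rotCoeff_mul_halfInv hn (hmem _ (Or.inr (Or.inl rfl)) h)
    have h2 : -(rotCoeff N R (n - N) * (halfInv n * halfInv (n - N))) = pairShift n (n - N) := by
      by_cases h : n - N = 0
      · rw [pairShift, if_pos (Or.inr h), h, halfInv_zero]; ring
      · exact rotCoeff_sub_mul_halfInv hn (hmem _ (Or.inr (Or.inr rfl)) h)
    have h3 : leakMass N R n = 0 := by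
      rw [leakMass]
      by_cases h : n + N = 0 <;> by_cases h' : n - N = 0
      · omega
      · rw [h, halfInv_zero, if_pos (hmem _ (Or.inr (Or.inr rfl)) h')]; simp
      · rw [h', halfInv_zero, if_pos (hmem _ (Or.inr (Or.inl rfl)) h)]; simp
      · rw [if_pos (hmem _ (Or.inr (Or.inr rfl)) h'), if_pos (hmem _ (Or.inr (Or.inl rfl)) h), add_zero]
    rw [if_pos hn, h3, fullShift, secondShift, ← h1, ← h2]
    ring
  · simp only [hG, Real.norm_eq_abs]
    have hβ := columnMass_nonneg (N := N) n
    have h0 := abs_nonneg (kernelDeriv s |(n : ℝ)|⁻¹)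
    split_ifs with hn
    · have h1 := mul_le_mul_of_nonneg_left (abs_secondShift_le hN hodd hn) h0
      have h2 := mul_le_mul_of_nonneg_left (leakMass_le N R n) hK
      have h3 := mul_nonneg hK (leakMass_nonneg N R n)
      rw [← abs_mul, abs_le] at h1
      rw [abs_le]
      constructor <;> nlinarith
    · rw [add_zero, abs_of_nonneg (mul_nonneg hK hβ)]
      linarith

end Steklov

/-! ### Choice of `N`: the sign of the second order coefficient. -/

/-- Pairing `n` with `2 M + 1 - n`, an eventually monotone sequence of negative sum has a negative
sum also with the weights `1 + N / (N - 2 n)`, `N = 2 M + 1`. -/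
theorem eventually_weighted_sum_neg {F : ℕ → ℝ} (hF : Summable F) {n₁ : ℕ}
    (hmono : ∀ m n, n₁ ≤ m → m ≤ n → F m ≤ F n) (hneg : ∑' n, F n < 0) :
    ∀ᶠ M : ℕ in atTop, ∑ n ∈ Finset.range (2 * M + 2),
      F n * (1 + (2 * M + 1 : ℝ) / (2 * M + 1 - 2 * n)) < 0 := by
  -- The cut-off has two roles: the partial sum up to it is negative, and beyond it `F` is monotone.
  obtain ⟨n₀, hn₀, hn₀'⟩ : ∃ n₀, ∑ m ∈ Finset.range n₀, F m < 0 ∧ n₁ ≤ n₀ :=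
    ((hF.hasSum.tendsto_sum_nat.eventually_lt_const hneg).and (eventually_ge_atTop n₁)).exists
  set w : ℕ → ℕ → ℝ := fun M m => (2 * M + 1 : ℝ) / (2 * M + 1 - 2 * m) with hw
  have hNinf : Tendsto (fun M : ℕ => (2 * M + 1 : ℝ)) atTop atTop :=
    tendsto_atTop_add_const_right _ _ (tendsto_natCast_atTop_atTop.const_mul_atTop two_pos)
  have hwlim : ∀ m, Tendsto (fun M => w M m) atTop (𝓝 1) := by
    intro m
    have h1 : Tendsto (fun M : ℕ => (1 - (2 * m : ℝ) / (2 * M + 1))⁻¹) atTop (𝓝 (1 - 0)⁻¹) :=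
      (tendsto_const_nhds.sub (hNinf.const_div_atTop _)).inv₀ (by norm_num)
    rw [sub_zero, inv_one] at h1
    refine h1.congr fun M => ?_
    have : (2 * M + 1 : ℝ) ≠ 0 := by positivity
    simp only [hw]
    rw [one_sub_div this, inv_div]
  have hlim : Tendsto (fun M : ℕ => ∑ n ∈ Finset.range (2 * M + 2), F n
      + ∑ m ∈ Finset.range n₀, w M m * (F m - F (2 * M + 1 - m))) atTop
      (𝓝 (∑' n, F n + ∑ m ∈ Finset.range n₀, 1 * (F m - 0))) := by
    refine Tendsto.add (hF.hasSum.tendsto_sum_nat.comp ?_)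
      (tendsto_finsetSum _ fun m _ => (hwlim m).mul (tendsto_const_nhds.sub
        (hF.tendsto_atTop_zero.comp ?_)))
    · exact tendsto_atTop_mono (fun M => show M ≤ 2 * M + 2 by omega) tendsto_id
    · refine tendsto_atTop_atTop.2 fun b => ⟨b + m, fun M hM => by omega⟩
  have hlt : ∑' n, F n + ∑ m ∈ Finset.range n₀, 1 * (F m - 0) < 0 := by
    simp only [one_mul, sub_zero]
    linarith
  filter_upwards [hlim.eventually_lt_const hlt, eventually_ge_atTop n₀] with M hM hMn
  refine lt_of_le_of_lt ?_ hM
  have hwt : ∀ m ∈ Finset.range (M + 1), 0 < (2 * M + 1 - 2 * m : ℝ) := by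
    intro m hm
    have : (m : ℝ) ≤ M := by exact_mod_cast Nat.lt_succ_iff.1 (Finset.mem_range.1 hm)
    linarith
  have hsplit : ∀ f : ℕ → ℝ, ∑ n ∈ Finset.range (2 * M + 2), f n
      = ∑ m ∈ Finset.range (M + 1), (f m + f (2 * M + 1 - m)) := by
    intro f
    rw [show 2 * M + 2 = (M + 1) + (M + 1) by ring, Finset.sum_range_add, Finset.sum_add_distrib,
      ← Finset.sum_range_reflect (fun i => f (M + 1 + i))]
    congr 1
    refine Finset.sum_congr rfl fun m hm => ?_
    have := Finset.mem_range.1 hm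
    congr 1
    omega
  -- The weight `w` is odd under `m ↦ 2M + 1 - m`, so the weighted part becomes a sum of differences
  -- over `m ≤ M`.
  have h1 : ∑ n ∈ Finset.range (2 * M + 2), F n * (1 + w M n)
      = ∑ n ∈ Finset.range (2 * M + 2), F n
        + ∑ m ∈ Finset.range (M + 1), w M m * (F m - F (2 * M + 1 - m)) := by
    rw [hsplit, hsplit, ← Finset.sum_add_distrib]
    refine Finset.sum_congr rfl fun m hm => ?_
    have h2 : w M (2 * M + 1 - m) = - w M m := by
      have := Finset.mem_range.1 hm
      simp only [hw]
      rw [Nat.cast_sub (by omega), ← div_neg]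
      push_cast
      congr 1
      ring
    rw [h2]
    ring
  -- For `n₀ ≤ m ≤ M` the weight is positive and `F m ≤ F (2M + 1 - m)`, so these terms can be
  -- discarded; on the others, `w → 1` and `F (2M + 1 - m) → 0`.
  have h3 : ∑ m ∈ Finset.range (M + 1), w M m * (F m - F (2 * M + 1 - m))
      ≤ ∑ m ∈ Finset.range n₀, w M m * (F m - F (2 * M + 1 - m)) := by
    rw [← Finset.sum_range_add_sum_Ico _ (show n₀ ≤ M + 1 by omega)]
    refine add_le_of_nonpos_right (Finset.sum_nonpos fun m hm => ?_)
    rw [Finset.mem_Ico] at hm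
    refine mul_nonpos_of_nonneg_of_nonpos
      (div_nonneg (by positivity) (hwt m (Finset.mem_range.2 hm.2)).le) (sub_nonpos.2 ?_)
    exact hmono _ _ (by omega) (by omega)
  simp only [hw] at h1 h3
  rw [h1]
  exact add_le_add_right h3 _

namespace Steklov

/-- The second derivative of `x ^ s log x` has the sign of `s (s - 1) log x + 2 s - 1`, which is
nonpositive up to the chosen `x₀`. Hence `kernelDeriv s (1/n)` eventually increases with `n`. -/
theorem kernelDeriv_antitoneOn {s : ℝ} (hs : 2 < s) :
    ∃ x₀ : ℝ, 0 < x₀ ∧ AntitoneOn (kernelDeriv s) (Set.Ioc 0 x₀) := by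
  refine ⟨Real.exp (-((2 * s - 1) / (s * (s - 1)))), Real.exp_pos _, ?_⟩
  refine antitoneOn_of_deriv_nonpos (convex_Ioc _ _)
    (fun x hx => (hasDerivAt_kernelDeriv hx.1).continuousAt.continuousWithinAt)
    (fun x hx => ?_) fun x hx => ?_
  · rw [interior_Ioc] at hx
    exact (hasDerivAt_kernelDeriv hx.1).differentiableAt.differentiableWithinAt
  · rw [interior_Ioc] at hx
    rw [(hasDerivAt_kernelDeriv hx.1).deriv]
    have h1 : Real.log x ≤ -((2 * s - 1) / (s * (s - 1))) := by
      rw [Real.log_le_iff_le_exp hx.1]; exact hx.2.le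
    have h2 : 0 < s * (s - 1) := by nlinarith
    have h3 := mul_le_mul_of_nonneg_left h1 h2.le
    rw [mul_neg, mul_div_cancel₀ _ h2.ne'] at h3
    exact mul_nonpos_of_nonneg_of_nonpos (Real.rpow_nonneg hx.1.le _) (by linarith)

/-- For `n > N` the couplings to `n ± N` contribute `1/N` and `-1/N`. At `n = N` the coupling to `0`
is absent, and the rank-one term supplies `-1/N = 1/(N - 2N)`, so one formula covers `0 < n ≤ N`;
negative `n` follow by symmetry. -/
theorem fullShift_eq {N n : ℤ} (hN : 0 < N) (hodd : Odd N) (hn : n ≠ 0) :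
    fullShift N n = if |n| ≤ N then 1 / (N : ℝ) + 1 / (N - 2 * |(n : ℝ)|) else 0 := by
  have key : ∀ n : ℤ, 0 < n →
      fullShift N n = if |n| ≤ N then 1 / (N : ℝ) + 1 / (N - 2 * |(n : ℝ)|) else 0 := by
    intro n hn
    have hn' : (0 : ℝ) < n := by exact_mod_cast hn
    have hN' : (0 : ℝ) < N := by exact_mod_cast hN
    have h1 : pairShift n (n + N) = 1 / (N : ℝ) := by
      rw [pairShift, if_neg (by omega)]
      push_cast
      rw [abs_of_pos hn', abs_of_pos (by positivity), add_sub_cancel_left, one_div]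
    rw [fullShift, h1, mul_pow, sq (halfInv n), halfInv_mul_self, abs_of_pos hn, abs_of_pos hn',
      if_neg (show n ≠ -N by omega), pairShift]
    push_cast
    rcases lt_trichotomy n N with h | h | h
    · have h' : (n : ℝ) < N := by exact_mod_cast h
      rw [if_pos h.le, if_neg (by omega), if_neg h.ne, abs_of_neg (by linarith), abs_of_pos hn',
        neg_sub, one_div, one_div]
      ring_nf
    · subst h
      rw [if_pos le_rfl, if_pos (by omega), if_pos rfl]
      field_simp
      ring
    · have h' : (N : ℝ) < n := by exact_mod_cast h
      rw [if_neg (by omega), if_neg h.ne', if_neg (by omega), abs_of_pos (by linarith),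
        abs_of_pos hn',
        sub_sub_cancel_left, inv_neg]
      ring
  rcases hn.lt_or_gt with h | h
  · have h1 := key (-n) (by omega)
    rw [abs_neg, Int.cast_neg, abs_neg] at h1
    rw [← h1, fullShift, fullShift, halfInv_neg, pairShift, pairShift, pairShift, pairShift,
      show -n + N = -(n - N) by ring, show -n - N = -(n + N) by ring]
    simp only [neg_eq_zero, Int.cast_neg, abs_neg, neg_inj]
    simp only [neg_eq_iff_eq_neg]
    ring
  · exact key n h

theorem exists_tsum_fullShift_neg {s : ℝ} (hs : 2 < s)
    (hneg : ∑' k : ℕ, kernelDeriv s ((k : ℝ) + 1)⁻¹ < 0) :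
    ∃ N : ℤ, 0 < N ∧ Odd N ∧ ∑' n : ℤ, kernelDeriv s |(n : ℝ)|⁻¹ * fullShift N n < 0 := by
  set F : ℕ → ℝ := fun n => kernelDeriv s (n : ℝ)⁻¹ with hF
  have hF0 : F 0 = 0 := by simp [hF, kernelDeriv_zero hs]
  have hFs : HasSum F (∑' k : ℕ, kernelDeriv s ((k : ℝ) + 1)⁻¹) := by
    have h1 : HasSum (fun k => F (k + 1)) (∑' k : ℕ, kernelDeriv s ((k : ℝ) + 1)⁻¹) := by
      simpa [hF] using (hasSum_kernelDeriv hs).1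
    have h2 := (hasSum_nat_add_iff (f := F) 1).1 h1
    rwa [Finset.sum_range_one, hF0, add_zero] at h2
  obtain ⟨x₀, hx₀, hanti⟩ := kernelDeriv_antitoneOn hs
  obtain ⟨n₁, hn₁⟩ := exists_nat_gt x₀⁻¹
  have hmono : ∀ m n, n₁ ≤ m → m ≤ n → F m ≤ F n := by
    intro m n hm hmn
    have h1 : (n₁ : ℝ) ≤ m := by exact_mod_cast hm
    have h2 : (m : ℝ) ≤ n := by exact_mod_cast hmn
    have h3 : 0 < x₀⁻¹ := inv_pos.2 hx₀
    have h4 : (m : ℝ)⁻¹ ≤ x₀ := inv_le_of_inv_le₀ hx₀ (by linarith)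
    have h5 : (n : ℝ)⁻¹ ≤ (m : ℝ)⁻¹ := inv_anti₀ (by linarith) h2
    exact hanti ⟨inv_pos.2 (by linarith), h5.trans h4⟩ ⟨inv_pos.2 (by linarith), h4⟩ h5
  obtain ⟨M, hM⟩ := (eventually_weighted_sum_neg hFs.summable hmono
    (by rw [hFs.tsum_eq]; exact hneg)).exists
  refine ⟨2 * M + 1, by positivity, ⟨M, rfl⟩, ?_⟩
  set g : ℝ → ℝ := fun x => kernelDeriv s x * if x⁻¹ ≤ 2 * M + 1 then
    1 / (2 * M + 1 : ℝ) + 1 / (2 * M + 1 - 2 * x⁻¹) else 0 with hg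
  have hN : (0 : ℝ) < 2 * M + 1 := by positivity
  have h1 : HasSum (fun k : ℕ => g ((k : ℝ) + 1)⁻¹) (∑ k ∈ Finset.range (2 * M + 1),
      F (k + 1) * (1 / (2 * M + 1 : ℝ) + 1 / (2 * M + 1 - 2 * ((k + 1 : ℕ) : ℝ)))) := by
    have h2 : HasSum (fun k : ℕ => g ((k : ℝ) + 1)⁻¹)
        (∑ k ∈ Finset.range (2 * M + 1), g ((k : ℝ) + 1)⁻¹) := by
      refine hasSum_sum_of_ne_finset_zero fun k hk => ?_
      have hk' : 2 * M + 1 ≤ k := by simpa using hk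
      have : (2 * M + 1 : ℝ) ≤ k := by exact_mod_cast hk'
      simp only [hg, inv_inv]
      rw [if_neg (by linarith), mul_zero]
    convert! h2 using 1
    refine Finset.sum_congr rfl fun k hk => ?_
    have hk' : k + 1 ≤ 2 * M + 1 := Finset.mem_range.1 hk
    have : ((k : ℝ) + 1) ≤ 2 * M + 1 := by exact_mod_cast hk'
    simp only [hg, inv_inv, hF]
    rw [if_pos this]
    push_cast
    rfl
  have h2 := hasSum_int_of_inv_abs (by simp [hg, kernelDeriv_zero hs]) h1
  have h3 : (fun n : ℤ => kernelDeriv s |(n : ℝ)|⁻¹ * fullShift (2 * M + 1) n)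
      = fun n : ℤ => g |(n : ℝ)|⁻¹ := by
    ext n
    by_cases hn : n = 0
    · simp [hn, hg, kernelDeriv_zero hs]
    · rw [fullShift_eq (by positivity) ⟨M, rfl⟩ hn]
      simp only [hg, inv_inv]
      push_cast
      congr 1
      refine if_congr ?_ rfl rfl
      exact_mod_cast Iff.rfl
  rw [h3, h2.tsum_eq]
  -- The term `n = 0` is free because `F 0 = 0`, and `N = 2M + 1` is factored out.
  have h4 : ∑ n ∈ Finset.range (2 * M + 2), F n * (1 + (2 * M + 1 : ℝ) / (2 * M + 1 - 2 * n))
      = (2 * M + 1) * ∑ k ∈ Finset.range (2 * M + 1),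
        F (k + 1) * (1 / (2 * M + 1 : ℝ) + 1 / (2 * M + 1 - 2 * ((k + 1 : ℕ) : ℝ))) := by
    rw [Finset.sum_range_succ', hF0, zero_mul, add_zero, Finset.mul_sum]
    refine Finset.sum_congr rfl fun k _ => ?_
    field_simp
  rw [h4] at hM
  have := neg_of_mul_neg_right hM hN.le
  linarith

/-- For suitable `N` the trace of `f (T_ε)` decreases to second order. -/
theorem exists_eventually_tsum_lt {s : ℝ} (hs : 2 < s)
    (hneg : ∑' k : ℕ, kernelDeriv s ((k : ℝ) + 1)⁻¹ < 0) :
    ∃ N : ℤ, N ≠ 0 ∧ ∀ᶠ t in 𝓝[≠] (0 : ℝ), ∀ (_ : |t| ≤ 1 / 4) {J : Type}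
      {ψ : HilbertBasis J ℂ SeqSpace} {μ : J → ℝ}, (∀ j, invOp N t (ψ j) = (μ j : ℂ) • ψ j) →
      ∑' j, μ j ^ s * Real.log (μ j) <
        2 * ∑' k : ℕ, ((k : ℝ) + 1)⁻¹ ^ s * Real.log ((k : ℝ) + 1)⁻¹ := by
  obtain ⟨N, hN, hodd, hlt⟩ := exists_tsum_fullShift_neg hs hneg
  obtain ⟨K, hK, hKle⟩ := exists_kernel_le hs
  obtain ⟨R, hR, hR'⟩ := (((tendsto_traceCoeff hN.ne' hodd hs hK).eventually_lt_const hlt).and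
    (eventually_ge_atTop N.natAbs)).exists
  exact ⟨N, hN.ne', eventually_tsum_lt hN.ne' hodd (by rw [Int.abs_eq_natAbs]; omega) hs hKle hR⟩

end Steklov

/-! ### Smallness of the perturbation, normalization, and part (i). -/

/-- Derivatives in one variable of a jointly smooth function are jointly smooth. -/
theorem exists_contDiffOn_iteratedDeriv {g : ℝ → ℝ → ℝ} {S : Set ℝ} (hS : IsOpen S)
    (hg : ContDiffOn ℝ ∞ (fun p : ℝ × ℝ => g p.1 p.2) (S ×ˢ univ)) (k : ℕ) :
    ContDiffOn ℝ ∞ (fun p : ℝ × ℝ => iteratedDeriv k (g p.1) p.2) (S ×ˢ univ) := by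
  have hopen : IsOpen (S ×ˢ (univ : Set ℝ)) := hS.prod isOpen_univ
  induction k with
  | zero => simpa only [iteratedDeriv_zero] using hg
  | succ k ih =>
    have h1 := (ih.fderiv_of_isOpen hopen (m := ∞) (by simp)).clm_apply
      (contDiffOn_const (c := ((0, 1) : ℝ × ℝ)))
    refine h1.congr fun p hp => ?_
    have h2 : HasFDerivAt (fun p : ℝ × ℝ => iteratedDeriv k (g p.1) p.2) _ p :=
      ((ih.contDiffAt (hopen.mem_nhds hp)).differentiableAt (by simp)).hasFDerivAt
    have h3 : HasDerivAt (fun θ : ℝ => ((p.1, θ) : ℝ × ℝ)) (0, 1) p.2 :=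
      (hasDerivAt_const _ _).prodMk (hasDerivAt_id _)
    have h4 := h2.comp_hasDerivAt p.2 h3
    rw [iteratedDeriv_succ]
    exact h4.deriv

namespace Steklov

theorem SmoothCircle.tendsto_nhds {ι : Type*} {l : Filter ι} {A : ι → SmoothCircle ℝ}
    {a : SmoothCircle ℝ} (h : ∀ k, TendstoUniformly (fun i => iteratedDeriv k (A i))
      (iteratedDeriv k a) l) : Tendsto A l (𝓝 a) := by
  rw [nhds_iInf, tendsto_iInf]
  intro k
  rw [nhds_induced, tendsto_comap_iff, UniformFun.tendsto_iff_tendstoUniformly]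
  exact h k

theorem iteratedDeriv_periodic (f : SmoothCircle ℝ) (k : ℕ) :
    Function.Periodic (iteratedDeriv k f) (2 * π) := by
  intro θ
  have h := iteratedDeriv_comp_add_const k (f : ℝ → ℝ) (2 * π)
  have h2 : (fun z => f (z + 2 * π)) = f := funext f.periodic
  rw [h2] at h
  exact (congrFun h θ).symm

/-- The weight is jointly smooth in `(ε, θ)`, and joint continuity of each `θ`-derivative on the
compact period gives uniform convergence as `ε → 0`. -/
theorem eventually_weight_mem (N : ℤ) {U : Set (SmoothCircle ℝ)} (hU : U ∈ 𝓝 (1 : SmoothCircle ℝ)) :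
    ∀ᶠ ε in 𝓝 (0 : ℝ), ∀ hε : |ε| ≤ 1 / 4, weight N ε hε ∈ U := by
  classical
  set A : ℝ → SmoothCircle ℝ := fun ε => if hε : |ε| ≤ 1 / 4 then weight N ε hε else 1 with hA
  have hA0 : A 0 = 1 := by
    ext θ
    simp [hA, weight_apply, density_apply]
  set S : Set ℝ := Metric.ball 0 (1 / 4)
  have hS : IsOpen S := Metric.isOpen_ball
  have hAS : ∀ ε ∈ S, ∀ θ, A ε θ = (1 + 2 * ε * Real.cos (N * θ))⁻¹ := by
    intro ε hε θ
    have h : |ε| ≤ 1 / 4 := by simpa [S] using (Metric.mem_ball.1 hε).le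
    simp only [hA, dif_pos h, weight_apply, density_apply]
  have hsm : ContDiffOn ℝ ∞ (fun p : ℝ × ℝ => A p.1 p.2) (S ×ˢ univ) := by
    have h1 : ContDiffOn ℝ ∞ (fun p : ℝ × ℝ => (1 + 2 * p.1 * Real.cos (N * p.2))⁻¹) (S ×ˢ univ) := by
      refine ContDiffOn.inv (by fun_prop) fun p hp => ?_
      have h : |p.1| ≤ 1 / 4 := by simpa [S] using (Metric.mem_ball.1 hp.1).le
      exact (density_pos N h p.2).ne'
    exact h1.congr fun p hp => hAS p.1 hp.1 p.2
  have htend : Tendsto A (𝓝 0) (𝓝 1) := by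
    rw [← hA0]
    refine SmoothCircle.tendsto_nhds fun k => ?_
    have hcont : ContinuousOn (fun p : ℝ × Icc (0 : ℝ) (2 * π) => iteratedDeriv k (A p.1) p.2)
        (S ×ˢ univ) :=
      (exists_contDiffOn_iteratedDeriv (g := fun ε => (A ε : ℝ → ℝ)) hS hsm k).continuousOn.comp
        (f := fun p : ℝ × Icc (0 : ℝ) (2 * π) => (p.1, (p.2 : ℝ)))
        (Continuous.continuousOn (by fun_prop)) fun p hp => ⟨hp.1, mem_univ _⟩
    have hu := ContinuousOn.tendstoUniformly
      (f := fun (ε : ℝ) (θ : Icc (0 : ℝ) (2 * π)) => iteratedDeriv k (A ε) θ)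
      (hS.mem_nhds (Metric.mem_ball_self (by norm_num))) hcont
    rw [Metric.tendstoUniformly_iff] at hu ⊢
    intro δ hδ
    filter_upwards [hu δ hδ] with ε hε θ
    have hper : Function.Periodic (fun θ => (iteratedDeriv k (A 0) θ, iteratedDeriv k (A ε) θ))
        (2 * π) := fun θ => Prod.ext (iteratedDeriv_periodic _ k θ) (iteratedDeriv_periodic _ k θ)
    obtain ⟨y, hy, h⟩ := hper.exists_mem_Ico₀ Real.two_pi_pos θ
    rw [Prod.mk.injEq] at h
    rw [h.1, h.2]
    exact hε ⟨y, Ico_subset_Icc_self hy⟩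
  filter_upwards [htend.eventually_mem hU] with ε h hε
  simpa only [hA, dif_pos hε] using h

theorem integral_one_div_weight {N : ℤ} (hN : N ≠ 0) {ε : ℝ} (hε : |ε| ≤ 1 / 4) :
    (1 / (2 * π)) * (∫ θ in (0 : ℝ)..(2 * π), 1 / weight N ε hε θ) = 1 := by
  have hN' : (N : ℝ) ≠ 0 := by exact_mod_cast hN
  simp only [weight_apply, density_apply, one_div, inv_inv]
  have hsin : Real.sin (N * (2 * π)) = 0 := by
    have := Real.sin_int_mul_pi (2 * N)
    push_cast at this
    rw [← this]
    ring_nf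
  rw [intervalIntegral.integral_add (continuous_const.intervalIntegrable _ _)
    ((by fun_prop : Continuous fun θ : ℝ => 2 * ε * Real.cos (N * θ)).intervalIntegrable _ _),
    intervalIntegral.integral_const_mul, intervalIntegral.integral_comp_mul_left _ hN', integral_cos,
    hsin]
  have := Real.two_pi_pos
  simp only [mul_zero, Real.sin_zero, sub_zero, smul_eq_mul, mul_zero, add_zero,
    intervalIntegral.integral_const, mul_one]
  exact inv_mul_cancel₀ this.ne'

/-- The `n`-th term is `n^{1-s} (1 - s log n)`, which is negative for `n ≥ 2` and `s > 2`. So it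
suffices that a finite partial sum be negative at `s = 2`; continuity of that partial sum then
yields an interval, although the full series is used only for `s > 2`. -/
theorem exists_tsum_kernelDeriv_neg :
    ∃ s₀ : ℝ, 2 < s₀ ∧ ∀ s ∈ Set.Ioo 2 s₀, ∑' k : ℕ, kernelDeriv s ((k : ℝ) + 1)⁻¹ < 0 := by
  have hl := Real.log_two_gt_d9
  have hcont : Continuous fun s : ℝ => ∑ k ∈ Finset.range 8, kernelDeriv s ((k : ℝ) + 1)⁻¹ := by
    refine continuous_finsetSum _ fun k _ => ?_
    unfold kernelDeriv
    have h : Continuous fun s : ℝ => ((k : ℝ) + 1)⁻¹ ^ (s - 1) :=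
      (Real.continuous_const_rpow (by positivity)).comp (continuous_id.sub continuous_const)
    exact h.mul (by fun_prop)
  -- Eight terms leave room for the crude bounds `log 3 ≥ log 2` and `log 5, …, log 8 ≥ 2 log 2`.
  have hneg : ∑ k ∈ Finset.range 8, kernelDeriv 2 ((k : ℝ) + 1)⁻¹ < 0 := by
    have h2 : Real.log 4 = 2 * Real.log 2 := by
      rw [show (4 : ℝ) = 2 ^ 2 by norm_num, Real.log_pow]; norm_num
    have h3 : Real.log 2 ≤ Real.log 3 := Real.log_le_log (by norm_num) (by norm_num)
    have h5 : Real.log 4 ≤ Real.log 5 := Real.log_le_log (by norm_num) (by norm_num)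
    have h6 : Real.log 4 ≤ Real.log 6 := Real.log_le_log (by norm_num) (by norm_num)
    have h7 : Real.log 4 ≤ Real.log 7 := Real.log_le_log (by norm_num) (by norm_num)
    have h8 : Real.log 4 ≤ Real.log 8 := Real.log_le_log (by norm_num) (by norm_num)
    simp only [kernelDeriv, Real.log_inv, Finset.sum_range_succ, Finset.sum_range_zero]
    norm_num
    linarith
  have hev : ∀ᶠ s in 𝓝[>] (2 : ℝ), ∑ k ∈ Finset.range 8, kernelDeriv s ((k : ℝ) + 1)⁻¹ < 0 :=
    nhdsWithin_le_nhds (hcont.continuousAt.eventually_lt_const hneg)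
  obtain ⟨s₀, hs₀, h⟩ := mem_nhdsGT_iff_exists_Ioo_subset.1 hev
  refine ⟨s₀, hs₀, fun s hs => lt_of_le_of_lt ?_ (h hs)⟩
  have hle := sum_le_hasSum (Finset.range 8) (fun k hk => ?_) (hasSum_kernelDeriv hs.1).1.neg
  · rw [Finset.sum_neg_distrib] at hle
    exact neg_le_neg_iff.1 hle
  · have hk' : 8 ≤ k := by simpa using hk
    have hk2 : (8 : ℝ) ≤ k := by exact_mod_cast hk'
    have hlog : Real.log 2 ≤ Real.log ((k : ℝ) + 1) := Real.log_le_log (by norm_num) (by linarith)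
    rw [kernelDeriv, Real.log_inv, ← mul_neg]
    refine mul_nonneg (by positivity) ?_
    nlinarith [hs.1]

end Steklov

theorem proposition7 :
    (∃ s₀ : ℝ, 2 < s₀ ∧ ∀ s ∈ Set.Ioo 2 s₀,
      riemannZeta ((s : ℂ) - 1) + (s : ℂ) * deriv riemannZeta ((s : ℂ) - 1) < 0) ∧
    ∀ s₀ : ℝ, 2 < s₀ →
      (∀ s ∈ Set.Ioo 2 s₀,
        riemannZeta ((s : ℂ) - 1) + (s : ℂ) * deriv riemannZeta ((s : ℂ) - 1) < 0) →
      ∀ U ∈ 𝓝 (1 : Steklov.SmoothCircle ℝ), ∀ s ∈ Set.Ioo 2 s₀,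
        ∃ a ∈ U, ∃ ha : ∀ θ, 0 < a θ,
          (1 / (2 * π)) * (∫ θ in (0 : ℝ)..(2 * π), 1 / a θ) = 1 ∧
          (∀ z : ℂ, 1 < z.re →
            Summable fun k : ℕ => (Steklov.steklovEigenvalue a ha (k + 1) : ℂ) ^ (-z)) ∧
          DifferentiableAt ℂ (Steklov.steklovZeta a ha) (s : ℂ) ∧
          deriv (Steklov.steklovZeta a ha) (s : ℂ) < 2 * deriv riemannZeta (s : ℂ) := by
  open Steklov in
  -- The order on `ℂ` compares only numbers with equal imaginary parts; here both sides are real, so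
  -- it reduces to the order on `ℝ`.
  have hiff : ∀ s : ℝ, 2 < s → (riemannZeta ((s : ℂ) - 1) + (s : ℂ) * deriv riemannZeta ((s : ℂ) - 1) < 0
      ↔ ∑' k : ℕ, kernelDeriv s ((k : ℝ) + 1)⁻¹ < 0) := by
    intro s hs
    rw [(hasSum_kernelDeriv hs).2, ← Complex.ofReal_zero, Complex.real_lt_real]
  refine ⟨?_, fun s₀ hs₀ hneg U hU s hs => ?_⟩
  · obtain ⟨s₀, hs₀, h⟩ := exists_tsum_kernelDeriv_neg
    exact ⟨s₀, hs₀, fun s hs => (hiff s hs.1).2 (h s hs)⟩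
  · obtain ⟨N, hN, hev⟩ := exists_eventually_tsum_lt hs.1 ((hiff s hs.1).1 (hneg s hs))
    have hsmall : ∀ᶠ ε in 𝓝[≠] (0 : ℝ), |ε| ≤ 1 / 4 := by
      refine nhdsWithin_le_nhds ?_
      filter_upwards [Metric.closedBall_mem_nhds (0 : ℝ) (show (0 : ℝ) < 1 / 4 by norm_num)] with ε hε
      simpa using hε
    obtain ⟨ε, hlt, hmem, hε⟩ := (hev.and (((eventually_weight_mem N hU).filter_mono
      nhdsWithin_le_nhds).and hsmall)).exists
    obtain ⟨J, ψ, μ, hμ⟩ := exists_hilbertBasis_eigenvectors (invOp_compact N ε) (invOp_symm N ε)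
    obtain ⟨h1, h2⟩ := steklovEigenvalue_summable hN hε hμ
    have hs1 : 1 < s := by linarith [hs.1]
    obtain ⟨h3, -, h4⟩ := steklovZeta_deriv hN hε hμ hs1
    refine ⟨weight N ε hε, hmem hε, weight_pos N hε, integral_one_div_weight hN hε, fun z hz => ?_,
      h3, ?_⟩
    · exact summable_ofReal_cpow_neg h1 h2 hz
    · rw [h4, (deriv_riemannZeta_eq hs1).2]
      exact_mod_cast hlt hε hμ
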